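/- Let $\mathcal G$ be a locally finite connected planar graph drawn in $\mathbb R^2$ with straight edges that meet only at common end-points, with finitely many vertices in every bounded set, and invariant under the translations by $(1,0)$ and $(0,1)$, the rotation by $\pi/2$ around the origin, and the reflection in the line $\{0\}\times\mathbb R$. Let $E$ be its edge set, $q\ge 1$ and $p\in(0,1)$. For a finite set $F\subset E$, let $V_F$ be the set of end-points of edges of $F$ and $\partial F$ the set of vertices of $V_F$ incident to an edge of $E\setminus F$. For a partition $\xi$ of $\partial F$, the random-cluster measure $\phi^{\xi}_{F}$ on $\{0,1\}^{F}$ gives $\eta$ a probability proportional to $p^{o(\eta)}(1-p)^{c(\eta)}q^{k(\eta^\xi)}$, where $o(\eta)$ and $c(\eta)$ are the numbers of open and closed edges and $k(\eta^\xi)$ is the number of connected components of the graph with vertex set $V_F$ and the open edges of $\eta$ after the vertices in each class of $\xi$ have been identified. An infinite-volume measure is a probability measure on $\{0,1\}^{E}$ such that for every finite $F\subset E$, conditionally on the event (whenever it has positive probability) that the partition of $\partial F$ induced by open paths in $E\setminus F$ is $\xi$, the configuration in $F$ has law $\phi^{\xi}_{F}$. Assume that there is exactly one infinite-volume measure with parameters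 $p,q$, and call it $\phi_p$. Open paths are regarded as curves in the plane, contained in the union of the open edges (as closed segments). For $b,d>0$, a horizontal (vertical) crossing of $[0,b]\times[0,d]$ is an open path contained in this rectangle from its left to its right side (from its bottom to its top side); $\mathcal C_h(b,d)$ and $\mathcal C_v(b,d)$ are the events that such crossings exist. Crossings of a rectangle are separated if no two of them are connected by an open path contained in the rectangle. There exist universal constants $c_0,c_1>0$ (independent of $\mathcal G,q,p,n,I$) such that for all $n\in\mathbb N$ and every integer $1\le I\le n/400$ with $$I^2\le c_0\,\frac{\phi_p(\mathcal C_v(2n,n))}{\phi_p(\mathcal C_h(2n,n))^{c_1/I}},$$ we have $$\phi_p\big([0,2n]\times[0,n/2]\text{ has }2^I\text{ separated vertical crossings}\big)\ \ge\ \tfrac12\,\phi_p(\mathcal C_v(2n,n)).$$ -/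

import Mathlib

/-- The Euclidean plane in coordinates (only its topology and affine structure are used). -/
abbrev Plane : Type := ℝ × ℝ

/-- `τ` maps the graph `(V, G)` drawn in the plane to itself (it is used for bijections `τ`). -/
def IsGraphSymmetry (V : Set Plane) (G : SimpleGraph Plane) (τ : Plane → Plane) : Prop :=
  (∀ x, τ x ∈ V ↔ x ∈ V) ∧ ∀ x y, G.Adj (τ x) (τ y) ↔ G.Adj x y

/-- A connected locally finite planar graph, drawn in the plane with straight edges that meet only
at common end-points, and invariant under the translations by `(1,0)` and `(0,1)`, the rotation by
`π/2` around the origin and the reflection in the vertical axis.  The vertex set is `V`; points of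
the plane outside `V` are not vertices and have no neighbours. -/
structure PlanarLattice where
  V : Set Plane
  graph : SimpleGraph Plane
  mem_of_adj : ∀ x y, graph.Adj x y → x ∈ V
  connected : (graph.induce V).Connected
  finite_neighbors : ∀ x, (graph.neighborSet x).Finite
  finite_of_bounded : ∀ B : Set Plane, Bornology.IsBounded B → (V ∩ B).Finite
  planar : ∀ a b c d, graph.Adj a b → graph.Adj c d → s(a, b) ≠ s(c, d) →
    segment ℝ a b ∩ segment ℝ c d ⊆ ({a, b} ∩ {c, d} : Set Plane)
  translation_right : IsGraphSymmetry V graph (fun z => (z.1 + 1, z.2))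
  translation_up : IsGraphSymmetry V graph (fun z => (z.1, z.2 + 1))
  rotation : IsGraphSymmetry V graph (fun z => (-z.2, z.1))
  reflection : IsGraphSymmetry V graph (fun z => (-z.1, z.2))

namespace PlanarLattice

variable (L : PlanarLattice)

/-- The edges of the lattice. -/
abbrev Edge : Type := L.graph.edgeSet

/-- Configurations: `ω e = true` means that `e` is open. -/
abbrev Config : Type := L.Edge → Bool

/-! ### Random-cluster measures on finite subgraphs

A finite subgraph is given by its finite set `F` of edges; its vertices are the end-points. -/

/-- The vertices of the finite subgraph with edge set `F`. -/
def verts (F : Finset L.Edge) : Set Plane := {x | ∃ e ∈ F, x ∈ (e : Sym2 Plane)}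

/-- The boundary: the vertices of the subgraph incident to an edge of the lattice outside `F`. -/
def boundary (F : Finset L.Edge) : Set Plane :=
  {x | x ∈ L.verts F ∧ ∃ e : L.Edge, e ∉ F ∧ x ∈ (e : Sym2 Plane)}

/-- Boundary conditions: partitions of the boundary, as equivalence relations. -/
abbrev BoundaryCondition (F : Finset L.Edge) : Type := Setoid (L.boundary F)

/-- The graph on the vertices of `F` whose edges are the open edges of `η` together with an edge
between any two distinct boundary vertices in the same class of `ξ`.  Its connected components
correspond to those of the graph obtained from `η` by identifying the vertices of each class. -/
def wiredGraph (F : Finset L.Edge) (ξ : L.BoundaryCondition F) (η : F → Bool) :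
    SimpleGraph (L.verts F) :=
  SimpleGraph.fromRel fun x y =>
    (∃ e : F, η e = true ∧ ((e : L.Edge) : Sym2 Plane) = s((x : Plane), (y : Plane))) ∨
    ∃ (hx : (x : Plane) ∈ L.boundary F) (hy : (y : Plane) ∈ L.boundary F), ξ.r ⟨x, hx⟩ ⟨y, hy⟩

/-- The number of clusters of the wired configuration. -/
noncomputable def numClusters (F : Finset L.Edge) (ξ : L.BoundaryCondition F) (η : F → Bool) : ℕ :=
  Nat.card (L.wiredGraph F ξ η).ConnectedComponent

/-- The weight `p ^ (number of open edges) (1 - p) ^ (number of closed edges) q ^ (clusters)`. -/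
noncomputable def weight (p q : ℝ) (F : Finset L.Edge) (ξ : L.BoundaryCondition F)
    (η : F → Bool) : ℝ :=
  p ^ Nat.card {e : F // η e = true} * (1 - p) ^ Nat.card {e : F // η e = false} *
    q ^ L.numClusters F ξ η

open Classical in
/-- The partition function. -/
noncomputable def partitionFunction (p q : ℝ) (F : Finset L.Edge) (ξ : L.BoundaryCondition F) : ℝ :=
  ∑ η : F → Bool, L.weight p q F ξ η

/-- The probability of `η` under the random-cluster measure on `F` with boundary condition `ξ`. -/
noncomputable def finiteVolumeProb (p q : ℝ) (F : Finset L.Edge) (ξ : L.BoundaryCondition F)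
    (η : F → Bool) : ℝ :=
  L.weight p q F ξ η / L.partitionFunction p q F ξ

/-! ### Infinite-volume measures -/

/-- The boundary condition on `F` induced by `ω`: two boundary vertices are wired when they are
connected by a path of open edges outside `F`. -/
def inducedBC (F : Finset L.Edge) (ω : L.Config) : L.BoundaryCondition F :=
  (SimpleGraph.fromEdgeSet
    {e : Sym2 Plane | ∃ h : e ∈ L.graph.edgeSet, (⟨e, h⟩ : L.Edge) ∉ F ∧ ω ⟨e, h⟩ = true}
    ).reachableSetoid.comap Subtype.val

/-- Infinite-volume random-cluster measures: probability measures on configurations such that, for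
every finite subgraph `F`, conditionally on the induced boundary condition being `ξ`, the
configuration in `F` follows the random-cluster measure on `F` with boundary condition `ξ`. -/
def IsInfiniteVolume (p q : ℝ) (φ : MeasureTheory.Measure L.Config) : Prop :=
  MeasureTheory.IsProbabilityMeasure φ ∧
    ∀ (F : Finset L.Edge) (ξ : L.BoundaryCondition F), φ {ω | L.inducedBC F ω = ξ} ≠ 0 →
      ∀ η : F → Bool,
        ProbabilityTheory.cond φ {ω | L.inducedBC F ω = ξ} {ω | ∀ e : F, ω e = η e} =
          ENNReal.ofReal (L.finiteVolumeProb p q F ξ η)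

/-! ### Crossings of rectangles

Open paths are regarded as curves in the plane, so that crossings also make sense when no vertex
lies on a side of the rectangle; an edge that leaves the rectangle counts up to the side. -/

/-- The union of the open edges, as a subset of the plane. -/
def openSet (ω : L.Config) : Set Plane :=
  {z | ∃ (x y : Plane) (h : L.graph.Adj x y), ω ⟨s(x, y), h⟩ = true ∧ z ∈ segment ℝ x y}

/-- `x` and `y` are connected by an open path inside `[a,b] × [c,d]`. -/
def ConnectedInRect (ω : L.Config) (a b c d : ℝ) (x y : Plane) : Prop :=
  JoinedIn (L.openSet ω ∩ Set.Icc a b ×ˢ Set.Icc c d) x y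

/-- `[0,b] × [0,d]` contains an open path from its left side to its right side. -/
def horizontalCrossing (b d : ℝ) : Set L.Config :=
  {ω | ∃ x y : Plane, x.1 = 0 ∧ y.1 = b ∧ L.ConnectedInRect ω 0 b 0 d x y}

/-- `[0,b] × [0,d]` contains an open path from its bottom side to its top side. -/
def verticalCrossing (b d : ℝ) : Set L.Config :=
  {ω | ∃ x y : Plane, x.2 = 0 ∧ y.2 = d ∧ L.ConnectedInRect ω 0 b 0 d x y}

/-- `[0,b] × [0,d]` contains `K` vertical crossings (the `i`-th one from `x i` to `y i`), no two of
which are connected by an open path inside `[0,b] × [0,d]`. -/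
def separatedVerticalCrossings (b d : ℝ) (K : ℕ) : Set L.Config :=
  {ω | ∃ x y : Fin K → Plane,
    (∀ i, (x i).2 = 0 ∧ (y i).2 = d ∧ L.ConnectedInRect ω 0 b 0 d (x i) (y i)) ∧
    ∀ i j, i ≠ j → ¬ L.ConnectedInRect ω 0 b 0 d (x i) (x j)}

end PlanarLattice

/-!
The unique infinite-volume measure is determined by the conditional law of each single edge given
the others. It is therefore invariant under the symmetries of the lattice, and positively
associated.

Rescale so that the rectangle has height about `N`, with `N` of the order of `I`. Call a crossing of
a horizontal strip exceptional if it drifts to one side, stays on one side, visits the two sides in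
only one order, or is a long horizontal crossing. Translates and reflections of drifting or long
crossings meet by planarity, and `O(N)` of them can be glued to a horizontal crossing of the
`2N × N` rectangle; two crossings of one of the other kinds, side by side, force a simpler
exceptional crossing. By positive association, the probability of an exceptional crossing is thus at
most a multiple of a root, of order `1 / N`, of the probability of the horizontal crossing, and a
union bound over `O(N ^ 3)` places excludes all of them.

Without exceptional crossings, a crossing of a strip of height `h + 36` has a horizontal pass, which
stays in the middle of the strip and, seen from the side, makes two passes separated from each
other. Each of these contains a crossing of the middle strip of height `h`, so `I` iterations turn
one crossing into `2 ^ I` separated ones.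
-/

/-! ### Crossing curves in the plane -/

section PlanarCurves

open Set unitInterval

lemma exists_continuous_log (F : C(I × I, ℂ)) (hF : ∀ x, F x ≠ 0) :
    ∃ G : C(I × I, ℂ), G (0, 0) = Complex.log (F (0, 0)) ∧ ∀ x, Complex.exp (G x) = F x := by
  let r : C(ℝ × ℝ, I × I) :=
    ⟨fun x => (projIcc 0 1 zero_le_one x.1, projIcc 0 1 zero_le_one x.2), by fun_prop⟩
  let i : C(I × I, ℝ × ℝ) := ⟨fun x => (x.1, x.2), by fun_prop⟩
  have hri : ∀ x, r (i x) = x := fun x => by simp [r, i]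
  have : SimplyConnectedSpace (ℝ × ℝ) := SimplyConnectedSpace.ofContractible _
  obtain ⟨G, ⟨hG₀, hG⟩, -⟩ := Complex.isCoveringMapOn_exp.existsUnique_continuousMap_lifts
    (F.comp r) (a₀ := i (0, 0)) (e₀ := Complex.log (F (0, 0)))
    ((Complex.exp_log (hF _)).trans (by simp only [ContinuousMap.comp_apply, hri]))
    fun x => hF (r x)
  refine ⟨G.comp i, hG₀, fun x => ?_⟩
  simpa only [Function.comp_apply, ContinuousMap.comp_apply, hri] using congrFun hG (i x)

lemma lt_one_of_forall_ne {θ : I → ℝ} (hθ : Continuous θ) {c : ℝ} (h₀ : c < θ 0)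
    (hne : ∀ t, θ t ≠ c) : c < θ 1 := by
  by_contra! h₁
  obtain ⟨t, ht⟩ := mem_range_of_exists_le_of_exists_ge hθ ⟨1, h₁⟩ ⟨0, h₀.le⟩
  exact hne t ht

/-- Otherwise `a + i b` has a continuous argument. It starts in `[-π/2, π/2]`; it cannot pass
below `-π/2` along the bottom and right sides, nor above `π/2` along the left and top sides, so
`a > 0` at the opposite corner. -/
lemma exists_common_zero_of_signs {a b : I × I → ℝ} (ha : Continuous a) (hb : Continuous b)
    (h₀₀ : 0 ≤ a (0, 0)) (h₁₁ : a (1, 1) ≤ 0)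
    (bottom : ∀ s, a (s, 0) = 0 → 0 ≤ b (s, 0)) (right : ∀ t, a (1, t) = 0 → 0 ≤ b (1, t))
    (left : ∀ t, a (0, t) = 0 → b (0, t) ≤ 0) (top : ∀ s, a (s, 1) = 0 → b (s, 1) ≤ 0) :
    ∃ x, a x = 0 ∧ b x = 0 := by
  by_contra! hne
  obtain ⟨G, hG₀, hG⟩ := exists_continuous_log ⟨fun x => ⟨a x, b x⟩, by
    simpa only [Complex.mk_eq_add_mul_I] using by fun_prop⟩
    fun x h => hne x (congrArg Complex.re h) (congrArg Complex.im h)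
  have ha_eq : ∀ x, a x = Real.exp (G x).re * Real.cos (G x).im := fun x => by
    rw [← Complex.exp_re, hG]; rfl
  have hb_eq : ∀ x, b x = Real.exp (G x).re * Real.sin (G x).im := fun x => by
    rw [← Complex.exp_im, hG]; rfl
  have lower : ∀ x, (a x = 0 → 0 ≤ b x) → (G x).im ≠ -(Real.pi / 2) := fun x h h' => by
    have := h (by rw [ha_eq, h', Real.cos_neg, Real.cos_pi_div_two, mul_zero])
    rw [hb_eq, h', Real.sin_neg, Real.sin_pi_div_two] at this
    linarith [Real.exp_pos (G x).re]
  have upper : ∀ x, (a x = 0 → b x ≤ 0) → -(G x).im ≠ -(Real.pi / 2) := fun x h h' => by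
    rw [neg_inj] at h'
    have := h (by rw [ha_eq, h', Real.cos_pi_div_two, mul_zero])
    rw [hb_eq, h', Real.sin_pi_div_two] at this
    linarith [Real.exp_pos (G x).re]
  have start : |(G (0, 0)).im| < Real.pi / 2 := by
    have : |(G (0, 0)).im| ≤ Real.pi / 2 := by
      rw [hG₀, Complex.log_im, Complex.abs_arg_le_pi_div_two_iff]; exact h₀₀
    refine this.lt_of_ne fun h => ?_
    rcases eq_or_eq_neg_of_abs_eq h with h | h
    · exact upper _ (left 0) (congrArg Neg.neg h)
    · exact lower _ (bottom 0) h
  have end_gt : -(Real.pi / 2) < (G (1, 1)).im :=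
    lt_one_of_forall_ne (θ := fun t => (G (1, t)).im) (by fun_prop)
      (lt_one_of_forall_ne (θ := fun s => (G (s, 0)).im) (by fun_prop) (abs_lt.1 start).1
        fun s => lower _ (bottom s)) fun t => lower _ (right t)
  have end_lt : -(Real.pi / 2) < -(G (1, 1)).im :=
    lt_one_of_forall_ne (θ := fun s => -(G (s, 1)).im) (by fun_prop)
      (lt_one_of_forall_ne (θ := fun t => -(G (0, t)).im) (by fun_prop)
        (neg_lt_neg (abs_lt.1 start).2) fun t => upper _ (left t)) fun s => upper _ (top s)
  refine absurd h₁₁ (not_le.2 ?_)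
  rw [ha_eq]
  exact mul_pos (Real.exp_pos _) (Real.cos_pos_of_mem_Ioo ⟨end_gt, by linarith⟩)

section Subcurves

variable {X : Type*} [TopologicalSpace X] {A : Set X} {x y z : X}

lemma joinedIn_apply_of_forall_mem {γ : Path x y} (hγ : ∀ t, γ t ∈ A) (s t : I) :
    JoinedIn A (γ s) (γ t) :=
  ⟨γ.subpath s t, fun _ => hγ _⟩

lemma joinedIn_source_of_forall_mem {γ : Path x y} (hγ : ∀ t, γ t ∈ A) (t : I) :
    JoinedIn A x (γ t) := by
  simpa only [γ.source] using joinedIn_apply_of_forall_mem hγ 0 t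

lemma joinedIn_target_of_forall_mem {γ : Path x y} (hγ : ∀ t, γ t ∈ A) (t : I) :
    JoinedIn A (γ t) y := by
  simpa only [γ.target] using joinedIn_apply_of_forall_mem hγ t 1

lemma joinedIn_trans_of_subset {B C : Set X} (h₁ : JoinedIn A x y) (h₂ : JoinedIn B y z)
    (hA : A ⊆ C) (hB : B ⊆ C) : JoinedIn C x z :=
  (h₁.mono hA).trans (h₂.mono hB)

lemma joinedIn_of_mapsTo {Y : Type*} [TopologicalSpace Y] {B : Set Y} (h : JoinedIn A x y)
    {f : X → Y} (hf : Continuous f) (hAB : MapsTo f A B) : JoinedIn B (f x) (f y) :=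
  (h.map hf).mono hAB.image_subset

variable {f : X → ℝ} {c : ℝ}

lemma exists_first_visit (h : JoinedIn A x y) (hf : Continuous f) (hx : f x ≤ c)
    (hy : c ≤ f y) : ∃ z, f z = c ∧ JoinedIn (A ∩ {v | f v ≤ c}) x z ∧ JoinedIn A z y := by
  obtain ⟨γ, hγ⟩ := h
  have hfγ : Continuous fun t => f (γ t) := hf.comp γ.continuous
  have ivt : ∀ s : I, c ≤ f (γ s) → ∃ t ≤ s, f (γ t) = c := fun s hs => by
    obtain ⟨t, ht, hft⟩ := intermediate_value_Icc (nonneg' : (0 : I) ≤ s) hfγ.continuousOn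
      ⟨by simpa only [γ.source] using hx, hs⟩
    exact ⟨t, ht.2, hft⟩
  obtain ⟨t, ht, hmin⟩ := (isClosed_eq hfγ continuous_const).isCompact.exists_isLeast
    (s := {t | f (γ t) = c})
    ((ivt 1 (by simpa only [γ.target] using hy)).imp fun _ h => h.2)
  have before : ∀ s ≤ t, f (γ s) ≤ c := fun s hs => by
    by_contra! hlt
    obtain ⟨r, hrs, hr⟩ := ivt s hlt.le
    have : r = s := le_antisymm hrs (hs.trans (hmin hr))
    exact hlt.ne' (this ▸ hr)
  refine ⟨γ t, ht, ?_, joinedIn_target_of_forall_mem hγ t⟩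
  have : JoinedIn (A ∩ {v | f v ≤ c}) (γ 0) (γ t) := by
    refine ⟨γ.subpath 0 t, fun s => ⟨hγ _, ?_⟩⟩
    obtain ⟨r, hr, hrs⟩ := (γ.range_subpath_of_le 0 t nonneg').subset (mem_range_self s)
    exact hrs ▸ before r hr.2
  simpa only [γ.source] using this

lemma exists_last_visit (h : JoinedIn A x y) (hf : Continuous f) (hx : f x ≤ c)
    (hy : c ≤ f y) : ∃ z, f z = c ∧ JoinedIn A x z ∧ JoinedIn (A ∩ {v | c ≤ f v}) z y := by
  obtain ⟨z, hz, hyz, hzx⟩ := exists_first_visit h.symm hf.neg (neg_le_neg hy) (neg_le_neg hx)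
  simp only [Pi.neg_apply, neg_inj, neg_le_neg_iff] at hz hyz
  exact ⟨z, hz, hzx.symm, hyz.symm⟩

lemma exists_visit_of_not_joinedIn_le (h : JoinedIn A x y) (hf : Continuous f) (hx : f x ≤ c)
    (hn : ¬ JoinedIn (A ∩ {v | f v ≤ c}) x y) :
    ∃ z, f z = c ∧ JoinedIn (A ∩ {v | f v ≤ c}) x z := by
  obtain ⟨γ, hγ⟩ := h
  obtain ⟨t, ht⟩ : ∃ t, c < f (γ t) := by
    by_contra! hle
    exact hn ⟨γ, fun t => ⟨hγ t, hle t⟩⟩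
  obtain ⟨z, hz, hxz, -⟩ :=
    exists_first_visit (joinedIn_source_of_forall_mem hγ t) hf hx ht.le
  exact ⟨z, hz, hxz⟩

lemma exists_visit_of_not_joinedIn_ge (h : JoinedIn A x y) (hf : Continuous f) (hx : c ≤ f x)
    (hn : ¬ JoinedIn (A ∩ {v | c ≤ f v}) x y) :
    ∃ z, f z = c ∧ JoinedIn (A ∩ {v | c ≤ f v}) x z := by
  obtain ⟨z, hz, hxz⟩ := exists_visit_of_not_joinedIn_le h hf.neg (neg_le_neg hx)
    (by simpa only [Pi.neg_apply, neg_le_neg_iff] using hn)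
  simp only [Pi.neg_apply, neg_inj, neg_le_neg_iff] at hz hxz
  exact ⟨z, hz, hxz⟩

end Subcurves

variable {A B : Set Plane} {p q p' q' : Plane}

lemma exists_joinedIn_of_signs (hA : JoinedIn A p q) (hB : JoinedIn B p' q') {a b : Plane → ℝ}
    (ha : Continuous a) (hb : Continuous b) (h₀ : ∀ d, a d = 0 → b d = 0 → d = 0)
    (hp : 0 ≤ a (p - p')) (hq : a (q - q') ≤ 0)
    (bottom : ∀ v ∈ A, a (v - p') = 0 → 0 ≤ b (v - p'))
    (right : ∀ v ∈ B, a (q - v) = 0 → 0 ≤ b (q - v))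
    (left : ∀ v ∈ B, a (p - v) = 0 → b (p - v) ≤ 0)
    (top : ∀ v ∈ A, a (v - q') = 0 → b (v - q') ≤ 0) :
    ∃ v, JoinedIn A p v ∧ JoinedIn B p' v := by
  obtain ⟨f, hf⟩ := hA
  obtain ⟨g, hg⟩ := hB
  obtain ⟨⟨s, t⟩, hs, ht⟩ := exists_common_zero_of_signs
    (a := fun x => a (f x.1 - g x.2)) (b := fun x => b (f x.1 - g x.2))
    (by fun_prop) (by fun_prop)
    (by simpa only [f.source, g.source] using hp) (by simpa only [f.target, g.target] using hq)
    (fun s => by simpa only [g.source] using bottom _ (hf s))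
    (fun t => by simpa only [f.target] using right _ (hg t))
    (fun t => by simpa only [f.source] using left _ (hg t))
    (fun s => by simpa only [g.target] using top _ (hf s))
  have heq : f s = g t := sub_eq_zero.1 (h₀ _ hs ht)
  exact ⟨f s, joinedIn_source_of_forall_mem hf s, heq ▸ joinedIn_source_of_forall_mem hg t⟩

lemma exists_joinedIn_of_crossing {a b c d : ℝ} (hA : JoinedIn A p q) (hB : JoinedIn B p' q')
    (hAs : ∀ v ∈ A, c ≤ v.2 ∧ v.2 ≤ d) (hBs : ∀ v ∈ B, a ≤ v.1 ∧ v.1 ≤ b) (hp : p.1 ≤ a)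
    (hq : b ≤ q.1) (hp' : p'.2 ≤ c) (hq' : d ≤ q'.2) :
    ∃ v, JoinedIn A p v ∧ JoinedIn B p' v := by
  have hpA := hAs p hA.source_mem
  have hqA := hAs q hA.target_mem
  have hpB := hBs p' hB.source_mem
  have hqB := hBs q' hB.target_mem
  refine exists_joinedIn_of_signs hA hB (a := fun v => v.2 - v.1) (b := fun v => v.1 + v.2)
    (by fun_prop) (by fun_prop) (fun v h₁ h₂ => Prod.ext ?_ ?_) ?_ ?_ (fun v hv h => ?_)
    (fun v hv h => ?_) (fun v hv h => ?_) (fun v hv h => ?_)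
  all_goals simp only [Prod.fst_sub, Prod.snd_sub, Prod.fst_zero, Prod.snd_zero] at *
  · linarith
  · linarith
  · linarith
  · linarith
  · linarith [hAs v hv]
  · linarith [hBs v hv]
  · linarith [hBs v hv]
  · linarith [hAs v hv]

variable {y₀ y₁ b : ℝ}

lemma exists_joinedIn_of_abs_signs (hA : JoinedIn A p q) (hB : JoinedIn B p' q') {ε : ℝ}
    (hε : ε ≠ 0) (hp : |p.2 - p'.2| ≤ p.1 - p'.1) (hq : q.1 ≤ q'.1)
    (bottom : ∀ v ∈ A, 0 ≤ ε * (v.2 - p'.2))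
    (right : ∀ v ∈ B, q.1 ≤ v.1 ∨ 0 ≤ ε * (q.2 - v.2))
    (left : ∀ v ∈ B, ε * (p.2 - v.2) ≤ 0)
    (top : ∀ v ∈ A, v.1 ≤ q'.1 ∨ ε * (v.2 - q'.2) ≤ 0) :
    ∃ v, JoinedIn A p v ∧ JoinedIn B p' v := by
  have eq_zero : ∀ {v w : Plane}, v.1 - w.1 - |v.2 - w.2| = 0 → v.1 ≤ w.1 →
      ε * (v.2 - w.2) = 0 := fun {v w} h hle => by
    have : |v.2 - w.2| = 0 := by linarith [abs_nonneg (v.2 - w.2)]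
    rw [abs_eq_zero.1 this, mul_zero]
  refine exists_joinedIn_of_signs hA hB (a := fun v => v.1 - |v.2|) (b := fun v => ε * v.2)
    (by fun_prop) (by fun_prop) (fun v h₁ h₂ => ?_) (sub_nonneg.2 hp)
    (sub_nonpos.2 ((sub_nonpos.2 hq).trans (abs_nonneg _))) (fun v hv _ => bottom v hv)
    (fun v hv h => (right v hv).elim (fun h' => (eq_zero h h').ge) id) (fun v hv _ => left v hv)
    (fun v hv h => (top v hv).elim (fun h' => (eq_zero h h').le) id)
  have h₂ : v.2 = 0 := (mul_eq_zero.1 h₂).resolve_left hε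
  exact Prod.ext (by simpa only [h₂, abs_zero, sub_zero, Prod.fst_zero] using h₁) h₂

lemma exists_joinedIn_of_right (hA : JoinedIn A p q) (hB : JoinedIn B p' q')
    (hAs : ∀ v ∈ A, v.1 ≤ b ∧ y₀ ≤ v.2 ∧ v.2 ≤ y₁) (hBs : ∀ v ∈ B, y₀ ≤ v.2 ∧ v.2 ≤ y₁)
    (hp : p.2 = y₀) (hq : q.2 = y₁) (hp' : p'.2 = y₀) (hq' : b ≤ q'.1) (hpp : p'.1 ≤ p.1) :
    ∃ v, JoinedIn A p v ∧ JoinedIn B p' v := by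
  refine exists_joinedIn_of_abs_signs hA hB one_ne_zero
    (by rw [hp, hp', sub_self, abs_zero]; linarith) ((hAs q hA.target_mem).1.trans hq')
    (fun v hv => ?_) (fun v hv => Or.inr ?_) (fun v hv => ?_)
    (fun v hv => Or.inl ((hAs v hv).1.trans hq'))
  · linarith [hAs v hv]
  · linarith [hBs v hv]
  · linarith [hBs v hv]

lemma exists_joinedIn_of_swap (hA : JoinedIn A p q) (hB : JoinedIn B p' q')
    (hAs : ∀ v ∈ A, y₀ ≤ v.2 ∧ v.2 ≤ y₁) (hBs : ∀ v ∈ B, y₀ ≤ v.2 ∧ v.2 ≤ y₁)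
    (hp : p.2 = y₀) (hq : q.2 = y₁) (hp' : p'.2 = y₀) (hq' : q'.2 = y₁) (hpp : p'.1 ≤ p.1)
    (hqq : q.1 ≤ q'.1) : ∃ v, JoinedIn A p v ∧ JoinedIn B p' v := by
  refine exists_joinedIn_of_abs_signs hA hB one_ne_zero
    (by rw [hp, hp', sub_self, abs_zero]; linarith) hqq (fun v hv => ?_)
    (fun v hv => Or.inr ?_) (fun v hv => ?_) (fun v hv => Or.inr ?_)
  · linarith [hAs v hv]
  · linarith [hBs v hv]
  · linarith [hBs v hv]
  · linarith [hAs v hv]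

lemma exists_joinedIn_of_top {c : ℝ} (hA : JoinedIn A p q) (hB : JoinedIn B p' q')
    (hAs : ∀ v ∈ A, c ≤ v.1 ∧ v.2 ≤ y₁) (hBs : ∀ v ∈ B, v.1 ≤ b ∧ v.2 ≤ y₁)
    (hp : b ≤ p.1) (hq : q.2 = y₁) (hp' : p'.1 = c) (hq' : q'.2 = y₁) (hqq : q.1 ≤ q'.1) :
    ∃ v, JoinedIn A p v ∧ JoinedIn B p' v := by
  obtain ⟨v, hBv, hAv⟩ : ∃ v, JoinedIn B q' v ∧ JoinedIn A q v := by
    refine exists_joinedIn_of_abs_signs hB.symm hA.symm (neg_ne_zero.2 one_ne_zero)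
      (by rw [hq, hq', sub_self, abs_zero]; linarith)
      ((hBs p' hB.source_mem).1.trans hp) (fun v hv => ?_)
      (fun v hv => Or.inl (hp'.trans_le (hAs v hv).1)) (fun v hv => ?_)
      (fun v hv => Or.inl ((hBs v hv).1.trans hp))
    · linarith [hBs v hv]
    · linarith [hAs v hv]
  exact ⟨v, hA.trans hAv, hB.trans hBv⟩

end PlanarCurves

/-! ### Curves crossing a strip -/

section Strips

open Set

/-- The part of `A` in the horizontal strip `[y, y + h]`. -/
def slab (A : Set Plane) (y h : ℝ) : Set Plane := A ∩ {v | y ≤ v.2 ∧ v.2 ≤ y + h}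

/-- `A` contains a curve from `p` to `q` crossing the horizontal strip `[y, y + h]` upwards. -/
structure Crosses (A : Set Plane) (y h : ℝ) (p q : Plane) : Prop where
  bottom : p.2 = y
  top : q.2 = y + h
  joined : JoinedIn (slab A y h) p q

/-- `p` and `q` are possible ends of a crossing of the strip `[y, y + h]` that starts above the
unit interval `[x, x + 1]`. -/
structure StripEnds (x y h : ℝ) (p q : Plane) : Prop where
  left : x ≤ p.1
  right : p.1 ≤ x + 1
  bottom : p.2 = y
  top : q.2 = y + h

/-- The strip `[y, y + h]` is crossed from `[x, x + 1]` to the right of `x + 2`. -/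
def DriftRight (A : Set Plane) (x y h : ℝ) : Prop :=
  ∃ p q, StripEnds x y h p q ∧ x + 2 ≤ q.1 ∧ JoinedIn (slab A y h) p q

/-- The mirror image of `DriftRight` in the vertical line through `x + 1 / 2`. -/
def DriftLeft (A : Set Plane) (x y h : ℝ) : Prop :=
  ∃ p q, StripEnds x y h p q ∧ q.1 ≤ x - 1 ∧ JoinedIn (slab A y h) p q

/-- The rectangle `[x, x + h + 1] × [y, y + h]` is crossed horizontally. -/
def LongCrossing (A : Set Plane) (x y h : ℝ) : Prop :=
  ∃ p q : Plane, p.1 = x ∧ q.1 = x + h + 1 ∧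
    JoinedIn (slab A y h ∩ {v | x ≤ v.1 ∧ v.1 ≤ x + h + 1}) p q

/-- The strip `[y, y + h]` is crossed from `[x, x + 1]` without going to the right of `x + b`. -/
def StaysLeft (A : Set Plane) (x y h b : ℝ) : Prop :=
  ∃ p q, StripEnds x y h p q ∧ JoinedIn (slab A y h ∩ {v | v.1 ≤ x + b}) p q

/-- The mirror image of `StaysLeft` in the vertical line through `x + 1 / 2`. -/
def StaysRight (A : Set Plane) (x y h b : ℝ) : Prop :=
  ∃ p q, StripEnds x y h p q ∧ JoinedIn (slab A y h ∩ {v | x + 1 - b ≤ v.1}) p q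

/-- The strip `[y, y + h]` is crossed from `[x, x + 1]` by a curve that goes far to the left, if
at all, only before it goes far to the right. -/
def LeftThenRight (A : Set Plane) (x y h b : ℝ) : Prop :=
  ∃ p w q, StripEnds x y h p q ∧ JoinedIn (slab A y h ∩ {v | v.1 ≤ x + b - 1}) p w ∧
    JoinedIn (slab A y h ∩ {v | x + 5 - b ≤ v.1}) w q

/-- The mirror image of `LeftThenRight` in the vertical line through `x + 1 / 2`. -/
def RightThenLeft (A : Set Plane) (x y h b : ℝ) : Prop :=
  ∃ p w q, StripEnds x y h p q ∧ JoinedIn (slab A y h ∩ {v | x + 2 - b ≤ v.1}) p w ∧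
    JoinedIn (slab A y h ∩ {v | v.1 ≤ x + b - 4}) w q

variable {A B : Set Plane}

lemma slab_mono (hAB : A ⊆ B) (y h : ℝ) : slab A y h ⊆ slab B y h :=
  inter_subset_inter_left _ hAB

lemma slab_subset (A : Set Plane) (y h : ℝ) : slab A y h ⊆ A := inter_subset_left

lemma slab_subset_slab (A : Set Plane) (y : ℝ) {h h' : ℝ} (hh : h ≤ h') :
    slab A y h ⊆ slab A y h' :=
  fun _ hv => ⟨hv.1, hv.2.1, hv.2.2.trans (by gcongr)⟩

lemma inter_le_subset (A : Set Plane) {c c' : ℝ} (hc : c ≤ c') :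
    A ∩ {v | v.1 ≤ c} ⊆ A ∩ {v | v.1 ≤ c'} :=
  fun _ hv => ⟨hv.1, le_trans hv.2 hc⟩

lemma inter_ge_subset (A : Set Plane) {c c' : ℝ} (hc : c' ≤ c) :
    A ∩ {v | c ≤ v.1} ⊆ A ∩ {v | c' ≤ v.1} :=
  fun _ hv => ⟨hv.1, le_trans hc hv.2⟩

lemma Crosses.mono {y h : ℝ} {p q : Plane} (hA : Crosses A y h p q) (hAB : A ⊆ B) :
    Crosses B y h p q :=
  ⟨hA.bottom, hA.top, hA.joined.mono (slab_mono hAB y h)⟩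

lemma StripEnds.exists_joinedIn {x x' y h : ℝ} {p q p' q' : Plane} (hpq : StripEnds x y h p q)
    (hpq' : StripEnds x' y h p' q') (hj : JoinedIn (slab A y h) p q)
    (hj' : JoinedIn (slab A y h) p' q') (hpp : p'.1 ≤ p.1) (hqq : q.1 ≤ q'.1) :
    JoinedIn (slab A y h) p p' := by
  obtain ⟨v, hpv, hpv'⟩ := exists_joinedIn_of_swap hj hj' (fun v hv => hv.2) (fun v hv => hv.2)
    hpq.bottom hpq.top hpq'.bottom hpq'.top hpp hqq
  exact hpv.trans hpv'.symm

lemma exists_long_of_drift {x y h : ℝ} {M : ℕ} (hR : ∀ j ≤ M, DriftRight A (x + 2 * j) y h)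
    (hL : ∀ j < M, DriftLeft A (x + 2 * j + 3) y h) :
    ∃ p q : Plane, p.1 ≤ x + 1 ∧ x + 2 * M + 2 ≤ q.1 ∧ JoinedIn (slab A y h) p q := by
  choose! p q ends hq hpq using hR
  have chain : ∀ j ≤ M, JoinedIn (slab A y h) (p 0) (p j) := by
    intro j
    induction j with
    | zero => exact fun _ => JoinedIn.refl (hpq 0 (Nat.zero_le _)).source_mem
    | succ j ih =>
      intro hj
      have hj' : j ≤ M := by omega
      obtain ⟨r, s, ends', hs, hrs⟩ := hL j (by omega)
      have start := (ends (j + 1) hj).right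
      have target := hq (j + 1) hj
      push_cast at start target
      exact (ih hj').trans <| (ends'.exists_joinedIn (ends j hj') hrs (hpq j hj')
        (by linarith [(ends j hj').right, ends'.left]) (by linarith [hq j hj'])).symm.trans <|
        ends'.exists_joinedIn (ends (j + 1) hj) hrs (hpq (j + 1) hj)
          (by linarith [ends'.left]) (by linarith)
  refine ⟨p 0, q M, ?_, hq M le_rfl, (chain M le_rfl).trans (hpq M le_rfl)⟩
  simpa only [CharP.cast_eq_zero, mul_zero, add_zero] using (ends 0 (Nat.zero_le _)).right

lemma exists_long_of_longCrossing {x y h : ℝ} {M : ℕ}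
    (hH : ∀ j ≤ M, LongCrossing A (x + j) y h)
    (hV : ∀ j < M, LongCrossing (Prod.swap ⁻¹' A) y (x + j + 1) h) (hh : 0 ≤ h) :
    ∃ p q : Plane, p.1 = x ∧ q.1 = x + M + h + 1 ∧ JoinedIn (slab A y h) p q := by
  choose! p q hp hq hpq using hH
  have chain : ∀ j ≤ M, JoinedIn (slab A y h) (p 0) (p j) := by
    intro j
    induction j with
    | zero => exact fun _ => JoinedIn.refl (hpq 0 (Nat.zero_le _)).source_mem.1
    | succ j ih =>
      intro hj
      have hj' : j ≤ M := by omega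
      obtain ⟨r, s, hr, hs, hrs⟩ := hV j (by omega)
      obtain ⟨t, ht, hrt, -⟩ := exists_first_visit hrs (f := Prod.fst) (c := y + h)
        continuous_fst (by linarith) (by linarith)
      have vertical : JoinedIn (slab A y h ∩ {v | x + j + 1 ≤ v.1 ∧ v.1 ≤ x + j + 1 + h})
          r.swap t.swap := joinedIn_of_mapsTo hrt continuous_swap
        fun v ⟨⟨⟨hA, hx⟩, hy⟩, hy'⟩ => ⟨⟨hA, hy.1, hy'⟩, hx⟩
      have meets : ∀ i ≤ M, p i ∈ {v : Plane | v.1 ≤ x + j + 1} →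
          x + j + 1 + h ≤ (q i).1 → JoinedIn (slab A y h) (p i) r.swap := fun i hi hpi hqi => by
        obtain ⟨v, hv, hv'⟩ := exists_joinedIn_of_crossing (hpq i hi) vertical
          (fun v hv => hv.1.2) (fun v hv => hv.2) hpi hqi hr.le ht.ge
        exact joinedIn_trans_of_subset hv hv'.symm inter_subset_left inter_subset_left
      have start := hp (j + 1) hj
      have target := hq (j + 1) hj
      push_cast at start target
      exact (ih hj').trans <|
        (meets j hj' (by rw [mem_ofPred_eq, hp j hj']; linarith)
          (by linarith [hq j hj'])).trans
        (meets (j + 1) hj (by rw [mem_ofPred_eq]; linarith) (by linarith)).symm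
  refine ⟨p 0, q M, ?_, hq M le_rfl, (chain M le_rfl).trans ((hpq M le_rfl).mono inter_subset_left)⟩
  simpa only [CharP.cast_eq_zero, add_zero] using hp 0 (Nat.zero_le _)

lemma drift_or_long_of_stays {x y h b : ℝ} (hb : 2 * b + 3 ≤ h)
    (hL : StaysLeft A x y h b) (hR : StaysRight A (x - 3) y h b) :
    DriftLeft A x y h ∨ DriftRight A (x - 3) y h ∨
      LongCrossing (Prod.swap ⁻¹' A) y (x - 2 - b) (h - 1) := by
  obtain ⟨p, q, hpq, jpq⟩ := hL
  obtain ⟨r, s, hrs, jrs⟩ := hR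
  by_cases narrow :
      JoinedIn (slab A y h ∩ {v | x - 3 + 1 - b ≤ v.1} ∩ {v | v.1 ≤ x + b}) r s
  · refine Or.inr (Or.inr ⟨r.swap, s.swap, hrs.bottom, ?_, ?_⟩)
    · rw [Prod.fst_swap, hrs.top]; ring
    refine joinedIn_of_mapsTo narrow continuous_swap fun v ⟨⟨⟨hA, hy⟩, hl⟩, hr⟩ => ?_
    rw [mem_ofPred_eq] at hl hr
    exact ⟨⟨hA, show _ ≤ v.1 by linarith, show v.1 ≤ _ by linarith⟩, hy.1,
      show v.2 ≤ _ by linarith [hy.2]⟩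
  · have hpb : p.1 ≤ x + b := jpq.source_mem.2
    obtain ⟨z, hz, jrz⟩ := exists_visit_of_not_joinedIn_le jrs continuous_fst
      (by linarith [hpq.left, hrs.right]) narrow
    obtain ⟨v, jpv, jrv⟩ := exists_joinedIn_of_right jpq jrz (fun v hv => ⟨hv.2, hv.1.2⟩)
      (fun v hv => hv.1.1.2) hpq.bottom hpq.top hrs.bottom hz.ge
      (by linarith [hpq.left, hrs.right])
    have jrq : JoinedIn (slab A y h) r q := (joinedIn_trans_of_subset jrv jpv.symm
      (fun v hv => hv.1.1) inter_subset_left).trans (jpq.mono inter_subset_left)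
    by_cases hq : x - 1 ≤ q.1
    · exact Or.inr (Or.inl
        ⟨r, q, ⟨hrs.left, hrs.right, hrs.bottom, hpq.top⟩, by linarith, jrq⟩)
    · exact Or.inl ⟨p, q, hpq, by linarith, jpq.mono inter_subset_left⟩

lemma drift_or_stays_of_turns {x y h b : ℝ} (hb : 3 ≤ b)
    (hL : LeftThenRight A x y h b) (hR : RightThenLeft A (x + 3) y h b) :
    DriftRight A x y h ∨ DriftLeft A (x + 3) y h ∨ StaysLeft A x y h b ∨
      StaysRight A (x + 3) y h b := by
  obtain ⟨p, w, q, hpq, jpw, jwq⟩ := hL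
  obtain ⟨r, u, s, hrs, jru, jus⟩ := hR
  have jpq := joinedIn_trans_of_subset jpw jwq inter_subset_left inter_subset_left
  have jrs := joinedIn_trans_of_subset jru jus inter_subset_left inter_subset_left
  by_cases hq : x + 2 ≤ q.1
  · exact Or.inl ⟨p, q, hpq, hq, jpq⟩
  by_cases hs : s.1 ≤ x + 3 - 1
  · exact Or.inr (Or.inl ⟨r, s, hrs, hs, jrs⟩)
  push Not at hq hs
  by_cases left : JoinedIn (slab A y h ∩ {v | x + 5 - b ≤ v.1} ∩ {v | v.1 ≤ x + b}) q w
  · exact Or.inr (Or.inr (Or.inl ⟨p, q, hpq, joinedIn_trans_of_subset jpw left.symm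
      (inter_le_subset _ (by linarith)) (inter_subset_inter_left _ inter_subset_left)⟩))
  by_cases right :
      JoinedIn (slab A y h ∩ {v | v.1 ≤ x + 3 + b - 4} ∩ {v | x + 4 - b ≤ v.1}) s u
  · exact Or.inr (Or.inr (Or.inr ⟨r, s, hrs, joinedIn_trans_of_subset jru right.symm
      (inter_ge_subset _ (by linarith))
      ((inter_subset_inter_left _ inter_subset_left).trans (inter_ge_subset _ (by linarith)))⟩))
  obtain ⟨z, hz, jqz⟩ :=
    exists_visit_of_not_joinedIn_le jwq.symm continuous_fst (by linarith) left
  obtain ⟨z', hz', jsz'⟩ :=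
    exists_visit_of_not_joinedIn_ge jus.symm continuous_fst (by linarith) right
  obtain ⟨v, jzv, jzv'⟩ := exists_joinedIn_of_top jqz.symm jsz'.symm
    (fun v hv => ⟨le_trans (by linarith) hv.1.2, hv.1.1.2.2⟩)
    (fun v hv => ⟨hv.1.2.trans (by linarith), hv.1.1.2.2⟩)
    hz.ge hpq.top hz' hrs.top (by linarith)
  have jqs : JoinedIn (slab A y h) q s := joinedIn_trans_of_subset (jqz.trans jzv)
    (jsz'.trans jzv').symm (fun v hv => hv.1.1) fun v hv => hv.1.1
  exact Or.inl ⟨p, s, ⟨hpq.left, hpq.right, hpq.bottom, hrs.top⟩, by linarith, jpq.trans jqs⟩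

/-- How far a typical crossing of a strip of height `h` is required to go to both sides. -/
def halfWidth (h : ℕ) : ℕ := (h - 3) / 2

lemma two_mul_halfWidth {h : ℕ} (hh : 4 ≤ h) :
    2 * (halfWidth h : ℤ) + 3 ≤ h ∧ (h : ℤ) ≤ 2 * halfWidth h + 4 := by
  unfold halfWidth; omega

/-- `A` contains one of the crossings of height `h` at `(x, y)` that are improbable in a random
configuration. -/
inductive Exceptional (A : Set Plane) (x y : ℝ) (h : ℕ) : Prop
  | driftRight : DriftRight A x y h → Exceptional A x y h
  | driftLeft : DriftLeft A x y h → Exceptional A x y h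
  | longCrossing : LongCrossing A x y h → Exceptional A x y h
  | staysLeft : StaysLeft A x y h (halfWidth h) → Exceptional A x y h
  | staysRight : StaysRight A x y h (halfWidth h) → Exceptional A x y h
  | leftThenRight : LeftThenRight A x y h (halfWidth h) → Exceptional A x y h
  | rightThenLeft : RightThenLeft A x y h (halfWidth h) → Exceptional A x y h

/-- `A` contains no exceptional crossing at the integer points, for heights between `20`
and `N`. -/
def Regular (A : Set Plane) (N : ℕ) : Prop :=
  ∀ (x y : ℤ) (h : ℕ), 20 ≤ h → h ≤ N → ¬ Exceptional A x y h

lemma Exceptional.mono (hAB : A ⊆ B) {x y : ℝ} {h : ℕ} (hA : Exceptional A x y h) :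
    Exceptional B x y h := by
  have hs := slab_mono hAB y h
  have hsi : ∀ S : Set Plane, slab A y h ∩ S ⊆ slab B y h ∩ S :=
    fun S => inter_subset_inter_left S hs
  cases hA with
  | driftRight hA =>
    exact .driftRight <| hA.imp fun p => .imp fun q ⟨hpq, hq, j⟩ => ⟨hpq, hq, j.mono hs⟩
  | driftLeft hA =>
    exact .driftLeft <| hA.imp fun p => .imp fun q ⟨hpq, hq, j⟩ => ⟨hpq, hq, j.mono hs⟩
  | longCrossing hA =>
    exact .longCrossing <| hA.imp fun p => .imp fun q ⟨hp, hq, j⟩ => ⟨hp, hq, j.mono (hsi _)⟩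
  | staysLeft hA =>
    exact .staysLeft <| hA.imp fun p => .imp fun q ⟨hpq, j⟩ => ⟨hpq, j.mono (hsi _)⟩
  | staysRight hA =>
    exact .staysRight <| hA.imp fun p => .imp fun q ⟨hpq, j⟩ => ⟨hpq, j.mono (hsi _)⟩
  | leftThenRight hA =>
    exact .leftThenRight <| hA.imp fun p => .imp fun w => .imp fun q ⟨hpq, j, j'⟩ =>
      ⟨hpq, j.mono (hsi _), j'.mono (hsi _)⟩
  | rightThenLeft hA =>
    exact .rightThenLeft <| hA.imp fun p => .imp fun w => .imp fun q ⟨hpq, j, j'⟩ =>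
      ⟨hpq, j.mono (hsi _), j'.mono (hsi _)⟩

lemma Regular.mono {N : ℕ} (hB : Regular B N) (hAB : A ⊆ B) : Regular A N :=
  fun x y h hh hN hA => hB x y h hh hN (hA.mono hAB)

lemma exists_first_pass {X : Type*} [TopologicalSpace X] {A : Set X} {p q : X}
    (hpq : JoinedIn A p q) {f : X → ℝ} (hf : Continuous f) {c d : ℝ} (hcd : c ≤ d)
    (hc : c ≤ f p) (hd : f p ≤ d) (above : ¬ JoinedIn (A ∩ {v | f v ≤ d}) p q)
    (below : ¬ JoinedIn (A ∩ {v | c ≤ f v}) p q) :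
    ∃ z w, f z = c ∧ f w = d ∧ JoinedIn (A ∩ {v | c ≤ f v ∧ f v ≤ d}) z w ∧
      (JoinedIn (A ∩ {v | f v ≤ d}) p z ∨ JoinedIn (A ∩ {v | c ≤ f v}) p z) := by
  have band : A ∩ {v | f v ≤ d} ∩ {v | c ≤ f v} ⊆ A ∩ {v | c ≤ f v ∧ f v ≤ d} :=
    fun v hv => ⟨hv.1.1, hv.2, hv.1.2⟩
  have band' : A ∩ {v | c ≤ f v} ∩ {v | f v ≤ d} ⊆ A ∩ {v | c ≤ f v ∧ f v ≤ d} :=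
    fun v hv => ⟨hv.1.1, hv.1.2, hv.2⟩
  obtain ⟨w, hw, hpw⟩ := exists_visit_of_not_joinedIn_le hpq hf hd above
  by_cases hwp : JoinedIn (A ∩ {v | f v ≤ d} ∩ {v | c ≤ f v}) w p
  · obtain ⟨z, hz, hpz⟩ := exists_visit_of_not_joinedIn_ge hpq hf hc below
    by_cases hzp : JoinedIn (A ∩ {v | c ≤ f v} ∩ {v | f v ≤ d}) z p
    · exact ⟨z, w, hz, hw, joinedIn_trans_of_subset hzp hwp.symm band' band, Or.inr hpz⟩
    · obtain ⟨w', hw', hzw'⟩ :=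
        exists_visit_of_not_joinedIn_le hpz.symm hf (hz.trans_le hcd) hzp
      exact ⟨z, w', hz, hw', hzw'.mono band', Or.inr hpz⟩
  · obtain ⟨z, hz, hwz⟩ :=
      exists_visit_of_not_joinedIn_ge hpw.symm hf (hcd.trans_eq hw.symm) hwp
    exact ⟨z, w, hz, hw, hwz.symm.mono band,
      Or.inl (hpw.trans (hwz.mono inter_subset_left))⟩

section RegularCrossings

variable {N h : ℕ} {y : ℤ} {p q : Plane}

lemma Crosses.stripEnds {y h : ℝ} (hpq : Crosses A y h p q) : StripEnds ⌊p.1⌋ y h p q :=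
  ⟨Int.floor_le _, (Int.lt_floor_add_one _).le, hpq.bottom, hpq.top⟩

lemma Regular.drift_lt (hA : Regular A N) (hh : 20 ≤ h) (hN : h ≤ N) (hpq : Crosses A y h p q) :
    (⌊p.1⌋ : ℝ) - 1 < q.1 ∧ q.1 < ⌊p.1⌋ + 2 := by
  refine ⟨lt_of_not_ge fun hq => ?_, lt_of_not_ge fun hq => ?_⟩
  · exact hA ⌊p.1⌋ y h hh hN (.driftLeft ⟨p, q, hpq.stripEnds, hq, hpq.joined⟩)
  · exact hA ⌊p.1⌋ y h hh hN (.driftRight ⟨p, q, hpq.stripEnds, hq, hpq.joined⟩)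

lemma Regular.not_joinedIn_le (hA : Regular A N) (hh : 20 ≤ h) (hN : h ≤ N)
    (hpq : Crosses A y h p q) {c : ℝ} (hc : c ≤ ⌊p.1⌋ + halfWidth h) :
    ¬ JoinedIn (slab A y h ∩ {v | v.1 ≤ c}) p q := fun j =>
  hA ⌊p.1⌋ y h hh hN
    (.staysLeft ⟨p, q, hpq.stripEnds, j.mono (inter_le_subset _ hc)⟩)

lemma Regular.not_joinedIn_ge (hA : Regular A N) (hh : 20 ≤ h) (hN : h ≤ N)
    (hpq : Crosses A y h p q) {c : ℝ} (hc : ⌊p.1⌋ + 1 - halfWidth h ≤ c) :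
    ¬ JoinedIn (slab A y h ∩ {v | c ≤ v.1}) p q := fun j =>
  hA ⌊p.1⌋ y h hh hN
    (.staysRight ⟨p, q, hpq.stripEnds, j.mono (inter_ge_subset _ hc)⟩)

lemma one_le_halfWidth (hh : 20 ≤ h) : (1 : ℝ) ≤ halfWidth h := by
  have : 1 ≤ halfWidth h := by unfold halfWidth; omega
  exact_mod_cast this

lemma Regular.exists_right (hA : Regular A N) (hh : 20 ≤ h) (hN : h ≤ N)
    (hpq : Crosses A y h p q) :
    ∃ z : Plane, z.1 = ⌊p.1⌋ + halfWidth h ∧ JoinedIn (slab A y h) p z := by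
  obtain ⟨z, hz, hpz⟩ := exists_visit_of_not_joinedIn_le hpq.joined continuous_fst
    (by linarith [Int.lt_floor_add_one p.1, one_le_halfWidth hh])
    (hA.not_joinedIn_le hh hN hpq le_rfl)
  exact ⟨z, hz, hpz.mono inter_subset_left⟩

lemma Regular.exists_left (hA : Regular A N) (hh : 20 ≤ h) (hN : h ≤ N)
    (hpq : Crosses A y h p q) :
    ∃ z : Plane, z.1 = ⌊p.1⌋ + 1 - halfWidth h ∧ JoinedIn (slab A y h) p z := by
  obtain ⟨z, hz, hpz⟩ := exists_visit_of_not_joinedIn_ge hpq.joined continuous_fst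
    (by linarith [Int.floor_le p.1, one_le_halfWidth hh])
    (hA.not_joinedIn_ge hh hN hpq le_rfl)
  exact ⟨z, hz, hpz.mono inter_subset_left⟩

lemma Regular.floor_bounds (hA : Regular A N) (hh : 20 ≤ h) (hN : h ≤ N)
    (hpq : Crosses A y h p q) {c d : ℤ} (hcd : ∀ v ∈ A, (c : ℝ) ≤ v.1 ∧ v.1 ≤ d) :
    c + halfWidth h - 1 ≤ ⌊p.1⌋ ∧ ⌊p.1⌋ + halfWidth h ≤ d := by
  obtain ⟨r, hr, hpr⟩ := hA.exists_right hh hN hpq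
  obtain ⟨l, hl, hpl⟩ := hA.exists_left hh hN hpq
  have right : ⌊p.1⌋ + halfWidth h ≤ d := by
    exact_mod_cast hr ▸ (hcd r (slab_subset _ _ _ hpr.target_mem)).2
  have left : c ≤ ⌊p.1⌋ + 1 - halfWidth h := by
    exact_mod_cast hl ▸ (hcd l (slab_subset _ _ _ hpl.target_mem)).1
  exact ⟨by omega, right⟩

/-- A crossing first passes through the band `[c, d]` near its start, and last near its end. If the
two passes were joined within the band, the crossing could be rerouted to avoid one side, or to
visit both sides in only one order. -/
lemma Regular.exists_separated_passes (hA : Regular A N) (hh : 50 ≤ h) (hN : h ≤ N)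
    (hpq : Crosses A y h p q) {c d : ℝ} (hc : c = ⌊p.1⌋ + 5 - halfWidth h)
    (hd : d = ⌊p.1⌋ + halfWidth h - 5) :
    ∃ z w z' w' : Plane, z.1 = c ∧ w.1 = d ∧ z'.1 = c ∧ w'.1 = d ∧
      JoinedIn (slab A y h ∩ {v | c ≤ v.1 ∧ v.1 ≤ d}) z w ∧
      JoinedIn (slab A y h ∩ {v | c ≤ v.1 ∧ v.1 ≤ d}) z' w' ∧
      JoinedIn (slab A y h) p z ∧ JoinedIn (slab A y h) p z' ∧
      ¬ JoinedIn (slab A y h ∩ {v | c ≤ v.1 ∧ v.1 ≤ d}) z z' := by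
  have hb : (20 : ℝ) ≤ halfWidth h := by
    have : 20 ≤ halfWidth h := by unfold halfWidth; omega
    exact_mod_cast this
  have hh' : 20 ≤ h := by omega
  have hp := hpq.stripEnds
  have drift := hA.drift_lt hh' hN hpq
  have exceeds : ¬ JoinedIn (slab A y h ∩ {v | v.1 ≤ d}) p q :=
    hA.not_joinedIn_le hh' hN hpq (by linarith)
  have precedes : ¬ JoinedIn (slab A y h ∩ {v | c ≤ v.1}) p q :=
    hA.not_joinedIn_ge hh' hN hpq (by linarith)
  have not_left_right : ∀ w, JoinedIn (slab A y h ∩ {v | v.1 ≤ d}) p w →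
      ¬ JoinedIn (slab A y h ∩ {v | c ≤ v.1}) w q := fun w jpw jwq =>
    hA ⌊p.1⌋ y h hh' hN <| .leftThenRight ⟨p, w, q, hp,
      jpw.mono (inter_le_subset _ (by linarith)), jwq.mono (inter_ge_subset _ (by linarith))⟩
  have not_right_left : ∀ w, JoinedIn (slab A y h ∩ {v | c ≤ v.1}) p w →
      ¬ JoinedIn (slab A y h ∩ {v | v.1 ≤ d}) w q := fun w jpw jwq =>
    hA ⌊p.1⌋ y h hh' hN <| .rightThenLeft ⟨p, w, q, hp,
      jpw.mono (inter_ge_subset _ (by linarith)), jwq.mono (inter_le_subset _ (by linarith))⟩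
  obtain ⟨z, w, hz, hw, jzw, jpz⟩ := exists_first_pass hpq.joined continuous_fst
    (c := c) (d := d) (by linarith) (by linarith [hp.left]) (by linarith [hp.right])
    exceeds precedes
  obtain ⟨z', w', hz', hw', jzw', jqz'⟩ := exists_first_pass hpq.joined.symm continuous_fst
    (c := c) (d := d) (by linarith) (by linarith) (by linarith) (fun j => exceeds j.symm)
    fun j => precedes j.symm
  refine ⟨z, w, z', w', hz, hw, hz', hw', jzw, jzw',
    jpz.elim (.mono · inter_subset_left) (.mono · inter_subset_left),
    hpq.joined.trans (jqz'.elim (.mono · inter_subset_left) (.mono · inter_subset_left)),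
    fun j => ?_⟩
  have jd : JoinedIn (slab A y h ∩ {v | v.1 ≤ d}) z z' := j.mono fun v hv => ⟨hv.1, hv.2.2⟩
  have jc : JoinedIn (slab A y h ∩ {v | c ≤ v.1}) z z' := j.mono fun v hv => ⟨hv.1, hv.2.1⟩
  rcases jpz with jpz | jpz <;> rcases jqz' with jqz' | jqz'
  · exact exceeds (jpz.trans (jd.trans jqz'.symm))
  · exact not_left_right z jpz (jc.trans jqz'.symm)
  · exact not_right_left z jpz (jd.trans jqz'.symm)
  · exact precedes (jpz.trans (jc.trans jqz'.symm))

lemma longCrossing_of_joinedIn {x y h : ℝ} {s t : Plane} (hst : JoinedIn (slab A y h) s t)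
    (hs : s.1 ≤ x) (ht : x + h + 1 ≤ t.1) (hh : 0 ≤ h) : LongCrossing A x y h := by
  obtain ⟨t', ht', hst', -⟩ :=
    exists_first_visit hst continuous_fst (c := x + h + 1) (by linarith) ht
  obtain ⟨s', hs', -, hst''⟩ := exists_last_visit hst' continuous_fst hs (by linarith)
  exact ⟨s', t', hs', ht', hst''.mono fun v hv => ⟨hv.1.1, hv.2, hv.1.2⟩⟩

lemma Regular.joinedIn_between (hA : Regular A N) (hh : 20 ≤ h) (hN : h ≤ N)
    (hpq : Crosses A y h p q) {c d : ℤ} (hc : c ≤ p.1) (hd : p.1 ≤ d)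
    (hch : c + h + 1 ≤ ⌊p.1⌋ + halfWidth h) (hdh : ⌊p.1⌋ + h + 2 ≤ d + halfWidth h) {v : Plane}
    (hv : JoinedIn (slab A y h) p v) :
    JoinedIn (slab A y h ∩ {w | c ≤ w.1 ∧ w.1 ≤ d}) p v := by
  by_contra hn
  have hh₀ : (0 : ℝ) ≤ h := h.cast_nonneg
  by_cases right : JoinedIn (slab A y h ∩ {w | w.1 ≤ d}) p v
  · obtain ⟨s, hs, hps⟩ := exists_visit_of_not_joinedIn_ge right continuous_fst hc
      fun j => hn (j.mono fun w hw => ⟨hw.1.1, hw.2, hw.1.2⟩)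
    obtain ⟨t, ht, hpt⟩ := hA.exists_right hh hN hpq
    refine hA c y h hh hN (.longCrossing (longCrossing_of_joinedIn
      ((hps.symm.mono fun w hw => hw.1.1).trans hpt) hs.le ?_ hh₀))
    rw [ht]
    exact_mod_cast hch
  · obtain ⟨t, ht, hpt⟩ := exists_visit_of_not_joinedIn_le hv continuous_fst hd right
    obtain ⟨s, hs, hps⟩ := hA.exists_left hh hN hpq
    refine hA (⌊p.1⌋ + 1 - halfWidth h) y h hh hN (.longCrossing (longCrossing_of_joinedIn
      (hps.symm.trans (hpt.mono inter_subset_left)) (by rw [hs]; push_cast; rfl) ?_ hh₀))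
    rw [ht]
    have : ⌊p.1⌋ + 1 - (halfWidth h : ℤ) + h + 1 ≤ d := by omega
    exact_mod_cast this

lemma Regular.exists_inner_crossing (hA : Regular A N) {Y : ℤ} {k : ℕ} (hk : 20 ≤ k)
    (hN : k ≤ N) {z w : Plane} (hzw : Crosses A Y k z w) (hh : 20 ≤ h) (hYy : Y ≤ y)
    (hyY : y + h ≤ Y + k) {c d : ℤ} (hcd : ∀ v ∈ A, (c : ℝ) ≤ v.1 ∧ v.1 ≤ d) :
    ∃ p q : Plane, Crosses A y h p q ∧ JoinedIn (slab A Y k) z p ∧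
      c + halfWidth k - 3 ≤ ⌊p.1⌋ ∧ ⌊p.1⌋ + halfWidth k ≤ d + 2 := by
  have hYy' : (Y : ℝ) ≤ y := by exact_mod_cast hYy
  have hyY' : (y : ℝ) + h ≤ Y + k := by exact_mod_cast hyY
  obtain ⟨q, hq, hzq, -⟩ := exists_first_visit hzw.joined continuous_snd (c := y + h)
    (by rw [hzw.bottom]; linarith [h.cast_nonneg (α := ℝ)]) (by rw [hzw.top]; linarith)
  obtain ⟨p, hp, hzp, hpq⟩ := exists_last_visit hzq continuous_snd (c := y)
    (by rw [hzw.bottom]; linarith) (by rw [hq]; linarith [h.cast_nonneg (α := ℝ)])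
  have hpq' : Crosses A y h p q :=
    ⟨hp, hq, hpq.mono fun v hv => ⟨hv.1.1.1, hv.2, hv.1.2⟩⟩
  have drift := hA.drift_lt hh (by omega) hpq'
  obtain ⟨m, hm⟩ : ∃ m : ℕ, (m : ℤ) = y + h - Y := ⟨(y + h - Y).toNat, by omega⟩
  have hm' : (Y : ℝ) + m = y + h := by
    have : Y + m = y + h := by omega
    exact_mod_cast this
  have drift' := hA.drift_lt (h := m) (y := Y) (p := z) (q := q) (by omega) (by omega)
    ⟨hzw.bottom, hq.trans hm'.symm,
      hzq.mono fun v hv => ⟨hv.1.1, hv.1.2.1, le_of_le_of_eq hv.2 hm'.symm⟩⟩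
  have bounds := hA.floor_bounds hk hN hzw hcd
  have hpz : ⌊p.1⌋ - 1 < ⌊z.1⌋ + 2 := by exact_mod_cast drift.1.trans drift'.2
  have hzp' : ⌊z.1⌋ - 1 < ⌊p.1⌋ + 2 := by exact_mod_cast drift'.1.trans drift.2
  exact ⟨p, q, hpq', hzp.mono inter_subset_left, by omega, by omega⟩

end RegularCrossings

section Doubling

variable {N h : ℕ} {y : ℤ} {p q : Plane}

lemma Regular.exists_horizontal_pass (hA : Regular A N) (hh : 20 ≤ h) (hN : h ≤ N)
    (hpq : Crosses A y h p q) {c : ℤ} {k : ℕ} (hc : c = ⌊p.1⌋ + 1 - halfWidth h)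
    (hk : c + k = ⌊p.1⌋ + halfWidth h) :
    ∃ P Q : Plane, Crosses (Prod.swap ⁻¹' slab A y h) c k P.swap Q.swap ∧
      JoinedIn (slab A y h) p P := by
  obtain ⟨r, hr, hpr⟩ := hA.exists_right hh hN hpq
  obtain ⟨l, hl, hpl⟩ := hA.exists_left hh hN hpq
  replace hl : l.1 = c := by rw [hl, hc]; push_cast; rfl
  replace hr : r.1 = c + k := by rw [hr]; exact_mod_cast hk.symm
  obtain ⟨Q, hQ, hlQ, -⟩ := exists_first_visit (hpl.symm.trans hpr) continuous_fst
    (c := c + k) (by rw [hl]; linarith [k.cast_nonneg (α := ℝ)]) hr.ge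
  obtain ⟨P, hP, hlP, hPQ⟩ := exists_last_visit hlQ continuous_fst hl.le
    (by rw [hQ]; linarith [k.cast_nonneg (α := ℝ)])
  refine ⟨P, Q, ⟨hP, hQ, joinedIn_of_mapsTo hPQ continuous_swap fun v hv => ?_⟩,
    hpl.trans (hlP.mono inter_subset_left)⟩
  exact ⟨hv.1.1, hv.2, hv.1.2⟩

/-- The crossing has a horizontal pass, and that pass is confined to the middle of the strip
because it would otherwise leave it. Seen from the side, the pass is a crossing of a vertical strip
and so makes two separated passes in the vertical direction. -/
lemma Regular.exists_two_band_crossings (hA : Regular A N) (hA' : Regular (Prod.swap ⁻¹' A) N)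
    (hh : 136 ≤ h) (hN : h ≤ N) (hpq : Crosses A y h p q) :
    ∃ (c d Y : ℤ) (k : ℕ), Y ≤ y + 18 ∧ y + h ≤ Y + k + 18 ∧ h ≤ k + 19 ∧ k ≤ N ∧
      ∃ z w z' w' : Plane, Crosses (slab A y h ∩ {v | (c : ℝ) ≤ v.1 ∧ v.1 ≤ d}) Y k z w ∧
        Crosses (slab A y h ∩ {v | (c : ℝ) ≤ v.1 ∧ v.1 ≤ d}) Y k z' w' ∧
        JoinedIn (slab A y h) p z ∧ JoinedIn (slab A y h) p z' ∧
        ¬ JoinedIn (slab (slab A y h ∩ {v | (c : ℝ) ≤ v.1 ∧ v.1 ≤ d}) Y k) z z' := by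
  have hb := two_mul_halfWidth (h := h) (by omega)
  obtain ⟨m, hm⟩ : ∃ m : ℕ, (m : ℤ) = 2 * halfWidth h - 1 := ⟨2 * halfWidth h - 1, by omega⟩
  obtain ⟨c, hc⟩ : ∃ c : ℤ, c = ⌊p.1⌋ + 1 - halfWidth h := ⟨_, rfl⟩
  obtain ⟨P, Q, hPQ, hpP⟩ := hA.exists_horizontal_pass (by omega) hN hpq hc
    (k := m) (by omega)
  have hE : Regular (Prod.swap ⁻¹' slab A y h) N := hA'.mono (preimage_mono (slab_subset _ _ _))
  have hbm := two_mul_halfWidth (h := m) (by omega)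
  have middle := hE.floor_bounds (by omega) (by omega) hPQ (c := y) (d := y + h)
    fun v hv => by push_cast; exact hv.2
  obtain ⟨k, hk⟩ : ∃ k : ℕ, (k : ℤ) = 2 * halfWidth m - 10 := ⟨2 * halfWidth m - 10, by omega⟩
  have hk' : (k : ℝ) = 2 * halfWidth m - 10 := by exact_mod_cast hk
  obtain ⟨z, w, z', w', hz, hw, hz', hw', hzw, hzw', hPz, hPz', hsep⟩ :=
    hE.exists_separated_passes (by omega) (by omega) hPQ
      (c := (⌊P.swap.1⌋ + 5 - halfWidth m : ℤ)) (d := (⌊P.swap.1⌋ + 5 - halfWidth m : ℤ) + k)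
      (by push_cast; rfl) (by rw [hk']; push_cast; ring)
  set Y : ℤ := ⌊P.swap.1⌋ + 5 - halfWidth m
  set B := slab A y h ∩ {v | (c : ℝ) ≤ v.1 ∧ v.1 ≤ (c + m : ℤ)} with hB
  have hswap : Prod.swap ⁻¹' (slab B Y k) =
      slab (Prod.swap ⁻¹' slab A y h) c m ∩ {v | (Y : ℝ) ≤ v.1 ∧ v.1 ≤ Y + k} := by
    rw [hB]; push_cast; rfl
  have toB : ∀ {s t : Plane}, JoinedIn (slab (Prod.swap ⁻¹' slab A y h) c m ∩
      {v | (Y : ℝ) ≤ v.1 ∧ v.1 ≤ Y + k}) s t → JoinedIn (slab B Y k) s.swap t.swap :=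
    fun j => joinedIn_of_mapsTo j continuous_swap fun v hv => by rwa [← hswap] at hv
  have toA : ∀ {t : Plane}, JoinedIn (slab (Prod.swap ⁻¹' slab A y h) c m) P.swap t →
      JoinedIn (slab A y h) p t.swap :=
    fun j => hpP.trans (joinedIn_of_mapsTo j continuous_swap fun v hv => hv.1)
  refine ⟨c, c + m, Y, k, by omega, by omega, by omega, by omega, z.swap, w.swap, z'.swap,
    w'.swap, ⟨hz, hw, toB hzw⟩, ⟨hz', hw', toB hzw'⟩, toA hPz, toA hPz', fun j => hsep ?_⟩
  rw [← hswap]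
  exact joinedIn_of_mapsTo j continuous_swap fun v hv => hv

lemma Regular.exists_two_crossings (hA : Regular A N) (hA' : Regular (Prod.swap ⁻¹' A) N)
    (hh : 100 ≤ h) (hN : h + 36 ≤ N) (hpq : Crosses A y (h + 36 : ℕ) p q) :
    ∃ p₁ q₁ p₂ q₂ : Plane, Crosses A (y + 18 : ℤ) h p₁ q₁ ∧ Crosses A (y + 18 : ℤ) h p₂ q₂ ∧
      JoinedIn (slab A y (h + 36 : ℕ)) p p₁ ∧ JoinedIn (slab A y (h + 36 : ℕ)) p p₂ ∧
      ¬ JoinedIn (slab A (y + 18 : ℤ) h) p₁ p₂ := by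
  obtain ⟨c, d, Y, k, hY, hYk, hk, hkN, z, w, z', w', hzw, hzw', hpz, hpz', hsep⟩ :=
    hA.exists_two_band_crossings hA' (by omega) hN hpq
  set B := slab A y (h + 36 : ℕ) ∩ {v | (c : ℝ) ≤ v.1 ∧ v.1 ≤ d}
  have hBA : B ⊆ A := fun v hv => hv.1.1
  have hBslab : slab B Y k ⊆ slab A y (h + 36 : ℕ) := fun v hv => hv.1.1
  have hB : Regular B N := hA.mono hBA
  obtain ⟨p₁, q₁, hpq₁, hzp₁, hc₁, hd₁⟩ := hB.exists_inner_crossing (by omega) hkN hzw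
    (h := h) (y := y + 18) (by omega) (by omega) (by omega) (fun v hv => hv.2)
  obtain ⟨p₂, q₂, hpq₂, hzp₂, -, -⟩ := hB.exists_inner_crossing (by omega) hkN hzw'
    (h := h) (y := y + 18) (by omega) (by omega) (by omega) (fun v hv => hv.2)
  refine ⟨p₁, q₁, p₂, q₂, hpq₁.mono hBA, hpq₂.mono hBA, hpz.trans (hzp₁.mono hBslab),
    hpz'.trans (hzp₂.mono hBslab), fun j => hsep (hzp₁.trans (.trans ?_ hzp₂.symm))⟩
  have hbk := two_mul_halfWidth (h := k) (by omega)
  have hbh := two_mul_halfWidth (h := h) (by omega)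
  have hcd := hpq₁.joined.source_mem.1.2
  refine (hA.joinedIn_between (by omega) (by omega) (hpq₁.mono hBA) hcd.1 hcd.2 (by omega)
    (by omega) j).mono fun v ⟨⟨hv, hy, hy'⟩, hcd⟩ => ?_
  have hYy : (Y : ℝ) ≤ (y + 18 : ℤ) := by exact_mod_cast hY
  have hyY : ((y + 18 : ℤ) : ℝ) + h ≤ Y + k := by
    have : y + 18 + (h : ℤ) ≤ Y + k := by omega
    exact_mod_cast this
  push_cast at hy hy' hYy hyY
  refine ⟨⟨⟨hv, by linarith, ?_⟩, hcd⟩, by linarith, by linarith⟩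
  push_cast
  linarith

/-- `A` contains `K` crossings of the strip `[y, y + h]`, no two of which are joined in `A` within
the strip. -/
def HasSeparatedCrossings (A : Set Plane) (y h : ℝ) (K : ℕ) : Prop :=
  ∃ p q : Fin K → Plane, (∀ i, Crosses A y h (p i) (q i)) ∧
    ∀ i j, i ≠ j → ¬ JoinedIn (slab A y h) (p i) (p j)

lemma hasSeparatedCrossings_of_card {ι : Type*} [Fintype ι] {y h : ℝ} {p q : ι → Plane}
    (hpq : ∀ i, Crosses A y h (p i) (q i))
    (hsep : ∀ i j, i ≠ j → ¬ JoinedIn (slab A y h) (p i) (p j)) {K : ℕ}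
    (hK : Fintype.card ι = K) : HasSeparatedCrossings A y h K :=
  have e := (Fintype.equivFinOfCardEq hK).symm
  ⟨p ∘ e, q ∘ e, fun i => hpq (e i), fun _ _ hij => hsep _ _ (e.injective.ne hij)⟩

lemma Regular.hasSeparatedCrossings_two_mul (hA : Regular A N)
    (hA' : Regular (Prod.swap ⁻¹' A) N) (hh : 100 ≤ h) (hN : h + 36 ≤ N) {K : ℕ}
    (hK : HasSeparatedCrossings A y (h + 36 : ℕ) K) :
    HasSeparatedCrossings A (y + 18 : ℤ) h (K * 2) := by
  obtain ⟨p, q, hpq, hsep⟩ := hK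
  choose p₁ q₁ p₂ q₂ hpq₁ hpq₂ hpp₁ hpp₂ hn using
    fun i => hA.exists_two_crossings hA' hh hN (hpq i)
  have thinner : slab A (y + 18 : ℤ) h ⊆ slab A y (h + 36 : ℕ) := fun v ⟨hv, hy, hy'⟩ => by
    push_cast at hy hy'
    refine ⟨hv, by linarith, ?_⟩
    push_cast
    linarith
  have hpp : ∀ x : Fin K × Bool,
      JoinedIn (slab A y (h + 36 : ℕ)) (p x.1) (cond x.2 (p₁ x.1) (p₂ x.1)) := by
    rintro ⟨i, _ | _⟩
    exacts [hpp₂ i, hpp₁ i]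
  refine hasSeparatedCrossings_of_card (ι := Fin K × Bool)
    (p := fun x => cond x.2 (p₁ x.1) (p₂ x.1)) (q := fun x => cond x.2 (q₁ x.1) (q₂ x.1))
    ?_ (fun x x' hne j => ?_) (by simp)
  · rintro ⟨i, _ | _⟩
    exacts [hpq₂ i, hpq₁ i]
  · by_cases hi : x.1 = x'.1
    · obtain ⟨i, s⟩ := x
      obtain ⟨i', s'⟩ := x'
      obtain rfl : i = i' := hi
      cases s <;> cases s'
      exacts [hne rfl, hn i j.symm, hn i j, hne rfl]
    · exact hsep x.1 x'.1 hi ((hpp x).trans ((j.mono thinner).trans (hpp x').symm))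

lemma Regular.hasSeparatedCrossings_two_pow (hA : Regular A N)
    (hA' : Regular (Prod.swap ⁻¹' A) N) (i : ℕ) {h : ℕ} (hh : 100 ≤ h) (hN : h + 36 * i ≤ N)
    (hpq : Crosses A y (h + 36 * i : ℕ) p q) :
    HasSeparatedCrossings A (y + 18 * i : ℤ) h (2 ^ i) := by
  induction i generalizing h with
  | zero =>
    refine hasSeparatedCrossings_of_card (ι := Unit) (p := fun _ => p) (q := fun _ => q)
      (fun _ => ?_) (fun _ _ hne => absurd rfl hne) rfl
    simpa only [CharP.cast_eq_zero, mul_zero, add_zero] using hpq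
  | succ i ih =>
    have height_succ : h + 36 * (i + 1) = h + 36 + 36 * i := by ring
    have := hA.hasSeparatedCrossings_two_mul hA' hh (by omega)
      (ih (h := h + 36) (by omega) (by omega) (height_succ ▸ hpq))
    rwa [← pow_succ, add_assoc, ← mul_add_one, ← Nat.cast_add_one] at this

end Doubling

end Strips

/-! ### Random-cluster weights -/

section GraphComponents

open SimpleGraph

variable {V : Type*} {G : SimpleGraph V} {u v x y : V}

lemma reachable_sup_edge (h : (G ⊔ edge u v).Reachable x y) :
    G.Reachable x y ∨ (G.Reachable x u ∧ G.Reachable v y) ∨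
      (G.Reachable x v ∧ G.Reachable u y) := by
  obtain ⟨w⟩ := h
  induction w with
  | nil => exact Or.inl (Reachable.refl _)
  | cons hadj _ ih =>
    rw [sup_adj, edge_adj] at hadj
    rcases hadj with hG | ⟨⟨rfl, rfl⟩ | ⟨rfl, rfl⟩, -⟩
    · rcases ih with h | ⟨h1, h2⟩ | ⟨h1, h2⟩
      · exact Or.inl (hG.reachable.trans h)
      · exact Or.inr (Or.inl ⟨hG.reachable.trans h1, h2⟩)
      · exact Or.inr (Or.inr ⟨hG.reachable.trans h1, h2⟩)
    · rcases ih with h | ⟨-, h2⟩ | ⟨-, h2⟩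
      · exact Or.inr (Or.inl ⟨Reachable.refl _, h⟩)
      · exact Or.inr (Or.inl ⟨Reachable.refl _, h2⟩)
      · exact Or.inl h2
    · rcases ih with h | ⟨-, h2⟩ | ⟨-, h2⟩
      · exact Or.inr (Or.inr ⟨Reachable.refl _, h⟩)
      · exact Or.inl h2
      · exact Or.inr (Or.inr ⟨Reachable.refl _, h2⟩)

lemma card_connectedComponent_sup_edge_of_reachable (h : G.Reachable u v) :
    Nat.card (G ⊔ edge u v).ConnectedComponent = Nat.card G.ConnectedComponent := by
  have : (G ⊔ edge u v).Reachable = G.Reachable := by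
    funext x y
    refine propext ⟨fun hr => ?_, fun hr => hr.mono le_sup_left⟩
    rcases reachable_sup_edge hr with h' | ⟨h1, h2⟩ | ⟨h1, h2⟩
    · exact h'
    · exact h1.trans (h.trans h2)
    · exact h1.trans (h.symm.trans h2)
  unfold ConnectedComponent
  rw [this]

lemma card_connectedComponent_sup_edge_of_not_reachable [Finite V] (h : ¬ G.Reachable u v) :
    Nat.card (G ⊔ edge u v).ConnectedComponent + 1 = Nat.card G.ConnectedComponent := by
  classical
  have huv : u ≠ v := fun e => h (e ▸ Reachable.refl _)
  have hadj : (G ⊔ edge u v).Reachable u v := Adj.reachable (by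
    rw [sup_adj, edge_adj]; exact Or.inr ⟨Or.inl ⟨rfl, rfl⟩, huv⟩)
  let f : {c : G.ConnectedComponent // c ≠ G.connectedComponentMk v} →
      (G ⊔ edge u v).ConnectedComponent := fun c => c.1.map (Hom.ofLE le_sup_left)
  have hf : Function.Bijective f := by
    constructor
    · rintro ⟨c, hc⟩ ⟨c', hc'⟩ hcc
      induction c using ConnectedComponent.ind with | _ x => ?_
      induction c' using ConnectedComponent.ind with | _ y => ?_
      have hxy : (G ⊔ edge u v).Reachable x y := ConnectedComponent.exact hcc
      rcases reachable_sup_edge hxy with h' | ⟨-, h2⟩ | ⟨h1, -⟩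
      · exact Subtype.ext (ConnectedComponent.sound h')
      · exact absurd (ConnectedComponent.sound h2.symm) hc'
      · exact absurd (ConnectedComponent.sound h1) hc
    · intro c
      induction c using ConnectedComponent.ind with | _ x => ?_
      by_cases hx : G.Reachable x v
      · exact ⟨⟨G.connectedComponentMk u, fun e => h (ConnectedComponent.exact e)⟩,
          ConnectedComponent.sound (hadj.trans (hx.mono le_sup_left).symm)⟩
      · exact ⟨⟨G.connectedComponentMk x, fun e => hx (ConnectedComponent.exact e)⟩, rfl⟩
  rw [← Nat.card_congr (Equiv.ofBijective f hf),
    ← Nat.card_congr (Equiv.optionSubtypeNe (G.connectedComponentMk v)), Finite.card_option]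

end GraphComponents

section Cube

open Function

variable {ι : Type*} [DecidableEq ι]

lemma card_update_eq [Finite ι] (η : ι → Bool) (e : ι) (b : Bool) :
    Nat.card {i // update η e b i = b} =
      Nat.card {i // update η e (!b) i = b} + 1 := by
  have : {i | update η e b i = b} = insert e {i | update η e (!b) i = b} := by
    ext i
    by_cases hi : i = e
    · subst hi; simp
    · simp [hi]
  change Nat.card {i | update η e b i = b} = Nat.card {i | _} + 1
  rw [Nat.card_coe_set_eq, Nat.card_coe_set_eq, this, Set.ncard_insert_of_notMem]
  simp

/-- Open the edges of `T` one at a time, in the lower of the two configurations on the left and in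
the upper one on the right. -/
lemma piecewise_mul_le_of_update {f : (ι → Bool) → ℝ} (hpos : ∀ a, 0 < f a)
    (hf : ∀ a b, a ≤ b → ∀ e, f (update a e true) * f (update b e false) ≤
      f (update a e false) * f (update b e true)) (T : Finset ι) :
    ∀ a b : ι → Bool, a ≤ b →
      f (T.piecewise ⊤ a) * f (T.piecewise ⊥ b) ≤ f (T.piecewise ⊥ a) * f (T.piecewise ⊤ b) := by
  induction T using Finset.induction_on with
  | empty => simp
  | insert e T he ih =>
    intro a b hab
    have lower := ih (update a e false) (update b e false)
      (update_le_update_iff.2 ⟨le_rfl, fun j _ => hab j⟩)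
    have upper := hf (T.piecewise ⊤ a) (T.piecewise ⊤ b) (T.piecewise_le_piecewise le_rfl hab) e
    simp only [← Finset.update_piecewise_of_notMem _ _ _ he] at lower
    rw [Finset.piecewise_insert, Finset.piecewise_insert, Finset.piecewise_insert,
      Finset.piecewise_insert]
    change f (update _ e true) * f (update _ e false) ≤ f (update _ e false) * f (update _ e true)
    have hpos₁ := hpos (update (T.piecewise ⊤ a) e false)
    have hpos₂ := hpos (update (T.piecewise ⊤ b) e false)
    refine le_of_mul_le_mul_right ?_ (mul_pos hpos₁ hpos₂)
    have := mul_le_mul lower upper (mul_pos (hpos _) hpos₂).le (mul_pos (hpos _) hpos₂).le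
    linarith

lemma mul_le_inf_mul_sup_of_update [Finite ι] {f : (ι → Bool) → ℝ} (hpos : ∀ a, 0 < f a)
    (hf : ∀ a b, a ≤ b → ∀ e, f (update a e true) * f (update b e false) ≤
      f (update a e false) * f (update b e true)) (a b : ι → Bool) :
    f a * f b ≤ f (a ⊓ b) * f (a ⊔ b) := by
  have := Fintype.ofFinite ι
  convert piecewise_mul_le_of_update hpos hf (Finset.univ.filter fun e => b e < a e) (a ⊓ b) b
    inf_le_right using 3 <;>
  · funext e
    cases ha : a e <;> cases hb : b e <;> simp [Finset.piecewise, ha, hb]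

end Cube

namespace PlanarLattice

open SimpleGraph

variable (L : PlanarLattice)

/-- The graph of the open edges outside `S`, on all points of the plane; for finite `S` its clusters
induce the boundary condition on `S`. -/
def openGraph (S : Set L.Edge) (ω : L.Config) : SimpleGraph Plane :=
  SimpleGraph.fromEdgeSet
    {e : Sym2 Plane | ∃ h : e ∈ L.graph.edgeSet, (⟨e, h⟩ : L.Edge) ∉ S ∧ ω ⟨e, h⟩ = true}

variable {L}

lemma openGraph_adj {S : Set L.Edge} {ω : L.Config} {x y : Plane} :
    (L.openGraph S ω).Adj x y ↔
      ∃ h : L.graph.Adj x y, (⟨s(x, y), h⟩ : L.Edge) ∉ S ∧ ω ⟨s(x, y), h⟩ = true := by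
  rw [openGraph, fromEdgeSet_adj]
  constructor
  · rintro ⟨⟨h, h'⟩, -⟩
    exact ⟨h, h'⟩
  · rintro ⟨h, h'⟩
    exact ⟨⟨h, h'⟩, h.ne⟩

lemma inducedBC_r_iff {F : Finset L.Edge} {ω : L.Config} {a b : L.boundary F} :
    (L.inducedBC F ω).r a b ↔ (L.openGraph F ω).Reachable a b := Iff.rfl

lemma exists_edge_of_reachable {S : Set L.Edge} {ω : L.Config} {x y : Plane}
    (h : (L.openGraph S ω).Reachable x y) (hne : x ≠ y) :
    ∃ e : L.Edge, e ∉ S ∧ x ∈ (e : Sym2 Plane) := by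
  obtain ⟨w⟩ := h
  cases w with
  | nil => exact absurd rfl hne
  | cons hadj _ =>
    obtain ⟨h, h1, -⟩ := openGraph_adj.1 hadj
    exact ⟨_, h1, Sym2.mem_mk_left _ _⟩

lemma mem_verts_left {F : Finset L.Edge} {x y : Plane} {h : s(x, y) ∈ L.graph.edgeSet}
    (he : (⟨s(x, y), h⟩ : L.Edge) ∈ F) : x ∈ L.verts F := ⟨_, he, Sym2.mem_mk_left _ _⟩

lemma mem_verts_right {F : Finset L.Edge} {x y : Plane} {h : s(x, y) ∈ L.graph.edgeSet}
    (he : (⟨s(x, y), h⟩ : L.Edge) ∈ F) : y ∈ L.verts F := ⟨_, he, Sym2.mem_mk_right _ _⟩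

lemma wiredGraph_reachable_of_reachable {F : Finset L.Edge} {ω : L.Config} {η : F → Bool}
    {x y : L.verts F} (h : (L.openGraph F ω).Reachable x y) :
    (L.wiredGraph F (L.inducedBC F ω) η).Reachable x y := by
  by_cases hne : (x : Plane) = y
  · rw [Subtype.ext hne]
  · have hx : (x : Plane) ∈ L.boundary F := ⟨x.2, exists_edge_of_reachable h hne⟩
    have hy : (y : Plane) ∈ L.boundary F := ⟨y.2, exists_edge_of_reachable h.symm (Ne.symm hne)⟩
    refine Adj.reachable ?_
    rw [wiredGraph, fromRel_adj]
    exact ⟨fun e => hne (congrArg _ e), Or.inl (Or.inr ⟨hx, hy, h⟩)⟩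

lemma openGraph_le_empty (S : Set L.Edge) (ω : L.Config) : L.openGraph S ω ≤ L.openGraph ∅ ω := by
  intro x y hxy
  obtain ⟨h, -, ho⟩ := openGraph_adj.1 hxy
  exact openGraph_adj.2 ⟨h, Set.notMem_empty _, ho⟩

lemma openGraph_reachable_of_wiredGraph_adj {F : Finset L.Edge} {ω : L.Config} {x y : L.verts F}
    (h : (L.wiredGraph F (L.inducedBC F ω) fun e => ω e).Adj x y) :
    (L.openGraph ∅ ω).Reachable x y := by
  have reachable_of_rel : ∀ a b : L.verts F,
      ((∃ e : F, ω e = true ∧ ((e : L.Edge) : Sym2 Plane) = s((a : Plane), (b : Plane))) ∨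
        ∃ (ha : (a : Plane) ∈ L.boundary F) (hb : (b : Plane) ∈ L.boundary F),
          (L.inducedBC F ω).r ⟨a, ha⟩ ⟨b, hb⟩) → (L.openGraph ∅ ω).Reachable a b := by
    rintro a b (⟨⟨⟨e, he⟩, _⟩, ho, hab⟩ | ⟨_, _, hr⟩)
    · obtain rfl : e = s((a : Plane), (b : Plane)) := hab
      exact Adj.reachable (openGraph_adj.2 ⟨he, Set.notMem_empty _, ho⟩)
    · exact (inducedBC_r_iff.1 hr).mono (openGraph_le_empty F ω)
  rw [wiredGraph, fromRel_adj] at h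
  exact h.2.elim (reachable_of_rel x y) fun h => (reachable_of_rel y x h).symm

lemma exists_wiredGraph_reachable {F : Finset L.Edge} {ω : L.Config} {x : L.verts F} {a b : Plane}
    (w : (L.openGraph ∅ ω).Walk a b) (hax : a = x) :
    ∃ x' : L.verts F, (L.wiredGraph F (L.inducedBC F ω) fun e => ω e).Reachable x x' ∧
      (L.openGraph F ω).Reachable x' b := by
  induction w using Walk.concatRec with
  | Hnil => exact ⟨x, Reachable.refl _, hax ▸ Reachable.refl _⟩
  | @Hconcat _ v w _ hadj ih =>
    obtain ⟨x', hxx', hx'v⟩ := ih hax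
    obtain ⟨h, -, ho⟩ := openGraph_adj.1 hadj
    by_cases hF : (⟨s(v, w), h⟩ : L.Edge) ∈ F
    · have hvw : (L.wiredGraph F (L.inducedBC F ω) fun e => ω e).Adj
          ⟨v, mem_verts_left hF⟩ ⟨w, mem_verts_right hF⟩ := by
        rw [wiredGraph, fromRel_adj]
        exact ⟨fun e => h.ne (congrArg Subtype.val e), Or.inl (Or.inl ⟨⟨_, hF⟩, ho, rfl⟩)⟩
      exact ⟨⟨w, mem_verts_right hF⟩, hxx'.trans ((wiredGraph_reachable_of_reachable
        (y := ⟨v, mem_verts_left hF⟩) hx'v).trans hvw.reachable), Reachable.refl _⟩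
    · exact ⟨x', hxx', hx'v.trans (openGraph_adj.2 ⟨h, hF, ho⟩).reachable⟩

lemma wiredGraph_reachable_iff {F : Finset L.Edge} {ω : L.Config} {x y : L.verts F} :
    (L.wiredGraph F (L.inducedBC F ω) (fun e => ω e)).Reachable x y ↔
      (L.openGraph ∅ ω).Reachable x y := by
  constructor
  · rintro ⟨w⟩
    induction w with
    | nil => exact Reachable.refl _
    | cons hadj _ ih => exact (openGraph_reachable_of_wiredGraph_adj hadj).trans ih
  · rintro ⟨w⟩
    obtain ⟨x', hxx', hx'y⟩ := exists_wiredGraph_reachable w rfl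
    exact hxx'.trans (wiredGraph_reachable_of_reachable hx'y)

instance finite_verts (F : Finset L.Edge) : Finite (L.verts F) := by
  have : L.verts F = ⋃ e ∈ F, {x | x ∈ (e : Sym2 Plane)} := by
    ext x; simp [verts]
  rw [Set.finite_coe_iff, this]
  refine F.finite_toSet.biUnion fun e _ => ?_
  obtain ⟨⟨a, b⟩, hab⟩ := Quot.exists_rep (e : Sym2 Plane)
  have : {x | x ∈ (e : Sym2 Plane)} ⊆ {a, b} := fun x hx => by
    rw [Set.mem_ofPred_eq, ← hab] at hx
    simpa using Sym2.mem_iff.1 hx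
  exact (Set.toFinite _).subset this

instance finite_boundary (F : Finset L.Edge) : Finite (L.boundary F) :=
  Set.finite_coe_iff.2 ((Set.finite_coe_iff.1 (finite_verts F)).subset fun _ hx => hx.1)

instance finite_boundaryCondition (F : Finset L.Edge) : Finite (L.BoundaryCondition F) :=
  Finite.of_injective (fun ξ : L.BoundaryCondition F => ξ.r) fun _ _ h => Setoid.ext_iff.2
    fun {a b} => Iff.of_eq (congrFun (congrFun h a) b)

/-- The end-points of `e` are connected in the wired configuration. For a configuration in which `e`
is closed this decides whether opening `e` lowers the number of clusters. -/
def Linked {F : Finset L.Edge} (ξ : L.BoundaryCondition F) (η : F → Bool) (e : F) : Prop :=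
  ∃ u v : L.verts F, ((e : L.Edge) : Sym2 Plane) = s((u : Plane), (v : Plane)) ∧
    (L.wiredGraph F ξ η).Reachable u v

lemma exists_endpoints {F : Finset L.Edge} (e : F) : ∃ u v : L.verts F,
    ((e : L.Edge) : Sym2 Plane) = s((u : Plane), (v : Plane)) ∧ u ≠ v := by
  obtain ⟨⟨e, he⟩, hF⟩ := e
  induction e with | _ a b => ?_
  exact ⟨⟨a, mem_verts_left hF⟩, ⟨b, mem_verts_right hF⟩, rfl,
    fun h => (L.graph.mem_edgeSet.1 he).ne (congrArg Subtype.val h)⟩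

lemma linked_iff {F : Finset L.Edge} {ξ : L.BoundaryCondition F} {η : F → Bool} {e : F}
    {u v : L.verts F} (he : ((e : L.Edge) : Sym2 Plane) = s((u : Plane), (v : Plane))) :
    Linked ξ η e ↔ (L.wiredGraph F ξ η).Reachable u v := by
  constructor
  · rintro ⟨a, b, hab, h⟩
    rw [he, Sym2.eq_iff] at hab
    rcases hab with ⟨h1, h2⟩ | ⟨h1, h2⟩
    · rwa [Subtype.ext h1, Subtype.ext h2]
    · rw [Subtype.ext h1, Subtype.ext h2]; exact h.symm
  · exact fun h => ⟨u, v, he, h⟩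

lemma wiredGraph_mono {F : Finset L.Edge} {ξ : L.BoundaryCondition F} {η η' : F → Bool}
    (h : η ≤ η') : L.wiredGraph F ξ η ≤ L.wiredGraph F ξ η' := by
  intro x y hxy
  rw [wiredGraph, fromRel_adj] at hxy ⊢
  have open_mono : ∀ e : F, η e = true → η' e = true := fun e he => by
    have := h e
    rw [he] at this
    exact top_le_iff.1 this
  refine ⟨hxy.1, hxy.2.imp (Or.imp_left ?_) (Or.imp_left ?_)⟩ <;>
  · rintro ⟨e, he, h'⟩
    exact ⟨e, open_mono e he, h'⟩

open Classical in
lemma wiredGraph_update {F : Finset L.Edge} (ξ : L.BoundaryCondition F) (η : F → Bool) {e : F}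
    {u v : L.verts F} (he : ((e : L.Edge) : Sym2 Plane) = s((u : Plane), (v : Plane)))
    (huv : u ≠ v) : L.wiredGraph F ξ (Function.update η e true) =
      L.wiredGraph F ξ (Function.update η e false) ⊔ edge u v := by
  apply le_antisymm
  · intro x y hxy
    rw [sup_adj, edge_adj]
    by_cases hs : s(x, y) = s(u, v)
    · rw [Sym2.eq_iff] at hs
      exact Or.inr ⟨by simpa using hs, hxy.ne⟩
    · left
      have hs' : s((x : Plane), (y : Plane)) ≠ s((u : Plane), (v : Plane)) := fun h => hs (by
        rw [Sym2.eq_iff] at h ⊢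
        simpa [Subtype.ext_iff] using h)
      rw [wiredGraph, fromRel_adj] at hxy ⊢
      have open_of_open : ∀ e' : F, ((e' : L.Edge) : Sym2 Plane) = s((x : Plane), (y : Plane)) →
          Function.update η e true e' = true → Function.update η e false e' = true := by
        intro e' h1 h2
        have : e' ≠ e := fun h => hs' (by rw [← h1, h, he])
        rwa [Function.update_of_ne this] at h2 ⊢
      refine ⟨hxy.1, hxy.2.imp (Or.imp_left ?_) (Or.imp_left ?_)⟩
      · rintro ⟨e', h1, h2⟩
        exact ⟨e', open_of_open e' h2 h1, h2⟩
      · rintro ⟨e', h1, h2⟩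
        exact ⟨e', open_of_open e' (h2.trans Sym2.eq_swap) h1, h2⟩
  · refine sup_le (wiredGraph_mono ?_) ?_
    · exact update_le_update_iff.2 ⟨by simp, fun _ _ => le_rfl⟩
    · intro x y hxy
      rw [edge_adj] at hxy
      rw [wiredGraph, fromRel_adj]
      refine ⟨hxy.2, ?_⟩
      rcases hxy.1 with ⟨rfl, rfl⟩ | ⟨rfl, rfl⟩
      · exact Or.inl (Or.inl ⟨e, by simp, he⟩)
      · exact Or.inr (Or.inl ⟨e, by simp, he⟩)

section Weights

variable {p q : ℝ} {F : Finset L.Edge} (ξ : L.BoundaryCondition F)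

open Classical in
lemma weight_update_of_linked {η : F → Bool} {e : F}
    (h : Linked ξ (Function.update η e false) e) :
    L.weight p q F ξ (Function.update η e true) * (1 - p) =
      p * L.weight p q F ξ (Function.update η e false) := by
  obtain ⟨u, v, he, huv⟩ := exists_endpoints e
  have hk : L.numClusters F ξ (Function.update η e true) =
      L.numClusters F ξ (Function.update η e false) := by
    rw [numClusters, wiredGraph_update ξ η he huv]
    exact card_connectedComponent_sup_edge_of_reachable ((linked_iff he).1 h)
  have h1 := card_update_eq η e true
  have h2 := card_update_eq η e false
  simp only [Bool.not_true, Bool.not_false] at h1 h2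
  rw [weight, weight, hk, h1, h2]
  ring

open Classical in
lemma weight_update_of_not_linked {η : F → Bool} {e : F}
    (h : ¬ Linked ξ (Function.update η e false) e) :
    L.weight p q F ξ (Function.update η e true) * (q * (1 - p)) =
      p * L.weight p q F ξ (Function.update η e false) := by
  obtain ⟨u, v, he, huv⟩ := exists_endpoints e
  have hk : L.numClusters F ξ (Function.update η e true) + 1 =
      L.numClusters F ξ (Function.update η e false) := by
    rw [numClusters, wiredGraph_update ξ η he huv]
    exact card_connectedComponent_sup_edge_of_not_reachable fun hr => h ((linked_iff he).2 hr)
  have h1 := card_update_eq η e true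
  have h2 := card_update_eq η e false
  simp only [Bool.not_true, Bool.not_false] at h1 h2
  rw [weight, weight, ← hk, h1, h2]
  ring

lemma weight_pos (hp : 0 < p) (hp1 : p < 1) (hq : 1 ≤ q) (η : F → Bool) :
    0 < L.weight p q F ξ η := by
  unfold weight
  have : 0 < 1 - p := by linarith
  positivity

open Classical in
lemma weight_update_mul_le (hp : 0 < p) (hp1 : p < 1) (hq : 1 ≤ q) {η η' : F → Bool} (h : η ≤ η')
    (e : F) :
    L.weight p q F ξ (Function.update η e true) * L.weight p q F ξ (Function.update η' e false) ≤
      L.weight p q F ξ (Function.update η e false) *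
        L.weight p q F ξ (Function.update η' e true) := by
  have linked_mono : Linked ξ (Function.update η e false) e →
      Linked ξ (Function.update η' e false) e := fun ⟨u, v, he, hr⟩ =>
    ⟨u, v, he, hr.mono (wiredGraph_mono (update_le_update_iff.2 ⟨le_rfl, fun j _ => h j⟩))⟩
  obtain ⟨r, r', hr, hr', hrr'⟩ : ∃ r r' : ℝ,
      L.weight p q F ξ (Function.update η e true) * r =
        p * L.weight p q F ξ (Function.update η e false) ∧
      L.weight p q F ξ (Function.update η' e true) * r' =
        p * L.weight p q F ξ (Function.update η' e false) ∧ r' ≤ r := by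
    by_cases hl : Linked ξ (Function.update η e false) e
    · exact ⟨_, _, weight_update_of_linked ξ hl, weight_update_of_linked ξ (linked_mono hl), le_rfl⟩
    · by_cases hl' : Linked ξ (Function.update η' e false) e
      · exact ⟨_, _, weight_update_of_not_linked ξ hl, weight_update_of_linked ξ hl',
          le_mul_of_one_le_left (sub_nonneg.2 hp1.le) hq⟩
      · exact ⟨_, _, weight_update_of_not_linked ξ hl, weight_update_of_not_linked ξ hl', le_rfl⟩
  have hw := weight_pos ξ hp hp1 hq (Function.update η e true)
  have hw' := weight_pos ξ hp hp1 hq (Function.update η' e true)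
  refine le_of_mul_le_mul_left ?_ hp
  calc p * (L.weight p q F ξ (Function.update η e true) *
        L.weight p q F ξ (Function.update η' e false))
      = L.weight p q F ξ (Function.update η e true) *
          (L.weight p q F ξ (Function.update η' e true) * r') := by rw [hr']; ring
    _ ≤ L.weight p q F ξ (Function.update η e true) *
          (L.weight p q F ξ (Function.update η' e true) * r) := by gcongr
    _ = _ := by linear_combination L.weight p q F ξ (Function.update η' e true) * hr

lemma weight_lattice (hp : 0 < p) (hp1 : p < 1) (hq : 1 ≤ q) (a b : F → Bool) :
    L.weight p q F ξ a * L.weight p q F ξ b ≤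
      L.weight p q F ξ (a ⊓ b) * L.weight p q F ξ (a ⊔ b) := by
  classical
  exact mul_le_inf_mul_sup_of_update (weight_pos ξ hp hp1 hq)
    (fun _ _ h e => weight_update_mul_le ξ hp hp1 hq h e) a b

end Weights

end PlanarLattice

/-! ### Infinite-volume measures and the states of single edges -/

namespace PlanarLattice

open SimpleGraph MeasureTheory

variable {L : PlanarLattice}

instance countable_edge : Countable L.Edge := by
  have hV : L.V.Countable := by
    have : L.V = ⋃ n : ℕ, L.V ∩ Metric.closedBall 0 n := by
      rw [← Set.inter_iUnion, Metric.iUnion_closedBall_nat, Set.inter_univ]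
    rw [this]
    exact Set.countable_iUnion fun n =>
      (L.finite_of_bounded _ Metric.isBounded_closedBall).countable
  have hV' := hV.to_subtype
  have hsub : L.graph.edgeSet ⊆ Set.range (Sym2.map (Subtype.val : L.V → Plane)) := by
    intro e he
    induction e with | _ a b => ?_
    exact ⟨s(⟨a, L.mem_of_adj _ _ he⟩, ⟨b, L.mem_of_adj _ _ (L.graph.mem_edgeSet.1 he).symm⟩), rfl⟩
  have : Countable (Sym2 L.V) := Quotient.countable
  exact ((Set.countable_range _).mono hsub).to_subtype

lemma measurableSet_eq (e : L.Edge) (b : Bool) : MeasurableSet {ω : L.Config | ω e = b} :=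
  (measurable_pi_apply e : Measurable fun ω : L.Config => ω e) (measurableSet_singleton b)

lemma reachable_iff_exists_finset {S : Set L.Edge} {ω : L.Config} {x y : Plane} :
    (L.openGraph S ω).Reachable x y ↔ ∃ T : Finset L.Edge,
      (fromEdgeSet {e : Sym2 Plane | ∃ h : e ∈ L.graph.edgeSet, (⟨e, h⟩ : L.Edge) ∈ T}).Reachable
        x y ∧ ∀ e ∈ T, e ∉ S ∧ ω e = true := by
  classical
  constructor
  · rintro ⟨w⟩
    induction w with
    | nil => exact ⟨∅, Reachable.refl _, by simp⟩
    | @cons a b c hadj _ ih =>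
      obtain ⟨T, hT, hT'⟩ := ih
      obtain ⟨h, h1, h2⟩ := openGraph_adj.1 hadj
      refine ⟨insert ⟨s(a, b), h⟩ T, ?_, ?_⟩
      · refine Reachable.trans (Adj.reachable ?_) (hT.mono (fromEdgeSet_mono ?_))
        · rw [fromEdgeSet_adj]
          exact ⟨⟨h, Finset.mem_insert_self _ _⟩, h.ne⟩
        · rintro e ⟨he, he'⟩
          exact ⟨he, Finset.mem_insert_of_mem he'⟩
      · simp only [Finset.forall_mem_insert]
        exact ⟨⟨h1, h2⟩, hT'⟩
  · rintro ⟨T, hT, hT'⟩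
    refine hT.mono (fromEdgeSet_mono ?_)
    rintro e ⟨he, he'⟩
    exact ⟨he, hT' _ he'⟩

lemma measurableSet_reachable (S : Set L.Edge) (x y : Plane) :
    MeasurableSet {ω : L.Config | (L.openGraph S ω).Reachable x y} := by
  simp only [reachable_iff_exists_finset]
  rw [Set.ofPred_exists]
  refine MeasurableSet.iUnion fun T => ?_
  by_cases hT : (fromEdgeSet {e : Sym2 Plane | ∃ h : e ∈ L.graph.edgeSet,
      (⟨e, h⟩ : L.Edge) ∈ T}).Reachable x y
  · have : {ω : L.Config | (fromEdgeSet {e : Sym2 Plane | ∃ h : e ∈ L.graph.edgeSet,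
      (⟨e, h⟩ : L.Edge) ∈ T}).Reachable x y ∧ ∀ e ∈ T, e ∉ S ∧ ω e = true} =
        ⋂ e ∈ T, {ω | e ∉ S ∧ ω e = true} := by
      ext ω; simp [hT]
    rw [this]
    exact Finset.measurableSet_biInter _ fun e _ =>
      (MeasurableSet.const _).inter (measurableSet_eq e true)
  · simp [hT]

lemma measurableSet_inducedBC (F : Finset L.Edge) (ξ : L.BoundaryCondition F) :
    MeasurableSet {ω : L.Config | L.inducedBC F ω = ξ} := by
  have : {ω : L.Config | L.inducedBC F ω = ξ} = ⋂ a : L.boundary F, ⋂ b : L.boundary F,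
      {ω | (L.openGraph F ω).Reachable a b ↔ ξ.r a b} := by
    ext ω
    simp only [Set.mem_ofPred_eq, Set.mem_iInter, ← inducedBC_r_iff]
    exact Setoid.ext_iff
  rw [this]
  refine MeasurableSet.iInter fun a => MeasurableSet.iInter fun b => ?_
  exact (measurableSet_reachable _ _ _).iff (MeasurableSet.const _)

lemma openGraph_congr {S : Set L.Edge} {ω ω' : L.Config} (h : ∀ e ∉ S, ω e = ω' e) :
    L.openGraph S ω = L.openGraph S ω' := by
  ext x y
  rw [openGraph_adj, openGraph_adj]
  refine exists_congr fun hxy => and_congr_right fun hS => ?_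
  rw [h _ hS]

lemma inducedBC_congr {F : Finset L.Edge} {ω ω' : L.Config} (h : ∀ e ∉ F, ω e = ω' e) :
    L.inducedBC F ω = L.inducedBC F ω' :=
  Setoid.ext_iff.2 fun {a b} => by
    change (L.openGraph F ω).Reachable a b ↔ (L.openGraph F ω').Reachable a b
    rw [openGraph_congr h]

open Classical in
/-- The configuration obtained by closing `e`. The preimages under this map are the events that do
not depend on the state of `e`. -/
noncomputable def closeEdge (e : L.Edge) (ω : L.Config) : L.Config := Function.update ω e false

lemma closeEdge_self (e : L.Edge) (ω : L.Config) : closeEdge e ω e = false := by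
  simp [closeEdge]

lemma closeEdge_of_ne {e e' : L.Edge} (h : e' ≠ e) (ω : L.Config) : closeEdge e ω e' = ω e' := by
  simp [closeEdge, h]

lemma measurable_closeEdge (e : L.Edge) : Measurable (closeEdge e : L.Config → L.Config) := by
  refine measurable_pi_iff.2 fun e' => ?_
  by_cases h : e' = e
  · subst h; simp only [closeEdge_self]; exact measurable_const
  · simp only [closeEdge_of_ne h]; exact measurable_pi_apply e'

/-- The event that the end-points of `e` are connected by a path of open edges other than `e`. -/
def Bridged (e : L.Edge) : Set L.Config :=
  {ω | ∃ x y : Plane, (e : Sym2 Plane) = s(x, y) ∧ (L.openGraph {e} ω).Reachable x y}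

lemma mem_bridged_iff {e : L.Edge} {x y : Plane} (he : (e : Sym2 Plane) = s(x, y))
    {ω : L.Config} : ω ∈ Bridged e ↔ (L.openGraph {e} ω).Reachable x y := by
  constructor
  · rintro ⟨a, b, hab, h⟩
    rw [he, Sym2.eq_iff] at hab
    rcases hab with ⟨rfl, rfl⟩ | ⟨rfl, rfl⟩
    · exact h
    · exact h.symm
  · exact fun h => ⟨x, y, he, h⟩

lemma measurableSet_bridged (e : L.Edge) : MeasurableSet (Bridged e : Set L.Config) := by
  obtain ⟨⟨x, y⟩, hxy⟩ := Quot.exists_rep (e : Sym2 Plane)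
  have : (Bridged e : Set L.Config) = {ω | (L.openGraph {e} ω).Reachable x y} := by
    ext ω; exact mem_bridged_iff hxy.symm
  rw [this]
  exact measurableSet_reachable _ _ _

lemma openGraph_closeEdge (e : L.Edge) (ω : L.Config) :
    L.openGraph ∅ (closeEdge e ω) = L.openGraph {e} ω := by
  ext x y
  rw [openGraph_adj, openGraph_adj]
  refine exists_congr fun hxy => ?_
  by_cases h : (⟨s(x, y), hxy⟩ : L.Edge) = e
  · simp [h, closeEdge_self]
  · simp [h, closeEdge_of_ne h]

open Classical in
lemma mem_bridged_iff_linked {F : Finset L.Edge} {ω : L.Config} (e : F) {η : F → Bool}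
    (h : ∀ e' : F, e' ≠ e → ω e' = η e') :
    ω ∈ Bridged (e : L.Edge) ↔ Linked (L.inducedBC F ω) (Function.update η e false) e := by
  obtain ⟨u, v, he, -⟩ := exists_endpoints e
  have h1 : L.inducedBC F ω = L.inducedBC F (closeEdge (e : L.Edge) ω) :=
    inducedBC_congr fun e' he' => (closeEdge_of_ne (fun hc => he' (by rw [hc]; exact e.2)) _).symm
  have h2 : Function.update η e false = fun e' : F => closeEdge (e : L.Edge) ω e' := by
    funext e'
    by_cases hee : e' = e
    · subst hee; simp [closeEdge_self]
    · rw [Function.update_of_ne hee, closeEdge_of_ne (fun hc => hee (Subtype.ext hc)), h e' hee]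
  rw [mem_bridged_iff he, linked_iff he, h1, h2, wiredGraph_reachable_iff, openGraph_closeEdge]

/-- The single-edge form of the random-cluster specification: given the states of the other edges,
`e` is open with odds `p : 1 - p` if its end-points are connected without it, and with odds
`p : q (1 - p)` otherwise. -/
def SingleEdge (p q : ℝ) (φ : Measure L.Config) : Prop :=
  IsProbabilityMeasure φ ∧ ∀ (e : L.Edge) (G : Set L.Config), MeasurableSet G →
    ENNReal.ofReal (1 - p) * φ (closeEdge e ⁻¹' G ∩ {ω | ω e = true} ∩ Bridged e) =
      ENNReal.ofReal p * φ (closeEdge e ⁻¹' G ∩ {ω | ω e = false} ∩ Bridged e) ∧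
    ENNReal.ofReal (q * (1 - p)) * φ (closeEdge e ⁻¹' G ∩ {ω | ω e = true} ∩ (Bridged e)ᶜ) =
      ENNReal.ofReal p * φ (closeEdge e ⁻¹' G ∩ {ω | ω e = false} ∩ (Bridged e)ᶜ)

/-- The event that the configuration in `F` is `η`. -/
def agreeOn {F : Finset L.Edge} (η : F → Bool) : Set L.Config := {ω | ∀ e : F, ω e = η e}

lemma measurableSet_agreeOn {F : Finset L.Edge} (η : F → Bool) :
    MeasurableSet (agreeOn η : Set L.Config) := by
  have : (agreeOn η : Set L.Config) = ⋂ e : F, {ω | ω e = η e} := by ext ω; simp [agreeOn]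
  rw [this]
  exact MeasurableSet.iInter fun e => measurableSet_eq _ _

/-- The event of agreeing with `η` on `F`: the version of `agreeOn` whose second argument does not
depend on `F`. -/
def cylinder (F : Finset L.Edge) (η : L.Config) : Set L.Config := {ω | ∀ e ∈ F, ω e = η e}

lemma measurableSet_cylinder (F : Finset L.Edge) (η : L.Config) :
    MeasurableSet (cylinder F η) := by
  have : cylinder F η = agreeOn fun e : F => η e := by ext ω; simp [cylinder, agreeOn]
  exact this ▸ measurableSet_agreeOn _

lemma isPiSystem_cylinder : IsPiSystem {S : Set L.Config | ∃ F η, S = cylinder F η} := by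
  classical
  rintro _ ⟨F, η, rfl⟩ _ ⟨F', η', rfl⟩ ⟨ω₀, h₀, h₀'⟩
  refine ⟨F ∪ F', ω₀, Set.ext fun ω => ?_⟩
  simp only [cylinder, Set.mem_inter_iff, Set.mem_ofPred_eq, Finset.mem_union, or_imp, forall_and]
  refine and_congr (forall₂_congr fun e he => ?_) (forall₂_congr fun e he => ?_)
  · rw [h₀ e he]
  · rw [h₀' e he]

lemma generateFrom_cylinder :
    MeasurableSpace.generateFrom {S : Set L.Config | ∃ F η, S = cylinder F η} =
      MeasurableSpace.pi := by
  apply le_antisymm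
  · refine MeasurableSpace.generateFrom_le ?_
    rintro _ ⟨F, η, rfl⟩
    exact measurableSet_cylinder F η
  · refine iSup_le fun e => ?_
    rw [← measurable_iff_comap_le]
    refine @measurable_to_countable' _ _ _ _ (_) _ fun b => ?_
    exact MeasurableSpace.measurableSet_generateFrom ⟨{e}, fun _ => b, by ext; simp [cylinder]⟩

lemma ext_of_cylinder {μ ν : Measure L.Config} [IsFiniteMeasure μ]
    (h : ∀ F η, μ (cylinder F η) = ν (cylinder F η)) : μ = ν := by
  refine ext_of_generate_finite _ generateFrom_cylinder.symm isPiSystem_cylinder ?_ ?_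
  · rintro _ ⟨F, η, rfl⟩
    exact h F η
  · simpa [cylinder] using h ∅ fun _ => true

lemma measure_eq_sum_inducedBC (φ : Measure L.Config) (F : Finset L.Edge)
    [Fintype (L.BoundaryCondition F)] (S : Set L.Config) :
    φ S = ∑ ξ : L.BoundaryCondition F, φ (S ∩ {ω | L.inducedBC F ω = ξ}) := by
  have := sum_measure_preimage_singleton (μ := φ.restrict S) (f := fun ω => L.inducedBC F ω)
    Finset.univ fun ξ _ => measurableSet_inducedBC F ξ
  simp only [Finset.coe_univ, Set.preimage_univ, Measure.restrict_apply_univ] at this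
  rw [← this]
  refine Finset.sum_congr rfl fun ξ _ => ?_
  change (φ.restrict S) {ω | L.inducedBC F ω = ξ} = _
  rw [Measure.restrict_apply (measurableSet_inducedBC F ξ), Set.inter_comm]

section

variable {p q : ℝ}

lemma partitionFunction_pos (hp : 0 < p) (hp1 : p < 1) (hq : 1 ≤ q) (F : Finset L.Edge)
    (ξ : L.BoundaryCondition F) : 0 < L.partitionFunction p q F ξ :=
  Finset.sum_pos (fun η _ => weight_pos ξ hp hp1 hq η) Finset.univ_nonempty

lemma IsInfiniteVolume.measure_inter {φ : Measure L.Config} (hφ : L.IsInfiniteVolume p q φ)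
    (F : Finset L.Edge) (ξ : L.BoundaryCondition F) (η : F → Bool) :
    φ (agreeOn η ∩ {ω | L.inducedBC F ω = ξ}) =
      ENNReal.ofReal (L.finiteVolumeProb p q F ξ η) * φ {ω | L.inducedBC F ω = ξ} := by
  have := hφ.1
  by_cases h0 : φ {ω | L.inducedBC F ω = ξ} = 0
  · rw [h0, mul_zero]
    exact measure_mono_null Set.inter_subset_right h0
  · rw [← hφ.2 F ξ h0 η, ProbabilityTheory.cond_apply (measurableSet_inducedBC F ξ), mul_comm,
      ← mul_assoc, ENNReal.mul_inv_cancel h0 (measure_ne_top _ _), one_mul, Set.inter_comm]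
    rfl

lemma IsInfiniteVolume.measure_inter_eq_sum {φ : Measure L.Config}
    (hφ : L.IsInfiniteVolume p q φ) {F : Finset L.Edge} [Fintype (L.BoundaryCondition F)]
    {P : L.BoundaryCondition F → Prop} [DecidablePred P] {B : Set L.Config} {η : F → Bool}
    (hB : ∀ ω ∈ agreeOn η, (ω ∈ B ↔ P (L.inducedBC F ω))) :
    φ (agreeOn η ∩ B) = ∑ ξ, if P ξ then
      ENNReal.ofReal (L.finiteVolumeProb p q F ξ η) * φ {ω | L.inducedBC F ω = ξ} else 0 := by
  rw [measure_eq_sum_inducedBC φ F]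
  refine Finset.sum_congr rfl fun ξ _ => ?_
  split_ifs with hξ
  · rw [← hφ.measure_inter]
    congr 1
    ext ω
    refine ⟨fun ⟨⟨hη, _⟩, hω⟩ => ⟨hη, hω⟩, fun ⟨hη, hω⟩ => ⟨⟨hη, (hB ω hη).2 ?_⟩, hω⟩⟩
    rwa [show L.inducedBC F ω = ξ from hω]
  · convert measure_empty (μ := φ)
    refine Set.eq_empty_of_forall_notMem fun ω ⟨⟨hη, hωB⟩, hω⟩ => hξ ?_
    rw [← show L.inducedBC F ω = ξ from hω]
    exact (hB ω hη).1 hωB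

lemma IsInfiniteVolume.mul_measure_inter_eq {φ : Measure L.Config}
    (hφ : L.IsInfiniteVolume p q φ) {F : Finset L.Edge} {P : L.BoundaryCondition F → Prop}
    {B : Set L.Config} {a b : ℝ} (ha : 0 ≤ a) (hb : 0 ≤ b) {η η' : F → Bool}
    (hB : ∀ ω ∈ agreeOn η, (ω ∈ B ↔ P (L.inducedBC F ω)))
    (hB' : ∀ ω ∈ agreeOn η', (ω ∈ B ↔ P (L.inducedBC F ω)))
    (hweight : ∀ ξ, P ξ → L.weight p q F ξ η * a = b * L.weight p q F ξ η') :
    ENNReal.ofReal a * φ (agreeOn η ∩ B) =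
      ENNReal.ofReal b * φ (agreeOn η' ∩ B) := by
  classical
  have := Fintype.ofFinite (L.BoundaryCondition F)
  rw [hφ.measure_inter_eq_sum hB, hφ.measure_inter_eq_sum hB', Finset.mul_sum, Finset.mul_sum]
  refine Finset.sum_congr rfl fun ξ _ => ?_
  split_ifs with hξ
  · rw [← mul_assoc, ← mul_assoc, ← ENNReal.ofReal_mul ha, ← ENNReal.ofReal_mul hb,
      finiteVolumeProb, finiteVolumeProb, mul_div_assoc', mul_div_assoc', ← hweight ξ hξ,
      mul_comm a]
  · rw [mul_zero, mul_zero]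

lemma closeEdge_preimage_cylinder_eq_empty {e : L.Edge} {F : Finset L.Edge} {η : L.Config}
    (h : e ∈ F ∧ η e = true) : closeEdge e ⁻¹' cylinder F η = ∅ := by
  ext ω
  simp only [Set.mem_preimage, Set.mem_empty_iff_false, iff_false]
  intro hω
  have := hω e h.1
  rw [closeEdge_self, h.2] at this
  exact absurd this (by simp)

open Classical in
lemma closeEdge_preimage_cylinder {e : L.Edge} {F : Finset L.Edge} {η : L.Config}
    (h : ¬ (e ∈ F ∧ η e = true)) (b : Bool) :
    closeEdge e ⁻¹' cylinder F η ∩ {ω | ω e = b} =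
      agreeOn (Function.update (fun e' : (insert e F : Finset L.Edge) => η e')
        ⟨e, Finset.mem_insert_self e F⟩ b) := by
  ext ω
  constructor
  · rintro ⟨h1, h2⟩ ⟨e', he'⟩
    by_cases hee : e' = e
    · subst hee; simpa using h2
    · have hF : e' ∈ F := (Finset.mem_insert.1 he').resolve_left hee
      rw [Function.update_of_ne (fun hc => hee (congrArg Subtype.val hc))]
      have := h1 e' hF
      rwa [closeEdge_of_ne hee] at this
  · intro h1
    refine ⟨fun e' he' => ?_, ?_⟩
    · by_cases hee : e' = e
      · subst hee
        rw [closeEdge_self]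
        cases hη : η e' with
        | false => rfl
        | true => exact absurd ⟨he', hη⟩ h
      · have := h1 ⟨e', Finset.mem_insert_of_mem he'⟩
        rw [Function.update_of_ne (fun hc => hee (congrArg Subtype.val hc))] at this
        rwa [closeEdge_of_ne hee]
    · have := h1 ⟨e, Finset.mem_insert_self e F⟩
      simpa using this

lemma measure_closeEdge_ext {φ : Measure L.Config} [IsFiniteMeasure φ] {e : L.Edge} {a b : ℝ}
    {A B : Set L.Config} (h : ∀ F η, ENNReal.ofReal a * φ (closeEdge e ⁻¹' cylinder F η ∩ A) =
      ENNReal.ofReal b * φ (closeEdge e ⁻¹' cylinder F η ∩ B))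
    {G : Set L.Config} (hG : MeasurableSet G) :
    ENNReal.ofReal a * φ (closeEdge e ⁻¹' G ∩ A) =
      ENNReal.ofReal b * φ (closeEdge e ⁻¹' G ∩ B) := by
  have scaled_map_apply : ∀ (c : ℝ) (A G : Set L.Config), MeasurableSet G →
      (ENNReal.ofReal c • (φ.restrict A).map (closeEdge e)) G =
        ENNReal.ofReal c * φ (closeEdge e ⁻¹' G ∩ A) := by
    intro c A G hG
    rw [Measure.smul_apply, Measure.map_apply (measurable_closeEdge e) hG,
      Measure.restrict_apply (measurable_closeEdge e hG), smul_eq_mul]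
  have : IsFiniteMeasure (ENNReal.ofReal a • (φ.restrict A).map (closeEdge e)) :=
    ⟨by
      rw [scaled_map_apply a A _ MeasurableSet.univ]
      exact ENNReal.mul_lt_top ENNReal.ofReal_lt_top (measure_lt_top _ _)⟩
  have := ext_of_cylinder (μ := ENNReal.ofReal a • (φ.restrict A).map (closeEdge e))
    (ν := ENNReal.ofReal b • (φ.restrict B).map (closeEdge e)) (fun F η => by
      rw [scaled_map_apply a A _ (measurableSet_cylinder F η),
        scaled_map_apply b B _ (measurableSet_cylinder F η)]
      exact h F η)
  rw [← scaled_map_apply a A G hG, ← scaled_map_apply b B G hG, this]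

lemma IsInfiniteVolume.mul_measure_closeEdge_eq {φ : Measure L.Config}
    (hφ : L.IsInfiniteVolume p q φ) (hp : 0 ≤ p) {a : ℝ} (ha : 0 ≤ a) {e : L.Edge}
    {B : Set L.Config} {P : ∀ F : Finset L.Edge, F → (F → Bool) → L.BoundaryCondition F → Prop}
    (hB : ∀ (F : Finset L.Edge) (he : e ∈ F) (η : F → Bool) (ω : L.Config),
      (∀ e' : F, e' ≠ ⟨e, he⟩ → ω e' = η e') → (ω ∈ B ↔ P F ⟨e, he⟩ η (L.inducedBC F ω)))
    (hweight : ∀ (F : Finset L.Edge) (e : F) (η : F → Bool) ξ, P F e η ξ →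
      L.weight p q F ξ (Function.update η e true) * a =
        p * L.weight p q F ξ (Function.update η e false))
    {G : Set L.Config} (hG : MeasurableSet G) :
    ENNReal.ofReal a * φ (closeEdge e ⁻¹' G ∩ {ω | ω e = true} ∩ B) =
      ENNReal.ofReal p * φ (closeEdge e ⁻¹' G ∩ {ω | ω e = false} ∩ B) := by
  have := hφ.1
  have hB' : ∀ (F : Finset L.Edge) (he : e ∈ F) (η : F → Bool) (b : Bool),
      ∀ ω ∈ agreeOn (Function.update η ⟨e, he⟩ b),
        (ω ∈ B ↔ P F ⟨e, he⟩ η (L.inducedBC F ω)) := fun F he η b ω hω =>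
    hB F he η ω fun e' he' => by rw [hω, Function.update_of_ne he']
  rw [Set.inter_assoc, Set.inter_assoc]
  refine measure_closeEdge_ext (fun F η => ?_) hG
  by_cases h : e ∈ F ∧ η e = true
  · simp only [closeEdge_preimage_cylinder_eq_empty h, Set.empty_inter, measure_empty, mul_zero]
  · rw [← Set.inter_assoc, ← Set.inter_assoc, closeEdge_preimage_cylinder h,
      closeEdge_preimage_cylinder h]
    have he := Finset.mem_insert_self e F
    exact hφ.mul_measure_inter_eq ha hp (hB' _ he _ true) (hB' _ he _ false) (hweight _ _ _)

theorem IsInfiniteVolume.singleEdge {φ : Measure L.Config} (hφ : L.IsInfiniteVolume p q φ)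
    (hp : 0 < p) (hp1 : p < 1) (hq : 1 ≤ q) : SingleEdge p q φ := by
  classical
  have hp' : 0 ≤ 1 - p := by linarith
  refine ⟨hφ.1, fun e G hG => ⟨?_, ?_⟩⟩
  · exact hφ.mul_measure_closeEdge_eq hp.le hp'
      (P := fun F e η ξ => Linked ξ (Function.update η e false) e)
      (fun F he η ω hω => mem_bridged_iff_linked ⟨e, he⟩ hω)
      (fun F e η ξ hξ => weight_update_of_linked ξ hξ) hG
  · exact hφ.mul_measure_closeEdge_eq hp.le (mul_nonneg (by linarith) hp')
      (P := fun F e η ξ => ¬ Linked ξ (Function.update η e false) e)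
      (fun F he η ω hω => not_congr (mem_bridged_iff_linked ⟨e, he⟩ hω))
      (fun F e η ξ hξ => weight_update_of_not_linked ξ hξ) hG

end

variable {p q : ℝ} {F : Finset L.Edge}

/-- The event `G` is determined by the edges outside `F`. -/
def IsExterior (F : Finset L.Edge) (G : Set L.Config) : Prop :=
  ∀ ω ω' : L.Config, (∀ e ∉ F, ω e = ω' e) → (ω ∈ G ↔ ω' ∈ G)

open Classical in
lemma closeEdge_preimage_agreeOn {F : Finset L.Edge} {G : Set L.Config} (hG : IsExterior F G)
    (η : F → Bool) (e : F) (b : Bool) :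
    closeEdge (e : L.Edge) ⁻¹' (G ∩ agreeOn (Function.update η e false)) ∩ {ω | ω e = b} =
      G ∩ agreeOn (Function.update η e b) := by
  ext ω
  have h1 : closeEdge (e : L.Edge) ω ∈ G ↔ ω ∈ G := hG _ _ fun e' he' =>
    closeEdge_of_ne (fun hc => he' (by rw [hc]; exact e.2)) _
  have h2 : ∀ e' : F, e' ≠ e → closeEdge (e : L.Edge) ω e' = ω e' := fun e' he' =>
    closeEdge_of_ne (fun hc => he' (Subtype.ext hc)) _
  constructor
  · rintro ⟨⟨h3, h4⟩, h5⟩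
    refine ⟨h1.1 h3, fun e' => ?_⟩
    by_cases hee : e' = e
    · subst hee; simpa using h5
    · rw [Function.update_of_ne hee, ← h2 e' hee, h4 e', Function.update_of_ne hee]
  · rintro ⟨h3, h4⟩
    refine ⟨⟨h1.2 h3, fun e' => ?_⟩, ?_⟩
    · by_cases hee : e' = e
      · subst hee; simp [closeEdge_self]
      · rw [h2 e' hee, h4 e', Function.update_of_ne hee, Function.update_of_ne hee]
    · have := h4 e
      simpa using this

open Classical in
lemma SingleEdge.measure_update {φ : Measure L.Config} (hφ : SingleEdge p q φ) (hp : 0 < p)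
    (hp1 : p < 1) (hq : 1 ≤ q) {F : Finset L.Edge} {ξ : L.BoundaryCondition F}
    {G : Set L.Config} (hG : MeasurableSet G) (hGF : IsExterior F G)
    (hξ : ∀ ω ∈ G, L.inducedBC F ω = ξ) (η : F → Bool) (e : F) :
    φ.real (G ∩ agreeOn (Function.update η e true)) *
        L.weight p q F ξ (Function.update η e false) =
      φ.real (G ∩ agreeOn (Function.update η e false)) *
        L.weight p q F ξ (Function.update η e true) := by
  have hp' : 0 < 1 - p := by linarith
  have bridged_iff : ∀ (b : Bool), ∀ ω ∈ G ∩ agreeOn (Function.update η e b),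
      (ω ∈ Bridged (e : L.Edge) ↔ Linked ξ (Function.update η e false) e) := fun b ω h => by
    rw [mem_bridged_iff_linked e (η := η) fun e' he' => by rw [h.2 e', Function.update_of_ne he'],
      hξ ω h.1]
  obtain ⟨a, ha, hmeasure, hweight⟩ : ∃ a : ℝ, 0 ≤ a ∧
      ENNReal.ofReal a * φ (G ∩ agreeOn (Function.update η e true)) =
        ENNReal.ofReal p * φ (G ∩ agreeOn (Function.update η e false)) ∧
      L.weight p q F ξ (Function.update η e true) * a =
        p * L.weight p q F ξ (Function.update η e false) := by
    have hsingle := hφ.2 e _ (hG.inter (measurableSet_agreeOn (Function.update η e false)))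
    rw [closeEdge_preimage_agreeOn hGF, closeEdge_preimage_agreeOn hGF] at hsingle
    by_cases hl : Linked ξ (Function.update η e false) e
    · have hsub : ∀ b, G ∩ agreeOn (Function.update η e b) ⊆ Bridged (e : L.Edge) :=
        fun b ω h => (bridged_iff b ω h).2 hl
      rw [Set.inter_eq_left.2 (hsub _), Set.inter_eq_left.2 (hsub _)] at hsingle
      exact ⟨1 - p, hp'.le, hsingle.1, weight_update_of_linked ξ hl⟩
    · have hsub : ∀ b, G ∩ agreeOn (Function.update η e b) ⊆ (Bridged (e : L.Edge))ᶜ :=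
        fun b ω h hc => hl ((bridged_iff b ω h).1 hc)
      rw [Set.inter_eq_left.2 (hsub _), Set.inter_eq_left.2 (hsub _)] at hsingle
      exact ⟨q * (1 - p), by positivity, hsingle.2, weight_update_of_not_linked ξ hl⟩
  have hreal := congrArg ENNReal.toReal hmeasure
  rw [ENNReal.toReal_mul, ENNReal.toReal_mul, ENNReal.toReal_ofReal ha,
    ENNReal.toReal_ofReal hp.le] at hreal
  refine mul_left_cancel₀ hp.ne' ?_
  simp only [Measure.real]
  linear_combination L.weight p q F ξ (Function.update η e true) * hreal -
    (φ (G ∩ agreeOn (Function.update η e true))).toReal * hweight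

lemma eq_of_forall_update {ι α : Type*} [Finite ι] [DecidableEq ι] {f : (ι → Bool) → α}
    (h : ∀ η e, f (Function.update η e true) = f (Function.update η e false)) (η η' : ι → Bool) :
    f η = f η' := by
  have := Fintype.ofFinite ι
  have h' : ∀ η e b, f (Function.update η e b) = f η := by
    intro η e b
    have : η = Function.update η e (η e) := by simp
    conv_rhs => rw [this]
    cases b <;> cases η e <;> simp [h]
  have piecewise_eq : ∀ T : Finset ι, f (T.piecewise η η') = f η' := by
    intro T
    induction T using Finset.induction_on with
    | empty => simp
    | insert e T _ ih => rw [Finset.piecewise_insert, h', ih]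
  have := piecewise_eq Finset.univ
  rwa [Finset.piecewise_univ] at this

open Classical in
lemma sum_measure_agreeOn (φ : Measure L.Config) [IsFiniteMeasure φ] (F : Finset L.Edge)
    (G : Set L.Config) : ∑ η : F → Bool, φ.real (G ∩ agreeOn η) = φ.real G := by
  have h : ∀ η : F → Bool, (fun (ω : L.Config) (e : F) => ω e) ⁻¹' {η} = agreeOn η := fun η => by
    ext ω
    simp only [Set.mem_preimage, Set.mem_singleton_iff, agreeOn, Set.mem_ofPred_eq, funext_iff]
  have := sum_measure_preimage_singleton (μ := φ.restrict G)
    (f := fun (ω : L.Config) (e : F) => ω e) Finset.univ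
    fun η _ => by rw [h]; exact measurableSet_agreeOn η
  simp only [Finset.coe_univ, Set.preimage_univ, Measure.restrict_apply_univ, h] at this
  rw [Measure.real, ← this, ENNReal.toReal_sum (fun _ _ => measure_ne_top _ _)]
  refine Finset.sum_congr rfl fun η _ => ?_
  rw [Measure.restrict_apply (measurableSet_agreeOn η), Set.inter_comm, Measure.real]

/-- The conditional law of the configuration in `F` is the random-cluster measure given any exterior
event that determines the boundary condition, not only given the boundary condition itself. -/
lemma SingleEdge.measure_inter {φ : Measure L.Config} (hφ : SingleEdge p q φ) (hp : 0 < p)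
    (hp1 : p < 1) (hq : 1 ≤ q) {F : Finset L.Edge} {ξ : L.BoundaryCondition F}
    {G : Set L.Config} (hG : MeasurableSet G) (hGF : IsExterior F G)
    (hξ : ∀ ω ∈ G, L.inducedBC F ω = ξ) (η : F → Bool) :
    φ.real (G ∩ agreeOn η) = L.finiteVolumeProb p q F ξ η * φ.real G := by
  classical
  have := hφ.1
  have hw := fun η => weight_pos ξ hp hp1 hq (F := F) η
  have hc : ∀ η', φ.real (G ∩ agreeOn η') / L.weight p q F ξ η' =
      φ.real (G ∩ agreeOn η) / L.weight p q F ξ η := fun η' =>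
    eq_of_forall_update (f := fun η => φ.real (G ∩ agreeOn η) / L.weight p q F ξ η)
      (fun η e => by
        rw [div_eq_div_iff (hw _).ne' (hw _).ne']
        exact hφ.measure_update hp hp1 hq hG hGF hξ η e) η' η
  have hZ := partitionFunction_pos hp hp1 hq F ξ
  have hsum : φ.real G = φ.real (G ∩ agreeOn η) / L.weight p q F ξ η *
      L.partitionFunction p q F ξ := by
    rw [← sum_measure_agreeOn φ F G, partitionFunction, Finset.mul_sum]
    refine Finset.sum_congr rfl fun η' _ => ?_
    rw [← hc η', div_mul_cancel₀ _ (hw _).ne']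
  rw [hsum, finiteVolumeProb]
  have := (hw η).ne'
  field_simp

lemma isExterior_inducedBC (F : Finset L.Edge) (ξ : L.BoundaryCondition F) :
    IsExterior F {ω | L.inducedBC F ω = ξ} := fun ω ω' h => by
  rw [Set.mem_ofPred_eq, Set.mem_ofPred_eq, inducedBC_congr h]

theorem SingleEdge.isInfiniteVolume {φ : Measure L.Config} (hφ : SingleEdge p q φ) (hp : 0 < p)
    (hp1 : p < 1) (hq : 1 ≤ q) : L.IsInfiniteVolume p q φ := by
  have := hφ.1
  refine ⟨hφ.1, fun F ξ h0 η => ?_⟩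
  have h1 := hφ.measure_inter hp hp1 hq (measurableSet_inducedBC F ξ) (isExterior_inducedBC F ξ)
    (fun _ h => h) η
  change ProbabilityTheory.cond φ _ (agreeOn η) = _
  have h2 : φ.real {ω | L.inducedBC F ω = ξ} ≠ 0 := (measureReal_ne_zero_iff).2 h0
  rw [← ENNReal.ofReal_toReal (measure_ne_top (ProbabilityTheory.cond φ _) _),
    ProbabilityTheory.cond_apply (measurableSet_inducedBC F ξ), ENNReal.toReal_mul,
    ENNReal.toReal_inv]
  congr 1
  change (φ.real _)⁻¹ * φ.real _ = _
  rw [h1]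
  field_simp

/-! ### Conditional probabilities given the exterior -/

open Classical in
/-- The configuration equal to `η` on `F` and to `ω` elsewhere. -/
noncomputable def glue {F : Finset L.Edge} (η : F → Bool) (ω : L.Config) : L.Config :=
  fun e => if h : e ∈ F then η ⟨e, h⟩ else ω e

lemma glue_of_mem {F : Finset L.Edge} (η : F → Bool) (ω : L.Config) (e : F) :
    glue η ω e = η e := by
  simp [glue]

lemma glue_of_notMem {F : Finset L.Edge} (η : F → Bool) (ω : L.Config) {e : L.Edge}
    (h : e ∉ F) : glue η ω e = ω e := by
  simp [glue, h]

lemma glue_congr {F : Finset L.Edge} (η : F → Bool) {ω ω' : L.Config}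
    (h : ∀ e ∉ F, ω e = ω' e) : glue η ω = glue η ω' := by
  funext e
  by_cases he : e ∈ F
  · simp [glue, he]
  · rw [glue_of_notMem η ω he, glue_of_notMem η ω' he, h e he]

lemma glue_eq_self {F : Finset L.Edge} {η : F → Bool} {ω : L.Config} (h : ω ∈ agreeOn η) :
    glue η ω = ω := by
  funext e
  by_cases he : e ∈ F
  · rw [glue_of_mem η ω ⟨e, he⟩, h ⟨e, he⟩]
  · rw [glue_of_notMem η ω he]

lemma measurable_glue {F : Finset L.Edge} (η : F → Bool) :
    Measurable (glue η : L.Config → L.Config) := by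
  refine measurable_pi_iff.2 fun e => ?_
  by_cases he : e ∈ F
  · simp only [glue_of_mem η _ ⟨e, he⟩]; exact measurable_const
  · simp only [glue_of_notMem η _ he]; exact measurable_pi_apply e

lemma glue_mono {F : Finset L.Edge} {η η' : F → Bool} (h : η ≤ η') (ω : L.Config) :
    glue η ω ≤ glue η' ω := by
  intro e
  by_cases he : e ∈ F
  · rw [glue_of_mem η ω ⟨e, he⟩, glue_of_mem η' ω ⟨e, he⟩]; exact h _
  · rw [glue_of_notMem η ω he, glue_of_notMem η' ω he]

open Classical in
/-- The probability of `B` under the random-cluster measure on `F` with the boundary condition and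
the exterior configuration given by `ω`. -/
noncomputable def condProb (p q : ℝ) (F : Finset L.Edge) (B : Set L.Config) (ω : L.Config) : ℝ :=
  ∑ η : F → Bool, L.finiteVolumeProb p q F (L.inducedBC F ω) η *
    (if glue η ω ∈ B then 1 else 0)

lemma condProb_congr {F : Finset L.Edge} (B : Set L.Config) {ω ω' : L.Config}
    (h : ∀ e ∉ F, ω e = ω' e) : condProb p q F B ω = condProb p q F B ω' := by
  refine Finset.sum_congr rfl fun η _ => ?_
  rw [inducedBC_congr h, glue_congr η h]

lemma finiteVolumeProb_nonneg (hp : 0 < p) (hp1 : p < 1) (hq : 1 ≤ q) {F : Finset L.Edge}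
    (ξ : L.BoundaryCondition F) (η : F → Bool) : 0 ≤ L.finiteVolumeProb p q F ξ η :=
  div_nonneg (weight_pos ξ hp hp1 hq η).le (partitionFunction_pos hp hp1 hq F ξ).le

lemma sum_finiteVolumeProb (hp : 0 < p) (hp1 : p < 1) (hq : 1 ≤ q) {F : Finset L.Edge}
    [Fintype (F → Bool)] (ξ : L.BoundaryCondition F) :
    ∑ η : F → Bool, L.finiteVolumeProb p q F ξ η = 1 := by
  simp only [finiteVolumeProb, ← Finset.sum_div]
  convert div_self (partitionFunction_pos hp hp1 hq F ξ).ne'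
  rw [partitionFunction]
  congr!

lemma condProb_nonneg (hp : 0 < p) (hp1 : p < 1) (hq : 1 ≤ q) (F : Finset L.Edge)
    (B : Set L.Config) (ω : L.Config) : 0 ≤ condProb p q F B ω :=
  Finset.sum_nonneg fun η _ => mul_nonneg (finiteVolumeProb_nonneg hp hp1 hq _ _)
    (by split_ifs <;> norm_num)

lemma condProb_le_one (hp : 0 < p) (hp1 : p < 1) (hq : 1 ≤ q) (F : Finset L.Edge)
    (B : Set L.Config) (ω : L.Config) : condProb p q F B ω ≤ 1 := by
  classical
  rw [← sum_finiteVolumeProb hp hp1 hq (L.inducedBC F ω)]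
  refine Finset.sum_le_sum fun η _ => mul_le_of_le_one_right
    (finiteVolumeProb_nonneg hp hp1 hq _ _) (by split_ifs <;> norm_num)

lemma measurable_condProb (F : Finset L.Edge) {B : Set L.Config} (hB : MeasurableSet B) :
    Measurable (condProb p q F B) := by
  classical
  refine Finset.measurable_sum _ fun η _ => Measurable.mul ?_ ?_
  · let _ : MeasurableSpace (L.BoundaryCondition F) := ⊤
    have h1 : Measurable fun ξ => L.finiteVolumeProb p q F ξ η := measurable_from_top
    exact h1.comp (measurable_to_countable' fun ξ => measurableSet_inducedBC F ξ)
  · exact Measurable.ite (measurable_glue η hB) measurable_const measurable_const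

open Classical in
lemma condProb_eq_div (B : Set L.Config) (ω : L.Config) : condProb p q F B ω = (∑ η : F → Bool,
      L.weight p q F (L.inducedBC F ω) η * (if glue η ω ∈ B then 1 else 0)) /
        L.partitionFunction p q F (L.inducedBC F ω) := by
  simp only [condProb, finiteVolumeProb, Finset.sum_div]
  exact Finset.sum_congr rfl fun η _ => by ring

lemma condProb_mul_le (hp : 0 < p) (hp1 : p < 1) (hq : 1 ≤ q) (F : Finset L.Edge)
    {A B : Set L.Config} (hA : IsUpperSet A) (hB : IsUpperSet B) (ω : L.Config) :
    condProb p q F A ω * condProb p q F B ω ≤ condProb p q F (A ∩ B) ω := by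
  classical
  have ite_nonneg : ∀ (A : Set L.Config) (η : F → Bool), 0 ≤ if glue η ω ∈ A then (1 : ℝ) else 0 :=
    fun A η => by split_ifs <;> norm_num
  have ite_mono : ∀ {A : Set L.Config}, IsUpperSet A →
      Monotone fun η : F → Bool => if glue η ω ∈ A then (1 : ℝ) else 0 := fun hA η η' h => by
    dsimp only
    split_ifs with h1 h2
    · exact le_rfl
    · exact absurd (hA (glue_mono h ω) h1) h2
    · exact zero_le_one
    · exact le_rfl
  have ite_mul_ite : ∀ η : F → Bool, (if glue η ω ∈ A then (1 : ℝ) else 0) *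
      (if glue η ω ∈ B then 1 else 0) = if glue η ω ∈ A ∩ B then 1 else 0 := fun η => by
    by_cases h1 : glue η ω ∈ A <;> by_cases h2 : glue η ω ∈ B <;> simp [h1, h2]
  have hfkg := fkg (α := F → Bool) (μ := fun η => L.weight p q F (L.inducedBC F ω) η)
    (f := fun η => if glue η ω ∈ A then 1 else 0) (g := fun η => if glue η ω ∈ B then 1 else 0)
    (fun η => (weight_pos _ hp hp1 hq η).le) (ite_nonneg A) (ite_nonneg B) (ite_mono hA)
    (ite_mono hB) fun a b => weight_lattice _ hp hp1 hq a b
  simp only [ite_mul_ite] at hfkg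
  have hZ := partitionFunction_pos hp hp1 hq F (L.inducedBC F ω)
  rw [condProb_eq_div, condProb_eq_div, condProb_eq_div, div_mul_div_comm,
    div_le_div_iff₀ (mul_pos hZ hZ) hZ]
  calc _ ≤ _ := mul_le_mul_of_nonneg_right hfkg hZ.le
    _ = _ := by rw [partitionFunction, mul_right_comm, mul_comm]; congr!

open Classical in
lemma condProb_eq_sum_indicator (F : Finset L.Edge)
    [Fintype (L.BoundaryCondition F)] (B : Set L.Config) (ω : L.Config) :
    condProb p q F B ω = ∑ ξ : L.BoundaryCondition F, ∑ η : F → Bool,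
      L.finiteVolumeProb p q F ξ η *
        ({ω : L.Config | L.inducedBC F ω = ξ} ∩ glue η ⁻¹' B).indicator 1 ω := by
  rw [Finset.sum_eq_single (L.inducedBC F ω)]
  · rw [condProb]
    refine Finset.sum_congr rfl fun η _ => ?_
    by_cases h : glue η ω ∈ B <;> simp [h]
  · intro ξ _ hξ
    refine Finset.sum_eq_zero fun η _ => ?_
    rw [Set.indicator_of_notMem (fun h => hξ h.1.symm), mul_zero]
  · exact fun h => absurd (Finset.mem_univ _) h

lemma measurableSet_inducedBC_inter_glue (ξ : L.BoundaryCondition F) (η : F → Bool)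
    {B : Set L.Config} (hB : MeasurableSet B) :
    MeasurableSet ({ω : L.Config | L.inducedBC F ω = ξ} ∩ glue η ⁻¹' B) :=
  (measurableSet_inducedBC F ξ).inter (measurable_glue η hB)

open Classical in
lemma SingleEdge.measure_inter_inducedBC {φ : Measure L.Config} (hφ : SingleEdge p q φ)
    (hp : 0 < p) (hp1 : p < 1) (hq : 1 ≤ q) {B D : Set L.Config}
    (hB : MeasurableSet B) (hD : MeasurableSet D) (hDF : IsExterior F D)
    (ξ : L.BoundaryCondition F) :
    φ.real (D ∩ B ∩ {ω | L.inducedBC F ω = ξ}) =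
      ∑ η : F → Bool, L.finiteVolumeProb p q F ξ η *
        φ.real ({ω : L.Config | L.inducedBC F ω = ξ} ∩ glue η ⁻¹' B ∩ D) := by
  have := hφ.1
  rw [← sum_measure_agreeOn φ F]
  refine Finset.sum_congr rfl fun η _ => ?_
  rw [← hφ.measure_inter hp hp1 hq ((measurableSet_inducedBC_inter_glue ξ η hB).inter hD)]
  · congr 1
    ext ω
    refine and_congr_left fun hη => ?_
    rw [Set.mem_inter_iff, Set.mem_inter_iff, Set.mem_inter_iff, Set.mem_inter_iff,
      Set.mem_preimage, glue_eq_self hη]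
    tauto
  · intro ω ω' h
    refine and_congr (and_congr (isExterior_inducedBC F ξ ω ω' h) ?_) (hDF ω ω' h)
    rw [Set.mem_preimage, Set.mem_preimage, glue_congr η h]
  · exact fun ω h => h.1.1

lemma SingleEdge.integral_condProb {φ : Measure L.Config} (hφ : SingleEdge p q φ) (hp : 0 < p)
    (hp1 : p < 1) (hq : 1 ≤ q) {B D : Set L.Config} (hB : MeasurableSet B)
    (hD : MeasurableSet D) (hDF : IsExterior F D) :
    ∫ ω in D, condProb p q F B ω ∂φ = φ.real (D ∩ B) := by
  classical
  have := hφ.1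
  have := Fintype.ofFinite (L.BoundaryCondition F)
  have hm := fun ξ (η : F → Bool) => measurableSet_inducedBC_inter_glue ξ η hB
  have hint : ∀ (ξ : L.BoundaryCondition F) (η : F → Bool), Integrable
      (fun ω => L.finiteVolumeProb p q F ξ η *
        ({ω : L.Config | L.inducedBC F ω = ξ} ∩ glue η ⁻¹' B).indicator 1 ω)
      (φ.restrict D) := fun ξ η =>
    ((integrable_const (1 : ℝ)).indicator (hm ξ η)).const_mul _
  have htotal : φ.real (D ∩ B) = ∑ ξ : L.BoundaryCondition F,
      φ.real (D ∩ B ∩ {ω | L.inducedBC F ω = ξ}) := by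
    rw [Measure.real, measure_eq_sum_inducedBC φ F,
      ENNReal.toReal_sum fun _ _ => measure_ne_top _ _]
    rfl
  simp only [condProb_eq_sum_indicator]
  rw [integral_finsetSum _ fun ξ _ => integrable_finsetSum _ fun η _ => hint ξ η, htotal]
  refine Finset.sum_congr rfl fun ξ _ => ?_
  rw [integral_finsetSum _ fun η _ => hint ξ η, hφ.measure_inter_inducedBC hp hp1 hq hB hD hDF]
  refine Finset.sum_congr rfl fun η _ => ?_
  rw [integral_const_mul, integral_indicator_one (hm ξ η), measureReal_restrict_apply (hm ξ η)]

lemma integrable_condProb (hp : 0 < p) (hp1 : p < 1) (hq : 1 ≤ q) (μ : Measure L.Config)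
    [IsFiniteMeasure μ] (F : Finset L.Edge) {B : Set L.Config} (hB : MeasurableSet B) :
    Integrable (condProb p q F B) μ :=
  Integrable.of_bound (measurable_condProb F hB).aestronglyMeasurable 1
    (Filter.Eventually.of_forall fun ω => by
      rw [Real.norm_of_nonneg (condProb_nonneg hp hp1 hq F B ω)]
      exact condProb_le_one hp hp1 hq F B ω)

lemma SingleEdge.lintegral_condProb_mul {φ : Measure L.Config} (hφ : SingleEdge p q φ)
    (hp : 0 < p) (hp1 : p < 1) (hq : 1 ≤ q) {F : Finset L.Edge} {B : Set L.Config}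
    (hB : MeasurableSet B) {Z : L.Config → ENNReal} (hZ : Measurable Z)
    (hZF : ∀ ω ω' : L.Config, (∀ e ∉ F, ω e = ω' e) → Z ω = Z ω') :
    ∫⁻ ω, ENNReal.ofReal (condProb p q F B ω) * Z ω ∂φ = ∫⁻ ω in B, Z ω ∂φ := by
  have := hφ.1
  let r : L.Config → L.Config := glue (F := F) fun _ => false
  have hr : Measurable r := measurable_glue _
  have hZr : ∀ ω, Z ω = Z (r ω) := fun ω => hZF _ _ fun e he => (glue_of_notMem _ _ he).symm
  have hc : Measurable fun ω => ENNReal.ofReal (condProb p q F B ω) :=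
    (measurable_condProb F hB).ennreal_ofReal
  have heq : (φ.withDensity fun ω => ENNReal.ofReal (condProb p q F B ω)).map r =
      (φ.restrict B).map r := by
    ext G hG
    rw [Measure.map_apply hr hG, Measure.map_apply hr hG, withDensity_apply _ (hr hG),
      Measure.restrict_apply (hr hG),
      ← ofReal_integral_eq_lintegral_ofReal (integrable_condProb hp hp1 hq _ F hB)
        (Filter.Eventually.of_forall fun ω => condProb_nonneg hp hp1 hq F B ω),
      hφ.integral_condProb hp hp1 hq hB (hr hG), ofReal_measureReal]
    intro ω ω' h
    rw [Set.mem_preimage, Set.mem_preimage]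
    exact iff_of_eq (congrArg (· ∈ G) (glue_congr _ h))
  calc _ = ∫⁻ ω, Z ω ∂(φ.withDensity fun ω => ENNReal.ofReal (condProb p q F B ω)) :=
        (lintegral_withDensity_eq_lintegral_mul _ hc hZ).symm
    _ = ∫⁻ ω, Z (r ω) ∂(φ.withDensity fun ω => ENNReal.ofReal (condProb p q F B ω)) :=
        lintegral_congr hZr
    _ = ∫⁻ ω, Z (r ω) ∂(φ.restrict B) := by
        rw [← lintegral_map hZ hr, heq, lintegral_map hZ hr]
    _ = _ := lintegral_congr fun ω => (hZr ω).symm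

lemma SingleEdge.lintegral_condProb {φ : Measure L.Config} (hφ : SingleEdge p q φ)
    (hp : 0 < p) (hp1 : p < 1) (hq : 1 ≤ q) {B : Set L.Config} (hB : MeasurableSet B) :
    ∫⁻ ω, ENNReal.ofReal (condProb p q F B ω) ∂φ = φ B := by
  simpa using hφ.lintegral_condProb_mul hp hp1 hq hB (F := F) (Z := fun _ => 1) measurable_const
    fun _ _ _ => rfl

lemma mul_withDensity_preimage_inter_eq {α : Type*} [MeasurableSpace α] {μ : Measure α} {r : α → α}
    (hr : Measurable r) {Y : α → ENNReal} (hY : Measurable Y) (hYr : ∀ x, Y (r x) = Y x)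
    {a b : ENNReal} {A B : Set α} (hA : MeasurableSet A) (hB : MeasurableSet B)
    (h : ∀ G, MeasurableSet G → a * μ (r ⁻¹' G ∩ A) = b * μ (r ⁻¹' G ∩ B))
    {G : Set α} (hG : MeasurableSet G) :
    a * (μ.withDensity Y) (r ⁻¹' G ∩ A) = b * (μ.withDensity Y) (r ⁻¹' G ∩ B) := by
  have hmap : a • (μ.restrict A).map r = b • (μ.restrict B).map r := by
    ext G hG
    simp only [Measure.smul_apply, smul_eq_mul, Measure.map_apply hr hG,
      Measure.restrict_apply (hr hG)]
    exact h G hG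
  have hval : ∀ (a : ENNReal) (A : Set α), MeasurableSet A →
      a * (μ.withDensity Y) (r ⁻¹' G ∩ A) = ∫⁻ x in G, Y x ∂(a • (μ.restrict A).map r) := by
    intro a A hA
    rw [withDensity_apply _ ((hr hG).inter hA), Measure.restrict_smul, lintegral_smul_measure,
      setLIntegral_map hG hY hr, Measure.restrict_restrict (hr hG), smul_eq_mul]
    simp only [hYr]
  rw [hval a A hA, hval b B hB, hmap]

lemma SingleEdge.withDensity {φ : Measure L.Config} (hφ : SingleEdge p q φ)
    {Y : L.Config → ENNReal} (hY : Measurable Y) (hYe : ∀ e ω, Y (closeEdge e ω) = Y ω)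
    (hY1 : ∫⁻ ω, Y ω ∂φ = 1) : SingleEdge p q (φ.withDensity Y) := by
  refine ⟨⟨by rw [withDensity_apply _ MeasurableSet.univ, Measure.restrict_univ, hY1]⟩,
    fun e G hG => ?_⟩
  have heT := measurableSet_eq e true
  have heF := measurableSet_eq e false
  have hBr := measurableSet_bridged e
  have hsingle := hφ.2 e
  simp only [Set.inter_assoc] at hsingle ⊢
  exact ⟨mul_withDensity_preimage_inter_eq (measurable_closeEdge e) hY (hYe e) (heT.inter hBr)
      (heF.inter hBr) (fun G hG => (hsingle G hG).1) hG,
    mul_withDensity_preimage_inter_eq (measurable_closeEdge e) hY (hYe e) (heT.inter hBr.compl)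
      (heF.inter hBr.compl) (fun G hG => (hsingle G hG).2) hG⟩

end PlanarLattice

/-! ### Positive association -/

namespace PlanarLattice

open MeasureTheory Filter Topology

variable {L : PlanarLattice} {p q : ℝ}

lemma exists_exhaustion (L : PlanarLattice) : ∃ F : ℕ → Finset L.Edge, Monotone F ∧
    ∀ e, ∃ n, e ∈ F n := by
  classical
  obtain ⟨f, hf⟩ := Countable.exists_injective_nat L.Edge
  have hfin : ∀ n, (f ⁻¹' (Set.Iio n)).Finite := fun n =>
    (Set.finite_Iio n).preimage hf.injOn
  refine ⟨fun n => (hfin n).toFinset, fun m n hmn e he => ?_, fun e => ⟨f e + 1, ?_⟩⟩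
  · simp only [Set.Finite.mem_toFinset, Set.mem_preimage, Set.mem_Iio] at he ⊢
    omega
  · simp

lemma memLp_condProb (hp : 0 < p) (hp1 : p < 1) (hq : 1 ≤ q) (μ : Measure L.Config)
    [IsFiniteMeasure μ] (F : Finset L.Edge) {B : Set L.Config} (hB : MeasurableSet B) :
    MemLp (condProb p q F B) 2 μ :=
  MemLp.of_bound (measurable_condProb F hB).aestronglyMeasurable 1
    (Filter.Eventually.of_forall fun ω => by
      rw [Real.norm_of_nonneg (condProb_nonneg hp hp1 hq F B ω)]
      exact condProb_le_one hp hp1 hq F B ω)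

lemma SingleEdge.integral_condProb_mul {φ : Measure L.Config} (hφ : SingleEdge p q φ)
    (hp : 0 < p) (hp1 : p < 1) (hq : 1 ≤ q) {F F' : Finset L.Edge} (hF : F ⊆ F')
    {B : Set L.Config} (hB : MeasurableSet B) :
    ∫ ω, condProb p q F B ω * condProb p q F' B ω ∂φ = ∫ ω in B, condProb p q F' B ω ∂φ := by
  have := hφ.1
  have h := hφ.lintegral_condProb_mul hp hp1 hq hB (F := F)
    (Z := fun ω => ENNReal.ofReal (condProb p q F' B ω))
    (measurable_condProb F' hB).ennreal_ofReal
    fun ω ω' h => by rw [condProb_congr B fun e he => h e fun h' => he (hF h')]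
  rw [integral_eq_lintegral_of_nonneg_ae, integral_eq_lintegral_of_nonneg_ae, ← h]
  · congr 1
    exact lintegral_congr fun ω => ENNReal.ofReal_mul (condProb_nonneg hp hp1 hq F B ω)
  · exact Eventually.of_forall fun ω => condProb_nonneg hp hp1 hq F' B ω
  · exact (measurable_condProb F' hB).aestronglyMeasurable
  · exact Eventually.of_forall fun ω =>
      mul_nonneg (condProb_nonneg hp hp1 hq F B ω) (condProb_nonneg hp hp1 hq F' B ω)
  · exact ((measurable_condProb F hB).mul (measurable_condProb F' hB)).aestronglyMeasurable

lemma cauchySeq_of_inner {E : Type*} [NormedAddCommGroup E] [InnerProductSpace ℝ E] {y : ℕ → E}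
    (h : ∀ n m, n ≤ m → inner ℝ (y n) (y m) = ‖y m‖ ^ 2) : CauchySeq y := by
  have hdist : ∀ n m, n ≤ m → dist (y m) (y n) ^ 2 = ‖y n‖ ^ 2 - ‖y m‖ ^ 2 := by
    intro n m hnm
    rw [dist_comm, dist_eq_norm, norm_sub_sq_real, h n m hnm]
    ring
  have hanti : Antitone fun n => ‖y n‖ ^ 2 := fun n m hnm => by
    have := hdist n m hnm
    have := sq_nonneg (dist (y m) (y n))
    dsimp only
    linarith
  have hc : CauchySeq fun n => ‖y n‖ ^ 2 :=
    (tendsto_atTop_ciInf hanti ⟨0, by rintro _ ⟨n, rfl⟩; positivity⟩).cauchySeq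
  rw [Metric.cauchySeq_iff'] at hc ⊢
  intro ε hε
  obtain ⟨N, hN⟩ := hc (ε ^ 2) (by positivity)
  refine ⟨N, fun n hn => ?_⟩
  have h1 := hN n hn
  rw [dist_comm, Real.dist_eq] at h1
  refine lt_of_pow_lt_pow_left₀ 2 hε.le ?_
  rw [hdist N n hn]
  exact (le_abs_self _).trans_lt h1

lemma SingleEdge.exists_tendsto_condProb {φ : Measure L.Config} (hφ : SingleEdge p q φ)
    (hp : 0 < p) (hp1 : p < 1) (hq : 1 ≤ q) {F : ℕ → Finset L.Edge} (hF : Monotone F)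
    {B : Set L.Config} (hB : MeasurableSet B) :
    ∃ (ns : ℕ → ℕ) (g : L.Config → ℝ), StrictMono ns ∧
      ∀ᵐ ω ∂φ, Tendsto (fun k => condProb p q (F (ns k)) B ω) atTop (𝓝 (g ω)) := by
  have := hφ.1
  let y : ℕ → Lp ℝ 2 φ := fun n => (memLp_condProb hp hp1 hq φ (F n) hB).toLp _
  have hy : ∀ n, y n =ᵐ[φ] condProb p q (F n) B := fun n => MemLp.coeFn_toLp _
  have hinner : ∀ n m, inner ℝ (y n) (y m) =
      ∫ ω, condProb p q (F n) B ω * condProb p q (F m) B ω ∂φ := by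
    intro n m
    rw [L2.inner_def]
    refine integral_congr_ae ?_
    filter_upwards [hy n, hy m] with ω h1 h2
    rw [h1, h2]
    exact mul_comm _ _
  have hcauchy : CauchySeq y := cauchySeq_of_inner fun n m hnm => by
    rw [← real_inner_self_eq_norm_sq, hinner, hinner,
      hφ.integral_condProb_mul hp hp1 hq (hF hnm) hB,
      hφ.integral_condProb_mul hp hp1 hq (Finset.Subset.refl _) hB]
  obtain ⟨g, hg⟩ := cauchySeq_tendsto_of_complete hcauchy
  obtain ⟨ns, hns, hae⟩ := (tendstoInMeasure_of_tendsto_Lp hg).exists_seq_tendsto_ae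
  refine ⟨ns, g, hns, ?_⟩
  filter_upwards [hae, ae_all_iff.2 hy] with ω h1 h2
  simpa only [h2] using h1

/-- The limit can be taken to depend on no single edge, not merely almost surely, by using the
`limsup`. -/
lemma SingleEdge.exists_tail_limit {φ : Measure L.Config} (hφ : SingleEdge p q φ)
    (hp : 0 < p) (hp1 : p < 1) (hq : 1 ≤ q) {B : Set L.Config} (hB : MeasurableSet B) :
    ∃ (F : ℕ → Finset L.Edge) (Y : L.Config → ENNReal), Measurable Y ∧
      (∀ e ω, Y (closeEdge e ω) = Y ω) ∧
      ∀ᵐ ω ∂φ, Tendsto (fun k => ENNReal.ofReal (condProb p q (F k) B ω)) atTop (𝓝 (Y ω)) := by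
  obtain ⟨F, hF, hF'⟩ := exists_exhaustion L
  obtain ⟨ns, g, hns, hlim⟩ := hφ.exists_tendsto_condProb hp hp1 hq hF hB
  refine ⟨fun k => F (ns k), fun ω => limsup (fun k =>
    ENNReal.ofReal (condProb p q (F (ns k)) B ω)) atTop, ?_, ?_, ?_⟩
  · exact Measurable.limsup fun k => (measurable_condProb _ hB).ennreal_ofReal
  · intro e ω
    obtain ⟨n, hn⟩ := hF' e
    refine limsup_congr ?_
    filter_upwards [eventually_ge_atTop n] with k hk
    have he : e ∈ F (ns k) := hF (hk.trans (hns.id_le k)) hn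
    rw [condProb_congr B fun e' he' => closeEdge_of_ne (fun h => he' (h ▸ he)) ω]
  · filter_upwards [hlim] with ω hω
    have hω' := (ENNReal.continuous_ofReal.tendsto _).comp hω
    exact hω'.limsup_eq ▸ hω'

lemma tendsto_setLIntegral_condProb (hp : 0 < p) (hp1 : p < 1) (hq : 1 ≤ q)
    {φ : Measure L.Config} [IsFiniteMeasure φ] {F : ℕ → Finset L.Edge} {B : Set L.Config}
    (hB : MeasurableSet B) {Y : L.Config → ENNReal}
    (hlim : ∀ᵐ ω ∂φ, Tendsto (fun k => ENNReal.ofReal (condProb p q (F k) B ω)) atTop (𝓝 (Y ω)))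
    (D : Set L.Config) :
    Tendsto (fun k => ∫⁻ ω in D, ENNReal.ofReal (condProb p q (F k) B ω) ∂φ) atTop
      (𝓝 (∫⁻ ω in D, Y ω ∂φ)) :=
  tendsto_lintegral_of_dominated_convergence (fun _ => 1)
    (fun _ => (measurable_condProb _ hB).ennreal_ofReal)
    (fun _ => Eventually.of_forall fun ω =>
      ENNReal.ofReal_le_one.2 (condProb_le_one hp hp1 hq _ _ ω))
    (by simp) (ae_restrict_of_ae hlim)

/-- Conditioning on the tail limit of `condProb p q F B` amounts to a change of density by a tail
function, so by uniqueness it leaves `φ` unchanged: the limit is uncorrelated with every event `A`.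
The finite-volume FKG inequality then passes to the limit. -/
theorem SingleEdge.mul_le_measure_inter {φ : Measure L.Config} (hφ : SingleEdge p q φ)
    (huniq : ∀ ψ : Measure L.Config, SingleEdge p q ψ → ψ = φ)
    (hp : 0 < p) (hp1 : p < 1) (hq : 1 ≤ q) {A B : Set L.Config} (hA : MeasurableSet A)
    (hB : MeasurableSet B) (hA' : IsUpperSet A) (hB' : IsUpperSet B) :
    φ A * φ B ≤ φ (A ∩ B) := by
  have := hφ.1
  by_cases h0 : φ B = 0
  · simp [h0]
  obtain ⟨F, Y, hY, hYe, hlim⟩ := hφ.exists_tail_limit hp hp1 hq hB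
  have hlim' := tendsto_setLIntegral_condProb hp hp1 hq hB hlim
  have hYint : ∫⁻ ω, Y ω ∂φ = φ B := by
    have h1 := hlim' Set.univ
    simp only [Measure.restrict_univ, hφ.lintegral_condProb hp hp1 hq hB] at h1
    exact tendsto_nhds_unique h1 tendsto_const_nhds
  have hψ := huniq _ (hφ.withDensity (Y := fun ω => (φ B)⁻¹ * Y ω) (hY.const_mul _)
    (fun e ω => by rw [hYe]) (by
      rw [lintegral_const_mul _ hY, hYint, ENNReal.inv_mul_cancel h0 (measure_ne_top _ _)]))
  have hYA : ∫⁻ ω in A, Y ω ∂φ = φ A * φ B := by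
    have h1 := congrArg (fun μ : Measure L.Config => μ A) hψ
    simp only [withDensity_apply _ hA, lintegral_const_mul _ hY] at h1
    rw [← h1, mul_comm, ← mul_assoc, ENNReal.mul_inv_cancel h0 (measure_ne_top _ _), one_mul]
  rw [← hYA]
  refine le_of_tendsto' (hlim' A) fun k => ?_
  rw [← hφ.lintegral_condProb_mul hp hp1 hq hA (F := F k)
    (measurable_condProb _ hB).ennreal_ofReal
    fun ω ω' h => by rw [condProb_congr B h],
    ← hφ.lintegral_condProb hp hp1 hq (F := F k) (hA.inter hB)]
  refine lintegral_mono fun ω => ?_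
  rw [← ENNReal.ofReal_mul (condProb_nonneg hp hp1 hq _ _ _)]
  exact ENNReal.ofReal_le_ofReal (condProb_mul_le hp hp1 hq _ hA' hB' ω)

end PlanarLattice

/-! ### Symmetries -/

namespace PlanarLattice

open MeasureTheory

variable {L : PlanarLattice} {p q : ℝ}

variable (L) in
/-- The affine symmetries of the graph. -/
def symmetryGroup : Subgroup (Plane ≃ᵃ[ℝ] Plane) where
  carrier := {τ | ∀ x y, L.graph.Adj (τ x) (τ y) ↔ L.graph.Adj x y}
  mul_mem' := fun {a b} ha hb x y => (ha (b x) (b y)).trans (hb x y)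
  one_mem' := fun x y => Iff.rfl
  inv_mem' := fun {a} ha x y => by
    rw [← ha]
    change L.graph.Adj (a (a.symm x)) (a (a.symm y)) ↔ _
    rw [a.apply_symm_apply, a.apply_symm_apply]

/-- The translation by an integer vector. -/
noncomputable def shift (a b : ℤ) : Plane ≃ᵃ[ℝ] Plane :=
  AffineEquiv.constVAdd ℝ Plane ((a : ℝ), (b : ℝ))

@[simp] lemma shift_apply (a b : ℤ) (z : Plane) : shift a b z = (z.1 + a, z.2 + b) := by
  simp [shift, add_comm, Prod.ext_iff]

/-- The reflection in the vertical axis. -/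
noncomputable def mirror : Plane ≃ᵃ[ℝ] Plane :=
  ((LinearEquiv.neg ℝ (M := ℝ)).prodCongr (LinearEquiv.refl ℝ ℝ)).toAffineEquiv

@[simp] lemma mirror_apply (z : Plane) : mirror z = (-z.1, z.2) := rfl

/-- The reflection in the diagonal. -/
noncomputable def diagonal : Plane ≃ᵃ[ℝ] Plane := (LinearEquiv.prodComm ℝ ℝ ℝ).toAffineEquiv

lemma shift_mem_symmetryGroup (a b : ℤ) : shift a b ∈ L.symmetryGroup := by
  have hr : shift 1 0 ∈ L.symmetryGroup := fun x y => by
    simpa using L.translation_right.2 x y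
  have hu : shift 0 1 ∈ L.symmetryGroup := fun x y => by
    simpa using L.translation_up.2 x y
  have zpow_eq : ∀ (v : Plane) (n : ℤ), (AffineEquiv.constVAdd ℝ Plane v) ^ n =
      AffineEquiv.constVAdd ℝ Plane (n • v) := fun v n =>
    (AffineEquiv.constVAdd_zsmul ℝ Plane n v).symm
  have : shift a b = shift 1 0 ^ a * shift 0 1 ^ b := by
    unfold shift
    rw [zpow_eq, zpow_eq]
    ext z <;> simp [AffineEquiv.mul_def]
  rw [this]
  exact mul_mem (zpow_mem hr _) (zpow_mem hu _)

lemma mirror_mem_symmetryGroup : mirror ∈ L.symmetryGroup := fun x y => L.reflection.2 x y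

lemma diagonal_mem_symmetryGroup : diagonal ∈ L.symmetryGroup := fun x y => by
  have h1 := L.reflection.2 (-x.2, x.1) (-y.2, y.1)
  have h2 := L.rotation.2 x y
  simp only [neg_neg] at h1 h2
  exact h1.trans h2

/-- The symmetries as automorphisms of the graph. -/
def symmetryIso {τ : Plane ≃ᵃ[ℝ] Plane} (hτ : τ ∈ L.symmetryGroup) : L.graph ≃g L.graph :=
  ⟨τ.toEquiv, fun {x y} => hτ x y⟩

/-- The action of the symmetries on configurations. -/
def pull {τ : Plane ≃ᵃ[ℝ] Plane} (hτ : τ ∈ L.symmetryGroup) (ω : L.Config) : L.Config :=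
  fun e => ω ((symmetryIso hτ).mapEdgeSet e)

lemma measurable_pull {τ : Plane ≃ᵃ[ℝ] Plane} (hτ : τ ∈ L.symmetryGroup) :
    Measurable (pull hτ) :=
  measurable_pi_iff.2 fun _ => measurable_pi_apply _

lemma openSet_pull {τ : Plane ≃ᵃ[ℝ] Plane} (hτ : τ ∈ L.symmetryGroup) (ω : L.Config) :
    L.openSet (pull hτ ω) = τ ⁻¹' L.openSet ω := by
  have hseg : ∀ x y z, τ z ∈ segment ℝ (τ x) (τ y) ↔ z ∈ segment ℝ x y := fun x y z => by
    have := image_segment ℝ τ.toAffineMap x y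
    change _ = segment ℝ (τ x) (τ y) at this
    rw [← this]
    exact τ.injective.mem_set_image
  ext z
  constructor
  · rintro ⟨x, y, h, h1, h2⟩
    exact ⟨τ x, τ y, (hτ x y).2 h, h1, (hseg x y z).2 h2⟩
  · rintro ⟨x, y, h, h1, h2⟩
    obtain ⟨x, rfl⟩ := τ.surjective x
    obtain ⟨y, rfl⟩ := τ.surjective y
    exact ⟨x, y, (hτ x y).1 h, h1, (hseg x y z).1 h2⟩

lemma closeEdge_pull {τ : Plane ≃ᵃ[ℝ] Plane} (hτ : τ ∈ L.symmetryGroup) (e : L.Edge)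
    (ω : L.Config) :
    closeEdge e (pull hτ ω) = pull hτ (closeEdge ((symmetryIso hτ).mapEdgeSet e) ω) := by
  funext e'
  by_cases h : e' = e
  · subst h
    rw [closeEdge_self, pull, closeEdge_self]
  · rw [closeEdge_of_ne h, pull, pull, closeEdge_of_ne]
    exact fun h' => h ((symmetryIso hτ).mapEdgeSet.injective h')

lemma pull_mem_bridged {τ : Plane ≃ᵃ[ℝ] Plane} (hτ : τ ∈ L.symmetryGroup) (e : L.Edge)
    (ω : L.Config) :
    pull hτ ω ∈ Bridged e ↔ ω ∈ Bridged ((symmetryIso hτ).mapEdgeSet e) := by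
  let σ : L.openGraph {e} (pull hτ ω) ≃g
      L.openGraph {(symmetryIso hτ).mapEdgeSet e} ω := ⟨τ.toEquiv, fun {x y} => by
    rw [openGraph_adj, openGraph_adj]
    constructor
    · rintro ⟨h, h1, h2⟩
      refine ⟨(hτ x y).1 h, fun hc => h1 ?_, h2⟩
      rw [Set.mem_singleton_iff] at hc ⊢
      rw [← hc]; rfl
    · rintro ⟨h, h1, h2⟩
      refine ⟨(hτ x y).2 h, fun hc => h1 ?_, h2⟩
      rw [Set.mem_singleton_iff] at hc ⊢
      exact (symmetryIso hτ).mapEdgeSet.injective hc⟩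
  obtain ⟨⟨x, y⟩, hxy⟩ := Quot.exists_rep (e : Sym2 Plane)
  have he' : (((symmetryIso hτ).mapEdgeSet e : L.Edge) : Sym2 Plane) = s(τ x, τ y) := by
    change Sym2.map τ (e : Sym2 Plane) = _
    rw [← hxy]; rfl
  rw [mem_bridged_iff hxy.symm, mem_bridged_iff he']
  exact σ.reachable_iff.symm

lemma SingleEdge.map_pull {φ : Measure L.Config} (hφ : SingleEdge p q φ)
    {τ : Plane ≃ᵃ[ℝ] Plane} (hτ : τ ∈ L.symmetryGroup) : SingleEdge p q (φ.map (pull hτ)) := by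
  have := hφ.1
  have hm := measurable_pull hτ (L := L)
  refine ⟨Measure.isProbabilityMeasure_map hm.aemeasurable, fun e G hG => ?_⟩
  have map_apply : ∀ (b : Bool) (S S' : Set L.Config), MeasurableSet S → pull hτ ⁻¹' S = S' →
      φ.map (pull hτ) (closeEdge e ⁻¹' G ∩ {ω | ω e = b} ∩ S) =
        φ (closeEdge ((symmetryIso hτ).mapEdgeSet e) ⁻¹' (pull hτ ⁻¹' G) ∩
          {ω | ω ((symmetryIso hτ).mapEdgeSet e) = b} ∩ S') := by
    rintro b S _ hS rfl
    rw [Measure.map_apply hm (((measurable_closeEdge e hG).inter (measurableSet_eq e b)).inter hS)]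
    congr 1
    ext ω
    simp only [Set.mem_preimage, Set.mem_inter_iff, closeEdge_pull]
    rfl
  have hb : pull hτ ⁻¹' Bridged e = Bridged ((symmetryIso hτ).mapEdgeSet e) := by
    ext ω; exact pull_mem_bridged hτ e ω
  have hb' : pull hτ ⁻¹' (Bridged e)ᶜ = (Bridged ((symmetryIso hτ).mapEdgeSet e))ᶜ := by
    rw [Set.preimage_compl, hb]
  rw [map_apply _ _ _ (measurableSet_bridged e) hb, map_apply _ _ _ (measurableSet_bridged e) hb,
    map_apply _ _ _ (measurableSet_bridged e).compl hb',
    map_apply _ _ _ (measurableSet_bridged e).compl hb']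
  exact hφ.2 _ _ (hm hG)

/-! ### Local finiteness and measurability -/

lemma exists_edge_length_bound (L : PlanarLattice) :
    ∃ R : ℝ, ∀ x y, L.graph.Adj x y → dist x y ≤ R := by
  have hfin : (L.V ∩ (Set.Icc 0 1 ×ˢ Set.Icc 0 1 : Set Plane)).Finite :=
    L.finite_of_bounded _ ((Metric.isBounded_Icc _ _).prod (Metric.isBounded_Icc _ _))
  have hfin' : (⋃ x ∈ L.V ∩ (Set.Icc 0 1 ×ˢ Set.Icc 0 1 : Set Plane),
      (fun y => dist x y) '' L.graph.neighborSet x).Finite :=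
    hfin.biUnion fun x _ => (L.finite_neighbors x).image _
  obtain ⟨R, hR⟩ := hfin'.bddAbove
  refine ⟨R, fun x y hxy => ?_⟩
  have hs := shift_mem_symmetryGroup (L := L) (-⌊x.1⌋) (-⌊x.2⌋)
  have hadj := (hs x y).2 hxy
  have h1 : dist (shift (-⌊x.1⌋) (-⌊x.2⌋) x) (shift (-⌊x.1⌋) (-⌊x.2⌋) y) = dist x y := by
    simp [Prod.dist_eq]
  rw [← h1]
  refine hR (Set.mem_biUnion (x := shift (-⌊x.1⌋) (-⌊x.2⌋) x) ⟨L.mem_of_adj _ _ hadj, ?_⟩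
    ⟨_, hadj, rfl⟩)
  simp only [shift_apply, Int.cast_neg, Set.mem_prod, Set.mem_Icc]
  have := Int.floor_le x.1
  have := Int.lt_floor_add_one x.1
  have := Int.floor_le x.2
  have := Int.lt_floor_add_one x.2
  refine ⟨⟨?_, ?_⟩, ⟨?_, ?_⟩⟩ <;> linarith

lemma finite_edges_of_bounded (L : PlanarLattice) {K : Set Plane} (hK : Bornology.IsBounded K) :
    {e : L.Edge | ∃ x y, (e : Sym2 Plane) = s(x, y) ∧ (segment ℝ x y ∩ K).Nonempty}.Finite := by
  obtain ⟨R, hR⟩ := L.exists_edge_length_bound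
  obtain ⟨r, hr⟩ := hK.subset_closedBall 0
  have hfin : (⋃ x ∈ L.V ∩ Metric.closedBall (0 : Plane) (r + R),
      (fun y => s(x, y)) '' L.graph.neighborSet x).Finite :=
    (L.finite_of_bounded _ Metric.isBounded_closedBall).biUnion
      fun x _ => (L.finite_neighbors x).image _
  refine (hfin.preimage (f := (Subtype.val : L.Edge → Sym2 Plane))
    Subtype.val_injective.injOn).subset ?_
  rintro ⟨e, he⟩ ⟨x, y, rfl, z, hz, hzK⟩
  refine Set.mem_biUnion (x := x) ⟨L.mem_of_adj _ _ he, ?_⟩ ⟨y, he, rfl⟩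
  have h1 : dist x z ≤ dist x y := by
    have := dist_add_dist_of_mem_segment hz
    have := dist_nonneg (x := z) (y := y)
    linarith
  have h2 := hr hzK
  rw [Metric.mem_closedBall] at h2 ⊢
  have := hR x y he
  linarith [dist_triangle x z 0]

/-- Increasing properties of a subset of the plane that have bounded witnesses. -/
structure IsFinitary (P : Set Plane → Prop) : Prop where
  mono : ∀ A B, A ⊆ B → P A → P B
  bounded : ∀ A, P A → ∃ K ⊆ A, Bornology.IsBounded K ∧ P K

lemma openSet_mono {ω ω' : L.Config} (h : ω ≤ ω') : L.openSet ω ⊆ L.openSet ω' := by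
  rintro z ⟨x, y, hxy, h1, h2⟩
  refine ⟨x, y, hxy, ?_, h2⟩
  have := h ⟨s(x, y), hxy⟩
  rw [h1] at this
  exact top_le_iff.1 this

lemma IsFinitary.isUpperSet {P : Set Plane → Prop} (hP : IsFinitary P) :
    IsUpperSet {ω : L.Config | P (L.openSet ω)} :=
  fun _ _ h hω => hP.mono _ _ (openSet_mono h) hω

lemma IsFinitary.measurableSet {P : Set Plane → Prop} (hP : IsFinitary P) :
    MeasurableSet {ω : L.Config | P (L.openSet ω)} := by
  classical
  have : {ω : L.Config | P (L.openSet ω)} = ⋃ T : {T : Finset L.Edge //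
      P (L.openSet fun e => decide (e ∈ T))}, ⋂ e ∈ T.1, {ω | ω e = true} := by
    ext ω
    simp only [Set.mem_iUnion, Set.mem_iInter, Set.mem_ofPred_eq]
    constructor
    · intro h
      obtain ⟨K, hK, hb, hPK⟩ := hP.bounded _ h
      have hfin := L.finite_edges_of_bounded hb
      refine ⟨⟨hfin.toFinset.filter fun e => ω e = true, ?_⟩, fun e he => ?_⟩
      · refine hP.mono _ _ (fun z hz => ?_) hPK
        obtain ⟨x, y, hxy, h1, h2⟩ := hK hz
        refine ⟨x, y, hxy, ?_, h2⟩
        simp only [decide_eq_true_eq, Finset.mem_filter, Set.Finite.mem_toFinset]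
        exact ⟨⟨x, y, rfl, z, h2, hz⟩, h1⟩
      · exact (Finset.mem_filter.1 he).2
    · rintro ⟨⟨T, hT⟩, h⟩
      refine hP.mono _ _ (openSet_mono fun e => ?_) hT
      by_cases he : e ∈ T
      · rw [h e he]; exact le_top
      · simp [he]
  rw [this]
  exact MeasurableSet.iUnion fun T => Finset.measurableSet_biInter _ fun e _ =>
    measurableSet_eq e true

lemma IsFinitary.joinedIn (R : Set Plane) (x y : Plane) :
    IsFinitary fun A => JoinedIn (A ∩ R) x y where
  mono A B h hA := hA.mono (Set.inter_subset_inter_left _ h)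
  bounded A hA := by
    obtain ⟨γ, hγ⟩ := hA
    refine ⟨Set.range γ, ?_, (isCompact_range γ.continuous).isBounded, γ, fun t => ?_⟩
    · rintro _ ⟨t, rfl⟩; exact (hγ t).1
    · exact ⟨⟨t, rfl⟩, (hγ t).2⟩

lemma IsFinitary.exists {ι : Sort*} {P : ι → Set Plane → Prop} (h : ∀ i, IsFinitary (P i)) :
    IsFinitary fun A => ∃ i, P i A where
  mono A B hAB := fun ⟨i, hi⟩ => ⟨i, (h i).mono A B hAB hi⟩
  bounded A := fun ⟨i, hi⟩ => by
    obtain ⟨K, h1, h2, h3⟩ := (h i).bounded A hi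
    exact ⟨K, h1, h2, i, h3⟩

lemma IsFinitary.and {P Q : Set Plane → Prop} (hP : IsFinitary P) (hQ : IsFinitary Q) :
    IsFinitary fun A => P A ∧ Q A where
  mono A B h := And.imp (hP.mono A B h) (hQ.mono A B h)
  bounded A := fun ⟨h1, h2⟩ => by
    obtain ⟨K, k1, k2, k3⟩ := hP.bounded A h1
    obtain ⟨K', k1', k2', k3'⟩ := hQ.bounded A h2
    exact ⟨K ∪ K', Set.union_subset k1 k1', k2.union k2', hP.mono _ _ Set.subset_union_left k3,
      hQ.mono _ _ Set.subset_union_right k3'⟩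

lemma IsFinitary.const (r : Prop) : IsFinitary fun _ => r where
  mono _ _ _ h := h
  bounded _ h := ⟨∅, Set.empty_subset _, Bornology.isBounded_empty, h⟩

lemma IsFinitary.comap {P : Set Plane → Prop} (hP : IsFinitary P) {f : Plane → Plane}
    (hf : Continuous f) : IsFinitary fun A => P (f ⁻¹' A) where
  mono A B h := hP.mono _ _ (Set.preimage_mono h)
  bounded A h := by
    obtain ⟨K, k1, k2, k3⟩ := hP.bounded _ h
    refine ⟨f '' K, Set.image_subset_iff.2 k1, ?_, hP.mono _ _ (Set.subset_preimage_image f K) k3⟩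
    exact ((k2.isCompact_closure.image hf).isBounded).subset (Set.image_mono subset_closure)

/-! ### Properties of the open set under the infinite-volume measure -/

/-- The unique infinite-volume measure, through the relation for single edges. -/
structure IsUniqueSingleEdge (p q : ℝ) (φ : Measure L.Config) : Prop where
  pos : 0 < p
  lt_one : p < 1
  one_le : 1 ≤ q
  singleEdge : SingleEdge p q φ
  unique : ∀ ψ : Measure L.Config, SingleEdge p q ψ → ψ = φ

lemma IsUniqueSingleEdge.map_pull {φ : Measure L.Config} (hφ : IsUniqueSingleEdge p q φ)
    {τ : Plane ≃ᵃ[ℝ] Plane} (hτ : τ ∈ L.symmetryGroup) : φ.map (pull hτ) = φ :=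
  hφ.unique _ (hφ.singleEdge.map_pull hτ)

/-- The probability that the set of open points has the property `P`. -/
noncomputable def prob (φ : Measure L.Config) (P : Set Plane → Prop) : ℝ :=
  φ.real {ω | P (L.openSet ω)}

lemma IsUniqueSingleEdge.prob_preimage_le {φ : Measure L.Config} (hφ : IsUniqueSingleEdge p q φ)
    {τ : Plane ≃ᵃ[ℝ] Plane} (hτ : τ ∈ L.symmetryGroup) (P : Set Plane → Prop) :
    prob φ (fun A => P (τ ⁻¹' A)) ≤ prob φ P := by
  have := hφ.singleEdge.1
  refine ENNReal.toReal_mono (measure_ne_top _ _) ?_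
  have := Measure.le_map_apply (μ := φ) (measurable_pull hτ).aemeasurable
    {ω | P (L.openSet ω)}
  rw [hφ.map_pull hτ] at this
  simpa only [Set.preimage_ofPred_eq, openSet_pull] using this

lemma IsUniqueSingleEdge.prob_preimage {φ : Measure L.Config} (hφ : IsUniqueSingleEdge p q φ)
    {τ : Plane ≃ᵃ[ℝ] Plane} (hτ : τ ∈ L.symmetryGroup) (P : Set Plane → Prop) :
    prob φ (fun A => P (τ ⁻¹' A)) = prob φ P := by
  refine le_antisymm (hφ.prob_preimage_le hτ P) ?_
  have h := hφ.prob_preimage_le (inv_mem hτ) fun A => P (τ ⁻¹' A)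
  have h1 : ∀ A : Set Plane, τ ⁻¹' ((τ⁻¹ : Plane ≃ᵃ[ℝ] Plane) ⁻¹' A) = A := fun A => by
    ext z
    change τ.symm (τ z) ∈ A ↔ _
    rw [τ.symm_apply_apply]
  simpa only [h1] using h

lemma IsUniqueSingleEdge.prob_mul_le {φ : Measure L.Config} (hφ : IsUniqueSingleEdge p q φ)
    {P Q : Set Plane → Prop} (hP : IsFinitary P) (hQ : IsFinitary Q) :
    prob φ P * prob φ Q ≤ prob φ fun A => P A ∧ Q A := by
  have := hφ.singleEdge.1
  have h := hφ.singleEdge.mul_le_measure_inter hφ.unique hφ.pos hφ.lt_one hφ.one_le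
    hP.measurableSet hQ.measurableSet hP.isUpperSet hQ.isUpperSet
  have h' := ENNReal.toReal_mono (measure_ne_top _ _) h
  rwa [ENNReal.toReal_mul] at h'

end PlanarLattice

/-! ### Crossings of strips under the symmetries of the lattice -/

section Symmetry

open Set PlanarLattice

variable {A : Set Plane} {x y h b : ℝ}

lemma joinedIn_iff_map (τ : Plane ≃ᵃ[ℝ] Plane) {S T : Set Plane} (hST : ∀ v, v ∈ S ↔ τ v ∈ T)
    (p q : Plane) : JoinedIn S p q ↔ JoinedIn T (τ p) (τ q) := by
  refine ⟨fun hpq => joinedIn_of_mapsTo hpq τ.continuous_of_finiteDimensional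
    fun v => (hST v).1, fun hpq => ?_⟩
  simpa only [τ.symm_apply_apply] using joinedIn_of_mapsTo hpq
    τ.symm.continuous_of_finiteDimensional
    fun v hv => (hST _).2 (by rwa [τ.apply_symm_apply])

lemma stripEnds_shift_iff (a c : ℤ) (p q : Plane) :
    StripEnds x y h p q ↔ StripEnds (x + a) (y + c) h (shift a c p) (shift a c q) := by
  constructor <;> rintro ⟨left, right, bottom, top⟩ <;> constructor <;>
    simp only [shift_apply] at * <;> linarith

lemma driftRight_shift (a c : ℤ) :
    DriftRight (shift a c ⁻¹' A) x y h ↔ DriftRight A (x + a) (y + c) h := by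
  refine .symm <| (shift a c).surjective.exists₂.trans <| .symm <| exists₂_congr fun p q =>
    and_congr (stripEnds_shift_iff a c p q) <| and_congr ?_ <|
      joinedIn_iff_map _ (fun v => ?_) p q <;>
    (simp only [slab, mem_inter_iff, mem_preimage, mem_ofPred_eq, shift_apply]; grind)

lemma longCrossing_shift (a c : ℤ) :
    LongCrossing (shift a c ⁻¹' A) x y h ↔ LongCrossing A (x + a) (y + c) h := by
  refine .symm <| (shift a c).surjective.exists₂.trans <| .symm <| exists₂_congr fun p q =>
    and_congr ?_ <| and_congr ?_ <| joinedIn_iff_map _ (fun v => ?_) p q <;>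
    (simp only [slab, mem_inter_iff, mem_preimage, mem_ofPred_eq, shift_apply]; grind)

lemma staysLeft_shift (a c : ℤ) :
    StaysLeft (shift a c ⁻¹' A) x y h b ↔ StaysLeft A (x + a) (y + c) h b := by
  refine .symm <| (shift a c).surjective.exists₂.trans <| .symm <| exists₂_congr fun p q =>
    and_congr (stripEnds_shift_iff a c p q) <| joinedIn_iff_map _ (fun v => ?_) p q
  simp only [slab, mem_inter_iff, mem_preimage, mem_ofPred_eq, shift_apply]
  grind

lemma leftThenRight_shift (a c : ℤ) :
    LeftThenRight (shift a c ⁻¹' A) x y h b ↔ LeftThenRight A (x + a) (y + c) h b := by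
  refine .symm <| (shift a c).surjective.exists₃.trans <| .symm <| exists₃_congr fun p w q =>
    and_congr (stripEnds_shift_iff a c p q) <|
      and_congr (joinedIn_iff_map _ (fun v => ?_) p w) <|
        joinedIn_iff_map _ (fun v => ?_) w q <;>
    (simp only [slab, mem_inter_iff, mem_preimage, mem_ofPred_eq, shift_apply]; grind)

lemma stripEnds_mirror_iff (p q : Plane) :
    StripEnds (-x - 1) y h p q ↔ StripEnds x y h (mirror p) (mirror q) := by
  constructor <;> rintro ⟨left, right, bottom, top⟩ <;> constructor <;>
    simp only [mirror_apply] at * <;> linarith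

lemma driftRight_mirror :
    DriftRight (mirror ⁻¹' A) (-x - 1) y h ↔ DriftLeft A x y h := by
  refine .symm <| mirror.surjective.exists₂.trans <| .symm <| exists₂_congr fun p q =>
    and_congr (stripEnds_mirror_iff p q) <| and_congr ?_ <|
      joinedIn_iff_map _ (fun v => ?_) p q
  · rw [mirror_apply]
    grind
  · simp only [slab, mem_inter_iff, mem_preimage, mem_ofPred_eq, mirror_apply]

lemma staysLeft_mirror :
    StaysLeft (mirror ⁻¹' A) (-x - 1) y h b ↔ StaysRight A x y h b := by
  refine .symm <| mirror.surjective.exists₂.trans <| .symm <| exists₂_congr fun p q =>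
    and_congr (stripEnds_mirror_iff p q) <| joinedIn_iff_map _ (fun v => ?_) p q
  simp only [slab, mem_inter_iff, mem_preimage, mem_ofPred_eq, mirror_apply]
  grind

lemma leftThenRight_mirror :
    LeftThenRight (mirror ⁻¹' A) (-x - 1) y h b ↔ RightThenLeft A x y h b := by
  refine .symm <| mirror.surjective.exists₃.trans <| .symm <| exists₃_congr fun p w q =>
    and_congr (stripEnds_mirror_iff p q) <|
      and_congr (joinedIn_iff_map _ (fun v => ?_) p w) <|
        joinedIn_iff_map _ (fun v => ?_) w q <;>
    (simp only [slab, mem_inter_iff, mem_preimage, mem_ofPred_eq, mirror_apply]; grind)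

end Symmetry

/-! ### Probabilities of exceptional crossings -/

section ExceptionalProbability

open Set PlanarLattice

lemma isFinitary_joinedIn_slab (y h : ℝ) (p q : Plane) :
    IsFinitary fun A => JoinedIn (slab A y h) p q := IsFinitary.joinedIn _ p q

lemma isFinitary_joinedIn_slab_inter (y h : ℝ) (R : Set Plane) (p q : Plane) :
    IsFinitary fun A => JoinedIn (slab A y h ∩ R) p q := by
  simp only [slab, inter_assoc]
  exact IsFinitary.joinedIn _ p q

lemma isFinitary_driftRight (x y h : ℝ) : IsFinitary fun A => DriftRight A x y h :=
  .exists fun _ => .exists fun _ => .and (.const _) <| .and (.const _) <|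
    isFinitary_joinedIn_slab _ _ _ _

lemma isFinitary_driftLeft (x y h : ℝ) : IsFinitary fun A => DriftLeft A x y h :=
  .exists fun _ => .exists fun _ => .and (.const _) <| .and (.const _) <|
    isFinitary_joinedIn_slab _ _ _ _

lemma isFinitary_longCrossing (x y h : ℝ) : IsFinitary fun A => LongCrossing A x y h :=
  .exists fun _ => .exists fun _ => .and (.const _) <| .and (.const _) <|
    isFinitary_joinedIn_slab_inter _ _ _ _ _

lemma isFinitary_staysLeft (x y h b : ℝ) : IsFinitary fun A => StaysLeft A x y h b :=
  .exists fun _ => .exists fun _ => .and (.const _) <| isFinitary_joinedIn_slab_inter _ _ _ _ _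

lemma isFinitary_staysRight (x y h b : ℝ) : IsFinitary fun A => StaysRight A x y h b :=
  .exists fun _ => .exists fun _ => .and (.const _) <| isFinitary_joinedIn_slab_inter _ _ _ _ _

lemma isFinitary_leftThenRight (x y h b : ℝ) : IsFinitary fun A => LeftThenRight A x y h b :=
  .exists fun _ => .exists fun _ => .exists fun _ => .and (.const _) <|
    .and (isFinitary_joinedIn_slab_inter _ _ _ _ _) (isFinitary_joinedIn_slab_inter _ _ _ _ _)

lemma isFinitary_rightThenLeft (x y h b : ℝ) : IsFinitary fun A => RightThenLeft A x y h b :=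
  .exists fun _ => .exists fun _ => .exists fun _ => .and (.const _) <|
    .and (isFinitary_joinedIn_slab_inter _ _ _ _ _) (isFinitary_joinedIn_slab_inter _ _ _ _ _)

/-- The strip `[0, N]` contains a curve from the left of `0` to the right of `2 * N + 2`. -/
def HasLongCurve (N : ℕ) (A : Set Plane) : Prop :=
  ∃ p q : Plane, p.1 ≤ 0 ∧ 2 * N + 2 ≤ q.1 ∧ JoinedIn (slab A 0 N) p q

/-- The probabilities of the properties of a random subset of the plane whose law is positively
associated and has the symmetries of the square lattice. -/
structure IsLatticeProb (pr : (Set Plane → Prop) → ℝ) : Prop where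
  nonneg : ∀ P, 0 ≤ pr P
  true_eq : pr (fun _ => True) = 1
  false_eq : pr (fun _ => False) = 0
  mono : ∀ P Q : Set Plane → Prop, (∀ A, P A → Q A) → pr P ≤ pr Q
  or_le : ∀ P Q, pr (fun A => P A ∨ Q A) ≤ pr P + pr Q
  mul_le : ∀ P Q, IsFinitary P → IsFinitary Q → pr P * pr Q ≤ pr fun A => P A ∧ Q A
  shift : ∀ (a c : ℤ) (P : Set Plane → Prop), pr (fun A => P (shift a c ⁻¹' A)) = pr P
  mirror : ∀ P : Set Plane → Prop, pr (fun A => P (mirror ⁻¹' A)) = pr P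
  swap : ∀ P : Set Plane → Prop, pr (fun A => P (Prod.swap ⁻¹' A)) = pr P

namespace IsLatticeProb

variable {pr : (Set Plane → Prop) → ℝ}

lemma le_one (hpr : IsLatticeProb pr) (P : Set Plane → Prop) : pr P ≤ 1 :=
  hpr.true_eq ▸ hpr.mono _ _ fun _ _ => trivial

lemma eq_of_shift (hpr : IsLatticeProb pr) {P : Set Plane → ℝ → ℝ → Prop}
    (hP : ∀ A x y (a c : ℤ), P (PlanarLattice.shift a c ⁻¹' A) x y ↔ P A (x + a) (y + c))
    (x y x' y' : ℤ) : pr (fun A => P A x y) = pr fun A => P A x' y' := by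
  rw [← hpr.shift (x' - x) (y' - y) fun A => P A x y]
  simp only [hP, Int.cast_sub, add_sub_cancel]

lemma eq_of_mirror (hpr : IsLatticeProb pr) {P Q : Set Plane → ℝ → ℝ → Prop}
    (hP : ∀ A x y (a c : ℤ), P (PlanarLattice.shift a c ⁻¹' A) x y ↔ P A (x + a) (y + c))
    (hPQ : ∀ A x y, P (PlanarLattice.mirror ⁻¹' A) (-x - 1) y ↔ Q A x y) (x y x' y' : ℤ) :
    pr (fun A => Q A x y) = pr fun A => P A x' y' := by
  rw [← hpr.eq_of_shift hP (-x - 1) y x' y',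
    ← hpr.mirror fun A => P A (-x - 1 : ℤ) y]
  simp only [Int.cast_sub, Int.cast_neg, Int.cast_one, hPQ]

lemma driftLeft_eq (hpr : IsLatticeProb pr) (x y x' y' : ℤ) (h : ℝ) :
    pr (fun A => DriftLeft A x y h) = pr fun A => DriftRight A x' y' h :=
  hpr.eq_of_mirror (P := fun A x y => DriftRight A x y h) (Q := fun A x y => DriftLeft A x y h)
    (fun _ _ _ => driftRight_shift) (fun _ _ _ => driftRight_mirror) x y x' y'

lemma staysRight_eq (hpr : IsLatticeProb pr) (x y x' y' : ℤ) (h b : ℝ) :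
    pr (fun A => StaysRight A x y h b) = pr fun A => StaysLeft A x' y' h b :=
  hpr.eq_of_mirror (P := fun A x y => StaysLeft A x y h b) (Q := fun A x y => StaysRight A x y h b)
    (fun _ _ _ => staysLeft_shift) (fun _ _ _ => staysLeft_mirror) x y x' y'

lemma rightThenLeft_eq (hpr : IsLatticeProb pr) (x y x' y' : ℤ) (h b : ℝ) :
    pr (fun A => RightThenLeft A x y h b) = pr fun A => LeftThenRight A x' y' h b :=
  hpr.eq_of_mirror (P := fun A x y => LeftThenRight A x y h b)
    (Q := fun A x y => RightThenLeft A x y h b)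
    (fun _ _ _ => leftThenRight_shift) (fun _ _ _ => leftThenRight_mirror) x y x' y'

lemma pow_le_forall (hpr : IsLatticeProb pr) {P : ℕ → Set Plane → Prop}
    (hP : ∀ i, IsFinitary (P i)) {d : ℝ} (hd : 0 ≤ d) (hdP : ∀ i, d ≤ pr (P i)) (n : ℕ) :
    IsFinitary (fun A => ∀ i < n, P i A) ∧ d ^ n ≤ pr fun A => ∀ i < n, P i A := by
  induction n with
  | zero => simp [hpr.true_eq, IsFinitary.const]
  | succ n ih =>
    simp only [Nat.forall_lt_succ_right]
    refine ⟨ih.1.and (hP n), le_trans ?_ (hpr.mul_le _ _ ih.1 (hP n))⟩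
    exact mul_le_mul ih.2 (hdP n) hd (hpr.nonneg _)

lemma pow_add_le_forall (hpr : IsLatticeProb pr) {P Q : ℕ → Set Plane → Prop}
    (hP : ∀ i, IsFinitary (P i)) (hQ : ∀ i, IsFinitary (Q i)) {d : ℝ} (hd : 0 ≤ d)
    (hdP : ∀ i, d ≤ pr (P i)) (hdQ : ∀ i, d ≤ pr (Q i)) (m n : ℕ) :
    d ^ (m + n) ≤ pr fun A => (∀ i < m, P i A) ∧ ∀ i < n, Q i A := by
  obtain ⟨finP, leP⟩ := hpr.pow_le_forall hP hd hdP m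
  obtain ⟨finQ, leQ⟩ := hpr.pow_le_forall hQ hd hdQ n
  rw [pow_add]
  exact (mul_le_mul leP leQ (pow_nonneg hd n) (hpr.nonneg _)).trans (hpr.mul_le _ _ finP finQ)

lemma exists_le_sum (hpr : IsLatticeProb pr) {ι : Type*} (s : Finset ι) (P : ι → Set Plane → Prop) :
    pr (fun A => ∃ i ∈ s, P i A) ≤ ∑ i ∈ s, pr (P i) := by
  classical
  induction s using Finset.induction_on with
  | empty => simp [hpr.false_eq]
  | insert i s hi ih =>
    rw [Finset.sum_insert hi]
    simp only [Finset.exists_mem_insert]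
    exact (hpr.or_le _ _).trans (by gcongr)

variable {N h : ℕ}

lemma driftRight_pow_le (hpr : IsLatticeProb pr) (hN : h ≤ N) (x y : ℤ) :
    pr (fun A => DriftRight A x y h) ^ (4 * N + 5) ≤ pr (HasLongCurve N) := calc
  pr (fun A => DriftRight A x y h) ^ (4 * N + 5)
      ≤ pr (fun A => DriftRight A x y h) ^ (N + 2 + (N + 1)) :=
    pow_le_pow_of_le_one (hpr.nonneg _) (hpr.le_one _) (by omega)
  _ ≤ pr fun A => (∀ j < N + 2, DriftRight A (-1 + 2 * j : ℤ) (0 : ℤ) h) ∧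
        ∀ j < N + 1, DriftLeft A (-1 + 2 * j + 3 : ℤ) (0 : ℤ) h :=
    hpr.pow_add_le_forall (P := fun j A => DriftRight A (-1 + 2 * j : ℤ) (0 : ℤ) h)
      (Q := fun j A => DriftLeft A (-1 + 2 * j + 3 : ℤ) (0 : ℤ) h)
      (fun _ => isFinitary_driftRight _ _ _) (fun _ => isFinitary_driftLeft _ _ _) (hpr.nonneg _)
      (fun _ => (hpr.eq_of_shift (P := fun A x y => DriftRight A x y h)
        (fun _ _ _ => driftRight_shift) _ _ _ _).le)
      (fun _ => (hpr.driftLeft_eq _ _ _ _ _).ge) _ _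
  _ ≤ pr (HasLongCurve N) := by
    refine hpr.mono _ _ fun A ⟨hR, hL⟩ => ?_
    push_cast at hR hL
    obtain ⟨p, q, hp, hq, hpq⟩ := exists_long_of_drift (fun j hj => hR j (by omega)) hL
    push_cast at hq
    exact ⟨p, q, by linarith, by linarith, hpq.mono (slab_subset_slab A 0 (by gcongr))⟩

lemma longCrossing_pow_le (hpr : IsLatticeProb pr) (hN : h ≤ N) (x y : ℤ) :
    pr (fun A => LongCrossing A x y h) ^ (4 * N + 5) ≤ pr (HasLongCurve N) := by
  have eq_shift (x' y' : ℤ) :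
      pr (fun A => LongCrossing A x y h) = pr fun A => LongCrossing A x' y' h :=
    hpr.eq_of_shift (P := fun A x y => LongCrossing A x y h) (fun _ _ _ => longCrossing_shift)
      _ _ _ _
  calc pr (fun A => LongCrossing A x y h) ^ (4 * N + 5)
      = pr (fun A => LongCrossing A x y h) ^ (2 * N + 3 + (2 * N + 2)) := by congr 1; omega
    _ ≤ pr fun A => (∀ j < 2 * N + 3, LongCrossing A (j : ℤ) (0 : ℤ) h) ∧
          ∀ j < 2 * N + 2, LongCrossing (Prod.swap ⁻¹' A) (0 : ℤ) (j + 1 : ℤ) h :=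
      hpr.pow_add_le_forall (P := fun j A => LongCrossing A (j : ℤ) (0 : ℤ) h)
        (Q := fun j A => LongCrossing (Prod.swap ⁻¹' A) (0 : ℤ) (j + 1 : ℤ) h)
        (fun _ => isFinitary_longCrossing _ _ _)
        (fun _ => (isFinitary_longCrossing _ _ _).comap continuous_swap) (hpr.nonneg _)
        (fun _ => (eq_shift _ _).le)
        (fun j => ((eq_shift _ _).trans
          (hpr.swap fun A => LongCrossing A (0 : ℤ) (j + 1 : ℤ) h).symm).le) _ _
    _ ≤ pr (HasLongCurve N) := by
      refine hpr.mono _ _ fun A ⟨hH, hV⟩ => ?_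
      push_cast at hH hV
      obtain ⟨p, q, hp, hq, hpq⟩ := exists_long_of_longCrossing (A := A) (x := 0) (y := 0)
        (M := 2 * N + 2) (fun j hj => by simpa using hH j (by omega))
        (fun j hj => by simpa using hV j hj) h.cast_nonneg
      push_cast at hq
      exact ⟨p, q, hp.le, by linarith [h.cast_nonneg (α := ℝ)],
        hpq.mono (slab_subset_slab A 0 (by gcongr))⟩

variable {κ : ℝ}

lemma driftRight_le (hpr : IsLatticeProb pr) (hκ0 : 0 ≤ κ)
    (hκ : pr (HasLongCurve N) ≤ (κ ^ 4) ^ (4 * N + 5)) (hN : h ≤ N) (x y : ℤ) :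
    pr (fun A => DriftRight A x y h) ≤ κ ^ 4 :=
  le_of_pow_le_pow_left₀ (by omega) (pow_nonneg hκ0 4) ((hpr.driftRight_pow_le hN x y).trans hκ)

lemma longCrossing_le (hpr : IsLatticeProb pr) (hκ0 : 0 ≤ κ)
    (hκ : pr (HasLongCurve N) ≤ (κ ^ 4) ^ (4 * N + 5)) (hN : h ≤ N) (x y : ℤ) :
    pr (fun A => LongCrossing A x y h) ≤ κ ^ 4 :=
  le_of_pow_le_pow_left₀ (by omega) (pow_nonneg hκ0 4) ((hpr.longCrossing_pow_le hN x y).trans hκ)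

lemma staysLeft_le (hpr : IsLatticeProb pr) (hκ0 : 0 ≤ κ)
    (hκ : pr (HasLongCurve N) ≤ (κ ^ 4) ^ (4 * N + 5)) (h4 : 4 ≤ h) (hN : h ≤ N) (x y : ℤ) :
    pr (fun A => StaysLeft A x y h (halfWidth h)) ≤ 2 * κ ^ 2 := by
  have wide : 2 * (halfWidth h : ℝ) + 3 ≤ h := by exact_mod_cast (two_mul_halfWidth h4).1
  suffices hs : pr (fun A => StaysLeft A x y h (halfWidth h)) ^ 2 ≤ 3 * κ ^ 4 from
    le_of_pow_le_pow_left₀ two_ne_zero (by positivity) (by nlinarith [pow_nonneg hκ0 4])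
  calc pr (fun A => StaysLeft A x y h (halfWidth h)) ^ 2
      = pr (fun A => StaysLeft A x y h (halfWidth h)) *
          pr (fun A => StaysRight A (x - 3 : ℤ) y h (halfWidth h)) := by
        rw [hpr.staysRight_eq _ _ x y, sq]
    _ ≤ _ := hpr.mul_le _ _ (isFinitary_staysLeft _ _ _ _) (isFinitary_staysRight _ _ _ _)
    _ ≤ pr fun A => DriftLeft A x y h ∨ DriftRight A (x - 3 : ℤ) y h ∨
          LongCrossing (Prod.swap ⁻¹' A) y (x - 2 - halfWidth h : ℤ) (h - 1 : ℕ) := by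
        refine hpr.mono _ _ fun A ⟨hL, hR⟩ => ?_
        push_cast [Nat.cast_sub (show 1 ≤ h by omega)] at hR ⊢
        exact drift_or_long_of_stays wide hL hR
    _ ≤ κ ^ 4 + (κ ^ 4 + κ ^ 4) := by
        refine (hpr.or_le _ _).trans (add_le_add ?_ <| (hpr.or_le _ _).trans (add_le_add ?_ ?_))
        · rw [hpr.driftLeft_eq x y x y]
          exact hpr.driftRight_le hκ0 hκ hN x y
        · exact hpr.driftRight_le hκ0 hκ hN _ y
        · rw [hpr.swap fun A => LongCrossing A y (x - 2 - halfWidth h : ℤ) (h - 1 : ℕ)]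
          exact hpr.longCrossing_le hκ0 hκ (by omega) _ _
    _ = 3 * κ ^ 4 := by ring

lemma leftThenRight_le (hpr : IsLatticeProb pr) (hκ0 : 0 ≤ κ) (hκ1 : κ ≤ 1)
    (hκ : pr (HasLongCurve N) ≤ (κ ^ 4) ^ (4 * N + 5)) (h9 : 9 ≤ h) (hN : h ≤ N) (x y : ℤ) :
    pr (fun A => LeftThenRight A x y h (halfWidth h)) ≤ 3 * κ := by
  have wide : (3 : ℝ) ≤ halfWidth h := by
    have := (two_mul_halfWidth (h := h) (by omega)).2
    exact_mod_cast (by omega : (3 : ℤ) ≤ halfWidth h)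
  have κ4_le : κ ^ 4 ≤ κ ^ 2 := pow_le_pow_of_le_one hκ0 hκ1 (by omega)
  suffices hs : pr (fun A => LeftThenRight A x y h (halfWidth h)) ^ 2 ≤
      2 * κ ^ 4 + 4 * κ ^ 2 from
    le_of_pow_le_pow_left₀ two_ne_zero (by positivity) (by nlinarith)
  calc pr (fun A => LeftThenRight A x y h (halfWidth h)) ^ 2
      = pr (fun A => LeftThenRight A x y h (halfWidth h)) *
          pr (fun A => RightThenLeft A (x + 3 : ℤ) y h (halfWidth h)) := by
        rw [hpr.rightThenLeft_eq _ _ x y, sq]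
    _ ≤ _ := hpr.mul_le _ _ (isFinitary_leftThenRight _ _ _ _) (isFinitary_rightThenLeft _ _ _ _)
    _ ≤ pr fun A => DriftRight A x y h ∨ DriftLeft A (x + 3 : ℤ) y h ∨
          StaysLeft A x y h (halfWidth h) ∨ StaysRight A (x + 3 : ℤ) y h (halfWidth h) := by
        refine hpr.mono _ _ fun A ⟨hLR, hRL⟩ => ?_
        push_cast at hRL ⊢
        exact drift_or_stays_of_turns wide hLR hRL
    _ ≤ κ ^ 4 + (κ ^ 4 + (2 * κ ^ 2 + 2 * κ ^ 2)) := by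
        refine (hpr.or_le _ _).trans (add_le_add ?_ <| (hpr.or_le _ _).trans (add_le_add ?_ <|
          (hpr.or_le _ _).trans (add_le_add ?_ ?_)))
        · exact hpr.driftRight_le hκ0 hκ hN x y
        · rw [hpr.driftLeft_eq _ y x y]
          exact hpr.driftRight_le hκ0 hκ hN x y
        · exact hpr.staysLeft_le hκ0 hκ (by omega) hN x y
        · rw [hpr.staysRight_eq _ y x y]
          exact hpr.staysLeft_le hκ0 hκ (by omega) hN x y
    _ = 2 * κ ^ 4 + 4 * κ ^ 2 := by ring

lemma exceptional_le (hpr : IsLatticeProb pr) (hκ0 : 0 ≤ κ) (hκ1 : κ ≤ 1)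
    (hκ : pr (HasLongCurve N) ≤ (κ ^ 4) ^ (4 * N + 5)) (h9 : 9 ≤ h) (hN : h ≤ N) (x y : ℤ) :
    pr (fun A => Exceptional A x y h) ≤ 21 * κ := by
  have drift := hpr.driftRight_le hκ0 hκ hN x y
  have stays := hpr.staysLeft_le hκ0 hκ (by omega) hN x y
  have turns := hpr.leftThenRight_le hκ0 hκ1 hκ h9 hN x y
  have κ2_le : κ ^ 2 ≤ κ := pow_le_of_le_one hκ0 hκ1 two_ne_zero
  have κ4_le : κ ^ 4 ≤ κ := pow_le_of_le_one hκ0 hκ1 four_ne_zero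
  calc pr (fun A => Exceptional A x y h)
      ≤ pr fun A => DriftRight A x y h ∨ DriftLeft A x y h ∨ LongCrossing A x y h ∨
          StaysLeft A x y h (halfWidth h) ∨ StaysRight A x y h (halfWidth h) ∨
          LeftThenRight A x y h (halfWidth h) ∨ RightThenLeft A x y h (halfWidth h) :=
        hpr.mono _ _ fun A hA => by cases hA <;> simp only [*, true_or, or_true]
    _ ≤ κ ^ 4 + (κ ^ 4 + (κ ^ 4 + (2 * κ ^ 2 + (2 * κ ^ 2 + (3 * κ + 3 * κ))))) := by
        refine (hpr.or_le _ _).trans (add_le_add drift ?_)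
        refine (hpr.or_le _ _).trans (add_le_add ((hpr.driftLeft_eq x y x y _).trans_le drift) ?_)
        refine (hpr.or_le _ _).trans (add_le_add (hpr.longCrossing_le hκ0 hκ hN x y) ?_)
        refine (hpr.or_le _ _).trans (add_le_add stays ?_)
        refine (hpr.or_le _ _).trans
          (add_le_add ((hpr.staysRight_eq x y x y _ _).trans_le stays) ?_)
        exact (hpr.or_le _ _).trans
          (add_le_add turns ((hpr.rightThenLeft_eq x y x y _ _).trans_le turns))
    _ ≤ 21 * κ := by linarith

end IsLatticeProb

variable {A B : Set Plane} {N : ℕ}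

lemma Exceptional.exists_mem {x y : ℝ} {h : ℕ} (hA : Exceptional A x y h) :
    ∃ p ∈ A, x ≤ p.1 ∧ p.1 ≤ x + 1 ∧ y ≤ p.2 ∧ p.2 ≤ y + h := by
  have start {p q : Plane} (ends : StripEnds x y h p q) (hp : p ∈ slab A y h) :
      ∃ p ∈ A, x ≤ p.1 ∧ p.1 ≤ x + 1 ∧ y ≤ p.2 ∧ p.2 ≤ y + h :=
    ⟨p, hp.1, ends.left, ends.right, hp.2⟩
  cases hA with
  | driftRight hA | driftLeft hA =>
    obtain ⟨p, q, ends, -, hpq⟩ := hA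
    exact start ends hpq.source_mem
  | longCrossing hA =>
    obtain ⟨p, q, hp, -, hpq⟩ := hA
    exact ⟨p, hpq.source_mem.1.1, hp.ge, by linarith, hpq.source_mem.1.2⟩
  | staysLeft hA | staysRight hA =>
    obtain ⟨p, q, ends, hpq⟩ := hA
    exact start ends hpq.source_mem.1
  | leftThenRight hA | rightThenLeft hA =>
    obtain ⟨p, w, q, ends, hpw, -⟩ := hA
    exact start ends hpw.source_mem.1

lemma Exceptional.mem_Icc {x y : ℤ} {h : ℕ} (hA : Exceptional A x y h) (hN : h ≤ N) (hN' : 1 ≤ N)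
    (hAN : A ⊆ Icc (0 : ℝ) (2 * N + 2) ×ˢ Icc (0 : ℝ) (2 * N + 2)) :
    x ∈ Finset.Icc (-N : ℤ) (2 * N + 2) ∧ y ∈ Finset.Icc (-N : ℤ) (2 * N + 2) := by
  have hN1 : (1 : ℝ) ≤ N := by exact_mod_cast hN'
  have hh : (h : ℝ) ≤ N := by exact_mod_cast hN
  obtain ⟨p, hp, h1, h2, h3, h4⟩ := hA.exists_mem
  obtain ⟨⟨h5, h6⟩, h7, h8⟩ := hAN hp
  simp only [Finset.mem_Icc]
  refine ⟨⟨?_, ?_⟩, ?_, ?_⟩ <;> rify <;> linarith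

/-- The places `(x, y, h)` at which a subset of `[0, 2 * N + 2] ^ 2` can contain an exceptional
crossing of height at most `N`. -/
noncomputable def exceptionalPlaces (N : ℕ) : Finset (ℤ × ℤ × ℕ) :=
  Finset.Icc (-N : ℤ) (2 * N + 2) ×ˢ Finset.Icc (-N : ℤ) (2 * N + 2) ×ˢ Finset.Icc 20 N

lemma card_exceptionalPlaces_le (hN : 3 ≤ N) : (exceptionalPlaces N).card ≤ 16 * N ^ 3 := by
  have side : (2 * N + 2 + 1 - -N : ℤ).toNat = 3 * N + 3 := by omega
  rw [exceptionalPlaces, Finset.card_product, Finset.card_product, Int.card_Icc, Nat.card_Icc, side]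
  calc (3 * N + 3) * ((3 * N + 3) * (N + 1 - 20)) ≤ 4 * N * (4 * N * N) := by
        gcongr <;> omega
    _ = 16 * N ^ 3 := by ring

/-- `A` or its transpose contains an exceptional crossing at one of the relevant places. -/
def HasException (N : ℕ) (A : Set Plane) : Prop :=
  ∃ t ∈ exceptionalPlaces N,
    Exceptional A t.1 t.2.1 t.2.2 ∨ Exceptional (Prod.swap ⁻¹' A) t.1 t.2.1 t.2.2

lemma regular_of_forall_not_exceptional (hN : 1 ≤ N) (hBA : B ⊆ A)
    (hA : ∀ t ∈ exceptionalPlaces N, ¬ Exceptional A t.1 t.2.1 t.2.2)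
    (hB : B ⊆ Icc (0 : ℝ) (2 * N + 2) ×ˢ Icc (0 : ℝ) (2 * N + 2)) : Regular B N := by
  intro x y h h20 hhN hex
  obtain ⟨hx, hy⟩ := hex.mem_Icc hhN hN hB
  refine hA (x, y, h) ?_ (hex.mono hBA)
  simp only [exceptionalPlaces, Finset.mem_product]
  exact ⟨hx, hy, Finset.mem_Icc.2 ⟨h20, hhN⟩⟩

lemma regular_of_not_hasException (hN : 1 ≤ N) (hA : ¬ HasException N A) (hBA : B ⊆ A)
    (hB : B ⊆ Icc (0 : ℝ) (2 * N + 2) ×ˢ Icc (0 : ℝ) (2 * N + 2)) :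
    Regular B N ∧ Regular (Prod.swap ⁻¹' B) N := by
  simp only [HasException, not_exists, not_and, not_or] at hA
  exact ⟨regular_of_forall_not_exceptional hN hBA (fun t ht => (hA t ht).1) hB,
    regular_of_forall_not_exceptional hN (preimage_mono hBA) (fun t ht => (hA t ht).2)
      fun _ hv => (hB hv).symm⟩

lemma IsLatticeProb.hasException_le {pr : (Set Plane → Prop) → ℝ} (hpr : IsLatticeProb pr)
    (hN : 3 ≤ N) {κ : ℝ} (hκ0 : 0 ≤ κ) (hκ1 : κ ≤ 1)
    (hκ : pr (HasLongCurve N) ≤ (κ ^ 4) ^ (4 * N + 5)) :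
    pr (HasException N) ≤ 672 * N ^ 3 * κ := calc
  pr (HasException N) ≤ _ := hpr.exists_le_sum _ _
  _ ≤ ∑ t ∈ exceptionalPlaces N, 42 * κ := by
    refine Finset.sum_le_sum fun t ht => (hpr.or_le _ _).trans ?_
    simp only [exceptionalPlaces, Finset.mem_product, Finset.mem_Icc] at ht
    rw [hpr.swap fun A => Exceptional A t.1 t.2.1 t.2.2]
    linarith [hpr.exceptional_le hκ0 hκ1 hκ (by omega) ht.2.2.2 t.1 t.2.1]
  _ = (exceptionalPlaces N).card * (42 * κ) := by rw [Finset.sum_const, nsmul_eq_mul]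
  _ ≤ (16 * N ^ 3 : ℕ) * (42 * κ) := by gcongr; exact card_exceptionalPlaces_le hN
  _ = 672 * N ^ 3 * κ := by push_cast; ring

end ExceptionalProbability

/-! ### Rescaling -/

section Rescaling

open Set PlanarLattice MeasureTheory

variable {A : Set Plane} {u : ℝ}

/-- The dilation by `u`. -/
def scaleBy (u : ℝ) (v : Plane) : Plane := (u * v.1, u * v.2)

lemma continuous_scaleBy (u : ℝ) : Continuous (scaleBy u) := by
  unfold scaleBy
  fun_prop

lemma scaleBy_scaleBy_inv (hu : u ≠ 0) (v : Plane) : scaleBy u (scaleBy u⁻¹ v) = v := by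
  simp [scaleBy, hu]

lemma scaleBy_inv_scaleBy (hu : u ≠ 0) (v : Plane) : scaleBy u⁻¹ (scaleBy u v) = v := by
  simp [scaleBy, hu]

lemma slab_preimage_scaleBy (hu : 0 < u) (y h : ℝ) :
    slab (scaleBy u ⁻¹' A) y h = scaleBy u ⁻¹' slab A (u * y) (u * h) := by
  ext v
  simp only [slab, scaleBy, mem_inter_iff, mem_preimage, mem_ofPred_eq, ← mul_add,
    mul_le_mul_iff_right₀ hu]

lemma joinedIn_preimage_scaleBy_iff (hu : u ≠ 0) {p q : Plane} :
    JoinedIn (scaleBy u ⁻¹' A) p q ↔ JoinedIn A (scaleBy u p) (scaleBy u q) := by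
  refine ⟨fun h => joinedIn_of_mapsTo h (continuous_scaleBy u) fun _ => id, fun h => ?_⟩
  rw [← scaleBy_inv_scaleBy hu p, ← scaleBy_inv_scaleBy hu q]
  refine joinedIn_of_mapsTo h (continuous_scaleBy u⁻¹) fun v hv => ?_
  rwa [mem_preimage, scaleBy_scaleBy_inv hu]

lemma crosses_preimage_scaleBy_iff (hu : 0 < u) {y h : ℝ} {p q : Plane} :
    Crosses (scaleBy u ⁻¹' A) y h p q ↔
      Crosses A (u * y) (u * h) (scaleBy u p) (scaleBy u q) := by
  have joined :=
    joinedIn_preimage_scaleBy_iff hu.ne' (A := slab A (u * y) (u * h)) (p := p) (q := q)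
  rw [← slab_preimage_scaleBy hu] at joined
  constructor <;> rintro ⟨hp, hq, hpq⟩
  · exact ⟨by simp only [scaleBy, hp], by simp only [scaleBy, hq, mul_add], joined.1 hpq⟩
  · simp only [scaleBy, ← mul_add] at hp hq
    exact ⟨mul_left_cancel₀ hu.ne' hp, mul_left_cancel₀ hu.ne' hq, joined.2 hpq⟩

lemma HasSeparatedCrossings.of_preimage_scaleBy (hu : 0 < u) {y h : ℝ} {K : ℕ}
    (hA : HasSeparatedCrossings (scaleBy u ⁻¹' A) y h K) :
    HasSeparatedCrossings A (u * y) (u * h) K := by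
  obtain ⟨p, q, hpq, hsep⟩ := hA
  refine ⟨fun i => scaleBy u (p i), fun i => scaleBy u (q i),
    fun i => (crosses_preimage_scaleBy_iff hu).1 (hpq i), fun i j hij hp => hsep i j hij ?_⟩
  rw [slab_preimage_scaleBy hu]
  exact (joinedIn_preimage_scaleBy_iff hu.ne').2 hp

lemma PlanarLattice.IsUniqueSingleEdge.isLatticeProb {L : PlanarLattice} {p q : ℝ}
    {φ : Measure L.Config} (hφ : IsUniqueSingleEdge p q φ) (u : ℕ) :
    IsLatticeProb fun P => prob φ fun A => P (scaleBy u ⁻¹' A) where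
  nonneg _ := measureReal_nonneg
  true_eq := by have := hφ.singleEdge.1; simp [prob]
  false_eq := by simp [prob]
  mono P Q h := by
    have := hφ.singleEdge.1
    exact measureReal_mono fun ω hω => h _ hω
  or_le _ _ := measureReal_union_le _ _
  mul_le _ _ hP hQ :=
    hφ.prob_mul_le (hP.comap (continuous_scaleBy u)) (hQ.comap (continuous_scaleBy u))
  shift a c P := by
    rw [← hφ.prob_preimage (shift_mem_symmetryGroup (u * a) (u * c)) fun A => P (scaleBy u ⁻¹' A)]
    refine congrArg (prob φ) (funext fun A => congrArg P (ext fun v => ?_))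
    simp [scaleBy, mul_add]
  mirror P := by
    rw [← hφ.prob_preimage mirror_mem_symmetryGroup fun A => P (scaleBy u ⁻¹' A)]
    refine congrArg (prob φ) (funext fun A => congrArg P (ext fun v => ?_))
    simp [scaleBy]
  swap P := hφ.prob_preimage diagonal_mem_symmetryGroup fun A => P (scaleBy u ⁻¹' A)

end Rescaling

/-! ### Crossings of rectangles -/

section Rectangles

open Set PlanarLattice MeasureTheory

variable {A : Set Plane} {b d d' : ℝ} {K : ℕ}

/-- The rectangle `[0, b] × [0, d]`. -/
def rect (b d : ℝ) : Set Plane := Icc 0 b ×ˢ Icc 0 d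

/-- The part of `A` in the rectangle `[0, b] × [0, d]` contains a curve from left to right. -/
def HasHorizontalCrossing (b d : ℝ) (A : Set Plane) : Prop :=
  ∃ p q : Plane, p.1 = 0 ∧ q.1 = b ∧ JoinedIn (A ∩ rect b d) p q

/-- The part of `A` in the rectangle `[0, b] × [0, d]` contains a curve from bottom to top. -/
def HasVerticalCrossing (b d : ℝ) (A : Set Plane) : Prop :=
  ∃ p q : Plane, p.2 = 0 ∧ q.2 = d ∧ JoinedIn (A ∩ rect b d) p q

/-- The part of `A` in the rectangle `[0, b] × [0, d]` contains `K` curves from bottom to top, no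
two of which are connected in it. -/
def HasSeparatedVerticalCrossings (b d : ℝ) (K : ℕ) (A : Set Plane) : Prop :=
  ∃ p q : Fin K → Plane,
    (∀ i, (p i).2 = 0 ∧ (q i).2 = d ∧ JoinedIn (A ∩ rect b d) (p i) (q i)) ∧
    ∀ i j, i ≠ j → ¬ JoinedIn (A ∩ rect b d) (p i) (p j)

lemma Crosses.exists_lower {y h h' : ℝ} {p q : Plane} (hpq : Crosses A y h p q) (h0 : 0 ≤ h')
    (hh : h' ≤ h) : ∃ w, Crosses A y h' p w := by
  obtain ⟨w, hw, hpw, -⟩ := exists_first_visit hpq.joined continuous_snd (c := y + h')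
    (by linarith [hpq.bottom]) (by linarith [hpq.top])
  exact ⟨w, hpq.bottom, hw, hpw.mono fun v hv => ⟨hv.1.1, hv.1.2.1, hv.2⟩⟩

lemma HasSeparatedCrossings.lower {y h h' : ℝ} (hA : HasSeparatedCrossings A y h K) (h0 : 0 ≤ h')
    (hh : h' ≤ h) : HasSeparatedCrossings A y h' K := by
  obtain ⟨p, q, hpq, hsep⟩ := hA
  choose w hw using fun i => (hpq i).exists_lower h0 hh
  exact ⟨p, w, hw, fun i j hij hp => hsep i j hij (hp.mono (slab_subset_slab A y hh))⟩

lemma HasLongCurve.hasHorizontalCrossing {N : ℕ} {u n : ℝ} (hu : 0 < u) (hN : u * N ≤ n)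
    (hN' : n ≤ u * (N + 1)) (hA : HasLongCurve N (scaleBy u ⁻¹' A)) :
    HasHorizontalCrossing (2 * n) n A := by
  have hn : 0 ≤ n := (by positivity : 0 ≤ u * N).trans hN
  obtain ⟨p, q, hp, hq, hpq⟩ := hA
  rw [slab_preimage_scaleBy hu, mul_zero, joinedIn_preimage_scaleBy_iff hu.ne'] at hpq
  have left : (scaleBy u p).1 ≤ 0 := mul_nonpos_of_nonneg_of_nonpos hu.le hp
  have right : 2 * n ≤ (scaleBy u q).1 := by simp only [scaleBy]; nlinarith
  obtain ⟨y, hy, hpy, -⟩ := exists_first_visit hpq continuous_fst (c := 2 * n) (by linarith) right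
  obtain ⟨x, hx, -, hxy⟩ := exists_last_visit hpy continuous_fst (c := 0) left (by linarith)
  refine ⟨x, y, hx, hy, hxy.mono ?_⟩
  rintro v ⟨⟨⟨hv, h0, hn⟩, hright⟩, hleft⟩
  exact ⟨hv, ⟨hleft, hright⟩, h0, by linarith⟩

lemma HasSeparatedCrossings.hasSeparatedVerticalCrossings {c : ℤ} (hc : 0 ≤ c) (hd : c + d' ≤ d)
    (hA : HasSeparatedCrossings (A ∩ rect b d) c d' K) :
    HasSeparatedVerticalCrossings b d' K (shift 0 c ⁻¹' A) := by
  have hc0 : (0 : ℝ) ≤ c := by exact_mod_cast hc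
  have joined := joinedIn_iff_map (shift 0 c) (S := shift 0 c ⁻¹' A ∩ rect b d')
    (T := slab (A ∩ rect b d) c d') fun v => by
      simp only [slab, rect, mem_inter_iff, mem_preimage, mem_prod, mem_Icc, mem_ofPred_eq,
        shift_apply, Int.cast_zero, add_zero]
      grind
  obtain ⟨p, q, hpq, hsep⟩ := hA
  refine ⟨fun i => (shift 0 c).symm (p i), fun i => (shift 0 c).symm (q i), fun i => ⟨?_, ?_, ?_⟩,
    fun i j hij hp => hsep i j hij ?_⟩
  · have := congrArg Prod.snd ((shift 0 c).apply_symm_apply (p i))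
    rw [shift_apply, (hpq i).bottom] at this
    linarith
  · have := congrArg Prod.snd ((shift 0 c).apply_symm_apply (q i))
    rw [shift_apply, (hpq i).top] at this
    linarith
  · simpa only [joined, AffineEquiv.apply_symm_apply] using (hpq i).joined
  · simpa only [joined, AffineEquiv.apply_symm_apply] using hp

variable {N I : ℕ} {u n : ℝ}

lemma preimage_scaleBy_rect_subset (hu : 0 < u) (hN : n ≤ u * (N + 1)) :
    scaleBy u ⁻¹' (A ∩ rect (2 * n) n) ⊆ Icc (0 : ℝ) (2 * N + 2) ×ˢ Icc (0 : ℝ) (2 * N + 2) := by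
  rintro v ⟨-, ⟨left, right⟩, bottom, top⟩
  simp only [scaleBy] at left right bottom top
  have := nonneg_of_mul_nonneg_right bottom hu
  refine ⟨⟨nonneg_of_mul_nonneg_right left hu, ?_⟩, this, ?_⟩ <;>
    refine le_of_mul_le_mul_left ?_ hu <;> nlinarith

lemma HasVerticalCrossing.exists_crosses (hu : 0 < u) (hN : u * N ≤ n)
    (hA : HasVerticalCrossing b n A) :
    ∃ p q, Crosses (scaleBy u ⁻¹' (A ∩ rect b n)) 0 N p q := by
  obtain ⟨p, q, hp, hq, hpq⟩ := hA
  have hpq : Crosses (A ∩ rect b n) 0 n p q :=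
    ⟨hp, by rw [hq, zero_add], hpq.mono fun v hv => ⟨hv, hv.2.2.1, by simpa using hv.2.2.2⟩⟩
  obtain ⟨w, hw⟩ := hpq.exists_lower (by positivity) hN
  refine ⟨scaleBy u⁻¹ p, scaleBy u⁻¹ w, (crosses_preimage_scaleBy_iff hu).2 ?_⟩
  simpa only [scaleBy_scaleBy_inv hu.ne', mul_zero] using hw

lemma HasVerticalCrossing.hasSeparatedCrossings (hu : 0 < u) (hN : u * N ≤ n)
    (hN' : n ≤ u * (N + 1)) (hI : 1 ≤ I) (hNI : 400 * I ≤ N)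
    (hA : ¬ HasException N (scaleBy u ⁻¹' A)) (hv : HasVerticalCrossing (2 * n) n A) :
    HasSeparatedCrossings (A ∩ rect (2 * n) n) (u * (18 * I)) (n / 2) (2 ^ I) := by
  have hI' : (1 : ℝ) ≤ I := by exact_mod_cast hI
  have hNI' : 400 * (I : ℝ) ≤ N := by exact_mod_cast hNI
  obtain ⟨p, q, hpq⟩ := hv.exists_crosses hu hN
  obtain ⟨hreg, hreg'⟩ := regular_of_not_hasException (by omega) hA
    (preimage_mono inter_subset_left) (preimage_scaleBy_rect_subset (A := A) hu hN')
  have height : N - 36 * I + 36 * I = N := by omega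
  have hsep := (hreg.hasSeparatedCrossings_two_pow hreg' (y := 0) I (h := N - 36 * I) (by omega)
    height.le (p := p) (q := q) (by simpa only [height, Int.cast_zero] using hpq)
    ).of_preimage_scaleBy hu
  push_cast [show 36 * I ≤ N by omega] at hsep
  rw [zero_add] at hsep
  exact hsep.lower (by nlinarith) (by nlinarith)

lemma PlanarLattice.IsUniqueSingleEdge.verticalCrossing_le {L : PlanarLattice} {p q : ℝ}
    {φ : Measure L.Config} (hφ : IsUniqueSingleEdge p q φ) {u n : ℕ} (hu : 0 < u) (hN : u * N ≤ n)
    (hN' : n ≤ u * (N + 1)) (hI : 1 ≤ I) (hNI : 400 * I ≤ N) :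
    φ.real (L.verticalCrossing (2 * n) n) ≤
      prob φ (fun A => HasException N (scaleBy u ⁻¹' A)) +
        φ.real (L.separatedVerticalCrossings (2 * n) (n / 2) (2 ^ I)) := by
  have := hφ.singleEdge.1
  have hu' : (0 : ℝ) < u := by exact_mod_cast hu
  have hNr : (u * N : ℝ) ≤ n := by exact_mod_cast hN
  have hNI' : 400 * (I : ℝ) ≤ N := by exact_mod_cast hNI
  let c : ℤ := u * (18 * I)
  have room : c + (n : ℝ) / 2 ≤ n := by
    have : (u : ℝ) * (36 * I) ≤ u * N := by gcongr; linarith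
    push_cast [c]
    linarith
  calc φ.real (L.verticalCrossing (2 * n) n)
      ≤ prob φ fun A => HasException N (scaleBy u ⁻¹' A) ∨
          HasSeparatedVerticalCrossings (2 * n) (n / 2) (2 ^ I) (shift 0 c ⁻¹' A) := by
        refine measureReal_mono fun ω hω => or_iff_not_imp_left.2 fun hex => ?_
        refine HasSeparatedCrossings.hasSeparatedVerticalCrossings (by positivity) room ?_
        push_cast [c]
        exact HasVerticalCrossing.hasSeparatedCrossings hu' hNr (by exact_mod_cast hN') hI hNI
          hex hω
    _ ≤ prob φ (fun A => HasException N (scaleBy u ⁻¹' A)) +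
          prob φ fun A => HasSeparatedVerticalCrossings (2 * n) (n / 2) (2 ^ I)
            (shift 0 c ⁻¹' A) := measureReal_union_le _ _
    _ ≤ _ := by
        gcongr
        exact hφ.prob_preimage_le (shift_mem_symmetryGroup 0 c)
          (HasSeparatedVerticalCrossings (2 * n) (n / 2) (2 ^ I))

lemma PlanarLattice.IsUniqueSingleEdge.prob_hasException_le {L : PlanarLattice} {p q : ℝ}
    {φ : Measure L.Config} (hφ : IsUniqueSingleEdge p q φ) {u n : ℕ} (hu : 0 < u) (hN : u * N ≤ n)
    (hN' : n ≤ u * (N + 1)) (hN3 : 3 ≤ N) :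
    prob φ (fun A => HasException N (scaleBy u ⁻¹' A)) ≤
      672 * N ^ 3 * φ.real (L.horizontalCrossing (2 * n) n) ^ ((4 * (4 * N + 5) : ℕ) : ℝ)⁻¹ := by
  have := hφ.singleEdge.1
  have hph : 0 ≤ φ.real (L.horizontalCrossing (2 * n) n) := measureReal_nonneg
  refine (hφ.isLatticeProb u).hasException_le hN3 (Real.rpow_nonneg hph _)
    (Real.rpow_le_one hph measureReal_le_one (by positivity)) ?_
  rw [← pow_mul, Real.rpow_inv_natCast_pow hph (by omega)]
  exact measureReal_mono fun ω hω => HasLongCurve.hasHorizontalCrossing (by exact_mod_cast hu)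
    (by exact_mod_cast hN) (by exact_mod_cast hN') hω

end Rectangles

/-! ### Choice of the scale -/

lemma exists_scale {n I : ℕ} (hI : 1 ≤ I) (hn : 400 * I ≤ n) :
    ∃ u N : ℕ, 0 < u ∧ u * N ≤ n ∧ n ≤ u * (N + 1) ∧ 400 * I ≤ N ∧ N ≤ 800 * I := by
  have hu : 0 < n / (400 * I) := Nat.div_pos hn (by omega)
  refine ⟨n / (400 * I), n / (n / (400 * I)), hu, Nat.mul_div_le n _,
    (Nat.lt_mul_div_succ n hu).le, (Nat.le_div_iff_mul_le hu).2 (Nat.mul_div_le n _), ?_⟩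
  have := Nat.lt_mul_div_succ n (show 0 < 400 * I by omega)
  refine (Nat.div_lt_of_lt_mul ?_).le
  nlinarith

lemma mul_pow_mul_rpow_le {N I : ℕ} {a v : ℝ} (hI : 1 ≤ I) (hN : N ≤ 800 * I) (ha0 : 0 ≤ a)
    (ha1 : a ≤ 1) (hv0 : 0 ≤ v) (hv1 : v ≤ 1)
    (h : (I : ℝ) ^ 2 * a ^ (1 / 25640 / (I : ℝ)) ≤ 1 / 10000000 * v) :
    672 * N ^ 3 * a ^ ((4 * (4 * N + 5) : ℕ) : ℝ)⁻¹ ≤ 1 / 2 * v := by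
  have hI' : (1 : ℝ) ≤ I := by exact_mod_cast hI
  have hN' : (N : ℝ) ≤ 800 * I := by exact_mod_cast hN
  set t := a ^ (1 / 25640 / (I : ℝ)) with ht
  have ht0 : 0 ≤ t := Real.rpow_nonneg ha0 _
  have root_le : a ^ ((4 * (4 * N + 5) : ℕ) : ℝ)⁻¹ ≤ t ^ 2 := by
    rw [ht, ← Real.rpow_natCast, ← Real.rpow_mul ha0]
    refine Real.rpow_le_rpow_of_exponent_ge' ha0 ha1 (by positivity) ?_
    push_cast
    rw [div_div, one_div, inv_mul_eq_div, div_le_iff₀ (by positivity), inv_mul_eq_div,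
      le_div_iff₀ (by positivity)]
    linarith
  calc 672 * N ^ 3 * a ^ ((4 * (4 * N + 5) : ℕ) : ℝ)⁻¹
      ≤ 672 * (800 * I) ^ 3 * t ^ 2 := by gcongr
    _ = 672 * 800 ^ 3 * (I ^ 3 * t ^ 2) := by ring
    _ ≤ 672 * 800 ^ 3 * (I ^ 4 * t ^ 2) := by gcongr; norm_num
    _ = 672 * 800 ^ 3 * (I ^ 2 * t) ^ 2 := by ring
    _ ≤ 672 * 800 ^ 3 * (1 / 10000000 * v) ^ 2 := by
      linarith [pow_le_pow_left₀ (mul_nonneg (sq_nonneg (I : ℝ)) ht0) h 2]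
    _ = 672 * 800 ^ 3 * (1 / 10000000) ^ 2 * (v * v) := by ring
    _ ≤ 1 / 2 * v := by nlinarith

theorem lemma4p3 :
    ∃ c₀ c₁ : ℝ, 0 < c₀ ∧ 0 < c₁ ∧
      ∀ (L : PlanarLattice) (q p : ℝ), 1 ≤ q → 0 < p → p < 1 →
      ∀ φ : MeasureTheory.Measure L.Config, L.IsInfiniteVolume p q φ →
        (∀ ψ : MeasureTheory.Measure L.Config, L.IsInfiniteVolume p q ψ → ψ = φ) →
      ∀ n I : ℕ, 1 ≤ I → (I : ℝ) ≤ (n : ℝ) / 400 →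
        (I : ℝ) ^ 2 * φ.real (L.horizontalCrossing (2 * n) n) ^ (c₁ / (I : ℝ)) ≤
          c₀ * φ.real (L.verticalCrossing (2 * n) n) →
        1 / 2 * φ.real (L.verticalCrossing (2 * n) n) ≤
          φ.real (L.separatedVerticalCrossings (2 * n) ((n : ℝ) / 2) (2 ^ I)) := by
  refine ⟨1 / 10000000, 1 / 25640, by norm_num, by norm_num, ?_⟩
  intro L q p hq hp hp1 φ hφ huniq n I hI hIn hle
  have := hφ.1
  have hφ' : PlanarLattice.IsUniqueSingleEdge p q φ :=
    ⟨hp, hp1, hq, hφ.singleEdge hp hp1 hq, fun ψ hψ => huniq ψ (hψ.isInfiniteVolume hp hp1 hq)⟩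
  have hn : 400 * I ≤ n := by
    have : 400 * (I : ℝ) ≤ n := by linarith
    exact_mod_cast this
  obtain ⟨u, N, hu, hN, hN', hNI, hNI'⟩ := exists_scale hI hn
  have cover := hφ'.verticalCrossing_le hu hN hN' hI hNI
  have exception := hφ'.prob_hasException_le hu hN hN' (by omega)
  have small := mul_pow_mul_rpow_le hI hNI' MeasureTheory.measureReal_nonneg
    MeasureTheory.measureReal_le_one MeasureTheory.measureReal_nonneg
    MeasureTheory.measureReal_le_one hle
  linarith
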